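/- **Setting.** Let $n,t,d_1,d_2$ be natural numbers, $R=2^n$, $k=2^t$, $\Omega=\mathbb F_2^t$, and $\varepsilon,\eta\in(0,1)$. Let $\mathrm{RM}(n,d)$ be the Reed–Muller code of evaluations on $\mathbb F_2^n$ of $\mathbb F_2$-polynomials of degree at most $d$ (block length $R$), and let $q_d$ be a uniformly random codeword of minimum weight of $\mathrm{RM}(n,d)$ for $d\le n$, i.e. the product of $d$ uniformly random linearly independent affine forms. *The instance $\mathcal U'_{\eta,R}$.* Let $\mathcal N_\eta$ be the displacement at time $2^{d_1-1}\log\frac1{1-\eta}$ of the rate-$1$ continuous-time random walk on $\mathrm{RM}(n,d_1)$ whose jumps are independent copies of $q_{d_1}$ (each $\pm1$ coordinate then has correlation $1-\eta$ with its initial value). The vertices are the classes of $\mathrm{RM}(n,d_1)$ modulo linear forms $x\mapsto\langle r,x\rangle$, and the alphabet is $\mathbb F_2^n$, of size $R$; the label $r$ of a class stands for its unique member $c$ with $(c(e_i)-c(0))_{i}=r$. A random constraint is obtained from a uniformly random codeword $c$ and $q\sim\mathcal N_\eta$; it requires that the label of the class of $c+q$ equals the label of the class of $c$ plus $(q(e_i)-q(0))_i$.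 So the label-extended graph is the noise graph $c\sim c+q$ on $\mathrm{RM}(n,d_1)$. *The instance $\mathcal W'=\mathcal W'_{\varepsilon,k}(\mathcal U'_{\eta,R})$.* Let $\mathcal C=\mathrm{RM}(n,d_2)^t$, viewed as words $x:\mathbb F_2^n\to\Omega$. Noise on $\mathcal C$ is the displacement at time $2^{d_2}\log\frac1{1-\varepsilon}$ of the rate-$1$ continuous-time walk with jumps $w\otimes q_{d_2}$, where $w\in\Omega$ is uniform and independent of $q_{d_2}$ (each symbol is then rerandomized with probability $\varepsilon$). The vertices of $\mathcal W'$ are pairs $(v,x)$ of a vertex $v$ of $\mathcal U'$ and $x\in\mathcal C$; the alphabet is $\Omega$. A random constraint is chosen as follows: pick a uniformly random vertex $u$ of $\mathcal U'$; two independent random constraints of $\mathcal U'$ at $u$, to $v$ with shift $b$ and to $v'$ with shift $b'$; a uniform $x\in\mathcal C$, a noisy copy $y$ of $x$, and a uniform $c\in\Omega$. The constraint is $$F_{v'}\big((y-c\cdot\mathbb 1)(\cdot+b')\big)=F_v\big(x(\cdot+b)\big)+c$$ for the assignment $F_v(x)\in\Omega$ of the vertex $(v,x)$. *The relaxation.*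 A level-$8$ pseudo-expectation is a linear functional $\tilde{\mathbb E}$ on real polynomials of degree at most $8$ with $\tilde{\mathbb E}1=1$ and $\tilde{\mathbb E}P^2\ge0$ whenever $\deg P\le4$. The level-$8$ SoS value of a unique game is the supremum of $\tilde{\mathbb E}P_0$, where $P_0=\mathbb E_{(u,v,\pi)}\sum_a x_{u,a}x_{v,\pi(a)}$ is the expected fraction of satisfied constraints, over all level-$8$ pseudo-expectations in the variables $x_{v,a}$ with $\tilde{\mathbb E}(x_{v,a}^2-x_{v,a})^2=0$ and $\tilde{\mathbb E}(\sum_a x_{v,a}-1)^2=0$ for all $v,a$. **Theorem.** For every $a>0$ there are constants $c,C>0$ and a function $K:(0,\infty)\to\mathbb R$, depending only on $a$, such that the following holds for all $n,t,d_1,d_2$ with $1\le d_1\le n$, $d_2\le n$, $2^{d_1}\ge a\log_2R$ and $2^{d_2}\ge a\log_2k$, and all $\varepsilon,\eta\in(0,1)$. The level-$8$ SoS value of $\mathcal W'_{\varepsilon,k}(\mathcal U'_{\eta,R})$ is at most $$\frac1{k^{c\varepsilon}}+k^{C\log k}\cdot R^{-c\eta}.$$ In particular, for every $\nu>0$, if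 $\log R\ge K(\nu)\,(\log k)^2/\eta$, then this value is at most $(1+\nu)\,k^{-c\varepsilon}$. -/

import Mathlib

noncomputable section

/-! ### Sum-of-squares relaxations of polynomial programs -/

/-- `E` is a level-`r` pseudo-expectation functional on polynomials in the variables `σ`. Only the
values of `E` on polynomials of degree at most `r` matter; a linear functional on that subspace is
the restriction of a linear functional on all polynomials, and the latter form is used. -/
structure IsPseudoExpectation {σ : Type} (r : ℕ) (E : MvPolynomial σ ℝ →ₗ[ℝ] ℝ) : Prop where
  positivity : ∀ P : MvPolynomial σ ℝ, 2 * P.totalDegree ≤ r → 0 ≤ E (P ^ 2)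
  normalization : E 1 = 1

/-- The value of the `r`-round SoS relaxation of the program
"maximize `P₀` subject to `P ^ 2 = 0` for all `P ∈ Cs`". -/
def sosValue {σ : Type} (r : ℕ) (P₀ : MvPolynomial σ ℝ) (Cs : Set (MvPolynomial σ ℝ)) :
    EReal :=
  sSup {v : EReal | ∃ E : MvPolynomial σ ℝ →ₗ[ℝ] ℝ,
    IsPseudoExpectation r E ∧ (∀ P ∈ Cs, E (P ^ 2) = 0) ∧ v = ((E P₀ : ℝ) : EReal)}

/-! ### Unique games -/

/-- A unique game with vertex set `V` and alphabet `A`: a distribution over constraints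
`(u, v, π)`. An assignment `s : V → A` satisfies `(u, v, π)` when `s v = π (s u)`. -/
abbrev UniqueGame (V A : Type) : Type := PMF (V × V × Equiv.Perm A)

namespace UniqueGame

variable {V A : Type} [Fintype V] [Fintype A] [DecidableEq A]

/-- The expected fraction of satisfied constraints, as a polynomial in the variables `x_{v,a}`
indicating that vertex `v` is assigned the label `a`. -/
def objective (W : UniqueGame V A) : MvPolynomial (V × A) ℝ :=
  ∑ e : V × V × Equiv.Perm A, MvPolynomial.C (W e).toReal *
    ∑ a : A, MvPolynomial.X (e.1, a) * MvPolynomial.X (e.2.1, e.2.2 a)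

variable (V A) in
/-- The equations `x_{v,a}² = x_{v,a}` and `∑ₐ x_{v,a} = 1`. -/
def constraints : Set (MvPolynomial (V × A) ℝ) :=
  {P | (∃ v a, P = MvPolynomial.X (v, a) ^ 2 - MvPolynomial.X (v, a)) ∨
    ∃ v, P = ∑ a : A, MvPolynomial.X (v, a) - 1}

/-- The optimal value of the level-`r` SoS relaxation of a unique game. -/
def sosValue (r : ℕ) (W : UniqueGame V A) : EReal :=
  _root_.sosValue r W.objective (constraints V A)

end UniqueGame

/-! ### Reed–Muller codes -/

abbrev F2Vec (n : ℕ) : Type := Fin n → ZMod 2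

/-- The Reed–Muller code of degree `d`: evaluations on `𝔽₂ⁿ` of polynomials of degree at most
`d`. Its block length is `2 ^ n`. -/
def RM (n d : ℕ) : Submodule (ZMod 2) (F2Vec n → ZMod 2) :=
  (MvPolynomial.restrictTotalDegree (Fin n) (ZMod 2) d).map (MvPolynomial.evalₗ (ZMod 2) (Fin n))

theorem mem_RM {n d : ℕ} (p : MvPolynomial (Fin n) (ZMod 2)) (hp : p.totalDegree ≤ d)
    {f : F2Vec n → ZMod 2} (hf : ∀ x, MvPolynomial.eval x p = f x) : f ∈ RM n d :=
  ⟨p, (MvPolynomial.mem_restrictTotalDegree _ _ _).2 hp, funext hf⟩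

theorem const_mem_RM (n d : ℕ) (a : ZMod 2) : (fun _ => a) ∈ RM n d :=
  mem_RM (MvPolynomial.C a) (by simp) (by simp)

theorem translate_mem_RM {n d : ℕ} (b : F2Vec n) {f : F2Vec n → ZMod 2} (hf : f ∈ RM n d) :
    (fun i => f (i + b)) ∈ RM n d := by
  obtain ⟨p, hp, rfl⟩ := hf
  have hp' := (MvPolynomial.mem_restrictTotalDegree _ _ _).1 hp
  refine mem_RM (MvPolynomial.aeval
    (fun j => MvPolynomial.X j + MvPolynomial.C (b j) : Fin n → MvPolynomial (Fin n) (ZMod 2)) p)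
    ?_ ?_
  · rw [MvPolynomial.aeval_def, MvPolynomial.eval₂_eq]
    refine MvPolynomial.totalDegree_finsetSum_le fun m hm => ?_
    refine (MvPolynomial.totalDegree_mul _ _).trans ?_
    have h1 : (algebraMap (ZMod 2) (MvPolynomial (Fin n) (ZMod 2)) (p.coeff m)).totalDegree = 0 :=
      MvPolynomial.totalDegree_C _
    rw [h1, zero_add]
    refine (MvPolynomial.totalDegree_finsetProd _ _).trans ?_
    refine le_trans ?_ ((MvPolynomial.le_totalDegree hm).trans hp')
    refine Finset.sum_le_sum fun j _ => ?_
    refine (MvPolynomial.totalDegree_pow _ _).trans ?_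
    have h2 : (MvPolynomial.X j + MvPolynomial.C (b j) :
        MvPolynomial (Fin n) (ZMod 2)).totalDegree ≤ 1 := by
      refine (MvPolynomial.totalDegree_add _ _).trans ?_
      simp
    simpa using Nat.mul_le_mul_left (m j) h2
  · intro x
    rw [MvPolynomial.aeval_def, MvPolynomial.eval₂_eq, map_sum]
    simp only [MvPolynomial.algebraMap_eq, map_mul, map_prod, map_pow, map_add,
      MvPolynomial.eval_C, MvPolynomial.eval_X]
    exact (MvPolynomial.eval_eq (x + b) p).symm

instance instFintypeRM (n d : ℕ) : Fintype (RM n d) := Fintype.ofFinite _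

/-- The product of the first `d` coordinates of the affine map `x ↦ A x + z`. If `d ≤ n` then, for
a uniformly random invertible `A` and a uniformly random `z`, this is the product of `d` uniformly
random linearly independent affine forms, that is, a uniformly random codeword of minimum weight
in the Reed–Muller code of degree `d`. -/
def minWord {n : ℕ} (d : ℕ) (A : GL (Fin n) (ZMod 2)) (z : F2Vec n) : RM n d :=
  ⟨fun x => ∏ i : Fin n with i.val < d, (A.val.mulVec x + z) i, by
    refine mem_RM (∏ i : Fin n with i.val < d,
      (∑ j, MvPolynomial.C (A.val i j) * MvPolynomial.X j + MvPolynomial.C (z i))) ?_ ?_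
    · refine (MvPolynomial.totalDegree_finsetProd _ _).trans ?_
      have hcard : (Finset.univ.filter fun i : Fin n => i.val < d).card ≤ d := by
        have h := Finset.card_le_card_of_injOn (s := Finset.univ.filter fun i : Fin n => i.val < d)
          (t := Finset.range d) (fun i => i.val) (by intro i hi; simpa using hi)
          (by intro i _ j _ h; exact Fin.ext h)
        simpa using h
      refine le_trans (Finset.sum_le_card_nsmul _ _ 1 fun i _ => ?_) (by simpa using hcard)
      refine (MvPolynomial.totalDegree_add _ _).trans (max_le ?_ (by simp))
      refine MvPolynomial.totalDegree_finsetSum_le fun j _ => ?_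
      refine (MvPolynomial.totalDegree_mul _ _).trans ?_
      simp
    · intro x
      simp [Matrix.mulVec, dotProduct]⟩

/-- A uniformly random codeword of minimum weight in the Reed–Muller code of degree `d ≤ n`. -/
def rmStep (n d : ℕ) : PMF (RM n d) :=
  (PMF.uniformOfFintype (GL (Fin n) (ZMod 2) × F2Vec n)).map fun p => minWord d p.1 p.2

/-! ### Noise on Reed–Muller codes -/

/-- The sum of `m` independent samples of `step`. -/
def iidSum {M : Type} [AddCommMonoid M] (step : PMF M) : ℕ → PMF M
  | 0 => PMF.pure 0
  | m + 1 => (iidSum step m).bind fun x => step.map fun y => x + y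

/-- The displacement at time `s` of the continuous-time random walk that jumps at rate `1`
according to `step`. -/
def continuousWalk {M : Type} [AddCommMonoid M] (s : ℝ) (step : PMF M) : PMF M :=
  (ProbabilityTheory.poissonMeasure s.toNNReal).toPMF.bind (iidSum step)

/-- The noise of the graph on the degree-`d` Reed–Muller code. A jump flips any given coordinate
with probability `2 ^ (-d)`, so after time `2 ^ (d - 1) * log (1 / (1 - η))` the correlation
of each `±1` coordinate with its initial value is `1 - η`. For `d = n` this is the usual noise
graph on the cube. -/
def rmNoise (n d : ℕ) (η : ℝ) : PMF (RM n d) :=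
  continuousWalk (2 ^ d / 2 * Real.log (1 / (1 - η))) (rmStep n d)

/-- The short code over the alphabet `Ω = 𝔽₂ᵗ`: words `x : 𝔽₂ⁿ → Ω` all of whose `t` coordinate
functions have degree at most `d`; the symbol at the position `i` is `fun j => x j i`. -/
abbrev ShortCode (n d t : ℕ) : Type := Fin t → RM n d

/-- A jump adds `w ⊗ q` for a uniformly random `w ∈ Ω` and a random minimum-weight codeword `q`:
all symbols at positions in the support of `q` are shifted by `w`. -/
def shortCodeStep (n d t : ℕ) : PMF (ShortCode n d t) :=
  (PMF.uniformOfFintype (F2Vec t)).bind fun w => (rmStep n d).map fun q => fun j => w j • q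

/-- A jump replaces any given symbol by a uniformly random one with probability `2 ^ (-d)`, so after
time `2 ^ d * log (1 / (1 - ε))` each symbol has been rerandomized with probability `ε`. For
`d = n` this is the usual `ε`-noise on `Ω ^ (2 ^ n)`. -/
def shortCodeNoise (n d t : ℕ) (ε : ℝ) : PMF (ShortCode n d t) :=
  continuousWalk (2 ^ d * Real.log (1 / (1 - ε))) (shortCodeStep n d t)

/-- The constant word with all symbols equal to `c`. -/
def constWord (n d : ℕ) {t : ℕ} (c : F2Vec t) : ShortCode n d t :=
  fun j => ⟨fun _ => c j, const_mem_RM n d (c j)⟩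

/-- The word obtained by permuting positions according to the translation `i ↦ i + b`. -/
def translateWord {n d t : ℕ} (b : F2Vec n) (x : ShortCode n d t) : ShortCode n d t :=
  fun j => ⟨fun i => (x j).1 (i + b), translate_mem_RM b (x j).2⟩

/-! ### The basic instance -/

/-- The linear forms `x ↦ ⟨r, x⟩` in the Reed–Muller code of degree `d`. -/
def linForms (n d : ℕ) : Submodule (ZMod 2) (RM n d) where
  carrier := {q | ∃ r : F2Vec n, ∀ x, q.1 x = r ⬝ᵥ x}
  zero_mem' := ⟨0, by simp⟩
  add_mem' := by
    rintro p q ⟨r, hr⟩ ⟨s, hs⟩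
    exact ⟨r + s, fun x => by simp [hr, hs, add_dotProduct]⟩
  smul_mem' := by
    rintro a p ⟨r, hr⟩
    exact ⟨a • r, fun x => by simp [hr]⟩

/-- The linear map to labels `r ∈ 𝔽₂ⁿ` with `linPart (q + ⟨r, ·⟩) = linPart q + r`. -/
def linPart {n d : ℕ} (q : RM n d) : F2Vec n := fun i => q.1 (Pi.single i 1) - q.1 0

/-- The vertices of the basic instance are the classes of codewords modulo linear forms. -/
abbrev BaseVertex (n d : ℕ) : Type := RM n d ⧸ linForms n d

instance instFintypeBaseVertex (n d : ℕ) : Fintype (BaseVertex n d) := Fintype.ofFinite _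

/-- The basic instance, with alphabet `𝔽₂ⁿ` of size `R = 2 ^ n`, as the distribution of a random
constraint incident to a given vertex `u`; the pair `(v, b)` stands for the constraint that the
label of `v` is the label of `u` plus `b`. A label `r` of the vertex `u` stands for the unique
codeword `c` in the class `u` with `linPart c = r`. As a graph on pairs (vertex, label), that is, on
codewords, this is the noise graph `c ∼ c + q` of the Reed–Muller code. -/
def baseGame (n d : ℕ) (η : ℝ) : BaseVertex n d → PMF (BaseVertex n d × F2Vec n) :=
  fun u => (rmNoise n d η).map fun q => (u + (linForms n d).mkQ q, linPart q)

/-! ### The alphabet reduction -/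

/-- The short-code alphabet reduction, to the alphabet `Ω = 𝔽₂ᵗ` of size `k = 2 ^ t`, of a regular
unique game `U` whose constraints are translations of `𝔽₂ⁿ` (given as the distribution of the
constraints incident to each vertex). It is the two-query test on assignments `f_v(x) ∈ Ω`:
choose two constraints `(v, b)`, `(v', b')` at a random vertex `u`, a random codeword `x`, a
noisy copy `y = x + z` of `x` and `c ∈ Ω`, and check `f_{v'}(b'.(y - c)) = f_v(b.x) + c`. -/
def shortCodeReduction {V : Type} [Fintype V] [Nonempty V] {n : ℕ}
    (U : V → PMF (V × F2Vec n)) (d t : ℕ) (ε : ℝ) :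
    UniqueGame (V × ShortCode n d t) (F2Vec t) :=
  (PMF.uniformOfFintype V).bind fun u =>
  (U u).bind fun e =>
  (U u).bind fun e' =>
  (PMF.uniformOfFintype (ShortCode n d t)).bind fun x =>
  (shortCodeNoise n d t ε).bind fun z =>
  (PMF.uniformOfFintype (F2Vec t)).map fun c =>
    ((e.1, translateWord e.2 x), (e'.1, translateWord e'.2 (x + z - constWord n d c)),
      Equiv.addRight c)

/-- The instance with alphabet sizes `R = 2 ^ n` (of the basic instance) and `k = 2 ^ t`. -/
def shortCodeGame (n t d₁ d₂ : ℕ) (ε η : ℝ) :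
    UniqueGame (BaseVertex n d₁ × ShortCode n d₂ t) (F2Vec t) :=
  shortCodeReduction (baseGame n d₁ η) d₂ t ε

end

/-!
The value of the reduced instance is bounded in the sum-of-squares proof system by a two-query
dictatorship test on the short code, whose error term is controlled by the expansion of the basic
instance.

**Folding.** Averaging over the shift `c` in the constraints, `objective_shortCodeReduction` writes
the objective as `k 𝔼_u ⟨h_u, T h_u⟩`. Here `h_u = nbrMean U u` is the mean over the neighbours of
`u` of the folded assignments, a family of linear polynomials indexed by codewords, and `T` is the
noise operator. Since `T` is a convolution, it is diagonal in the characters of the short code. The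
character of a word `α` is contracted by `exp (-(2 ^ d log (1 / (1 - ε)) rej d α))`, where `rej d α`
is the probability that a random minimum-weight codeword is not orthogonal to `α`
(`pmfMean_shortCodeNoise`).

**The minimum-weight test.** By `rej_ge_min`, `rej d α` is at least of order `min (w / 2 ^ d) 1` when
`α` has distance `w` from the dual code, which consists of functions of low degree. The proof is by
induction over random hyperplanes, as in the analysis of the Gowers norm test for low degree. If `f`
is close to low degree on many hyperplanes, the approximations agree on intersections and glue to
one function (`exists_common_extension`); otherwise `f` is still far on most hyperplanes
(`rej_ge_of_far`). Small distances are handled by inclusion-exclusion (`rej_ge_of_near`). Hence every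
character is given by a word of weight at most `l`, or it is contracted by `decay d l ε`
(`pairHom_dichotomy`).

**Low characters.** The dual code has minimum distance `2 ^ (d + 1)`, so for `4 l < 2 ^ (d + 1)` the
fourth moments of the low part of a function are those of a function on the full product space
(`avg_pairHom_quartic`). There `quarticMean_le` is a hypercontractive inequality, proved by sums of
squares of degree `8`: the fourth moment is at most the squared norm with weights `4 ^ wt α`, plus
the sum of the squared influences with weights that grow with the alphabet. As `h_u` is an average
of boolean variables with mean `1 / k`, a small fourth moment makes its correlation with its low part
small (`IsPseudoAssignment.X_mul_le`). The outcome is `IsPseudoAssignment.nbrMean_noise_le`.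

**Influences.** A class of codewords modulo linear forms together with a label is the same as a
codeword `g` of the base code. Measuring the Fourier coefficients of the folded assignments in the
frame translated by the label, the constraints of the basic instance act on them as the noise of the
base code (`fhat_nbrMean`). The sum of the squared influences is therefore the mean square of a
square function of noisy forms, `∑ β, κ β (T f_β)²` on the base code. Its high characters are
contracted by the noise, and its low characters are spread out by hypercontractivity
(`avg_squareFunction_sq_le`). Its mean is small because a random one of the `2 ^ n` labels is a
nonzero position of a word of weight at most `l` with probability at most `l / 2 ^ n`
(`sum_infWeight_frameCoeff_le`). This gives `IsPseudoAssignment.avg_influences_le`.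

**Parameters.** With `l` and `l'` small multiples of `t` and `n`, which the hypotheses on `2 ^ d₂` and
`2 ^ d₁` permit, the high characters of the short code contribute `k ^ (-c ε)`, the low ones a
negative power of `k`, and the influences `k ^ (C log k) R ^ (-c η)` (`value_bound_le_exp`).
-/

/-! ### Functions of bounded degree on an elementary abelian 2-group -/

section Degree

variable {V W M : Type*} [AddCommGroup V] [AddCommGroup W] [AddCommGroup M]

/-- `f` has degree less than `m`: all its `m`-fold discrete derivatives vanish. -/
def DegLT : ℕ → (V → M) → Prop
  | 0, f => f = 0
  | m + 1, f => ∀ v, DegLT m (fun x => f (x + v) - f x)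

namespace DegLT

theorem zero (m : ℕ) : DegLT m (0 : V → M) := by
  induction m with
  | zero => rfl
  | succ m ih => intro v; simpa using! ih

theorem add {m : ℕ} {f g : V → M} (hf : DegLT m f) (hg : DegLT m g) : DegLT m (f + g) := by
  induction m generalizing f g with
  | zero => simp_all [DegLT]
  | succ m ih =>
    intro v
    have h := ih (hf v) (hg v)
    convert h using 1
    funext x
    simp only [Pi.add_apply]
    abel

theorem neg {m : ℕ} {f : V → M} (hf : DegLT m f) : DegLT m (-f) := by
  induction m generalizing f with
  | zero => simp_all [DegLT]
  | succ m ih =>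
    intro v
    convert ih (hf v) using 1
    funext x
    simp only [Pi.neg_apply]
    abel

theorem sub {m : ℕ} {f g : V → M} (hf : DegLT m f) (hg : DegLT m g) : DegLT m (f - g) := by
  rw [sub_eq_add_neg]; exact hf.add hg.neg

theorem succ {m : ℕ} {f : V → M} (hf : DegLT m f) : DegLT (m + 1) f := by
  induction m generalizing f with
  | zero => intro v; simp_all [DegLT]; rfl
  | succ m ih => intro v; exact ih (hf v)

theorem mono {m m' : ℕ} (h : m ≤ m') {f : V → M} (hf : DegLT m f) : DegLT m' f := by
  induction h with
  | refl => exact hf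
  | step _ ih => exact ih.succ

theorem sum {ι : Type*} {m : ℕ} (s : Finset ι) {f : ι → V → M} (hf : ∀ i ∈ s, DegLT m (f i)) :
    DegLT m (∑ i ∈ s, f i) := by
  classical
  induction s using Finset.induction_on with
  | empty => simpa using zero m
  | insert i s hi ih =>
    rw [Finset.sum_insert hi]
    exact (hf i (by simp)).add (ih fun j hj => hf j (by simp [hj]))

/-- The degree does not increase under composition with an affine map. -/
theorem comp {m : ℕ} {f : V → M} (hf : DegLT m f) (φ : W → V)
    (hφ : ∀ v, ∃ w, ∀ x, φ (x + v) = φ x + w) : DegLT m (fun x => f (φ x)) := by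
  induction m generalizing f with
  | zero => simp_all [DegLT]; rfl
  | succ m ih =>
    intro v
    obtain ⟨w, hw⟩ := hφ v
    simp only [hw]
    exact ih (hf w)

theorem const (a : M) : DegLT 1 (fun _ : V => a) := by
  intro v
  simp [DegLT]; rfl

/-- A nonzero function of degree less than `m` is nonzero on at least a `2 ^ (1 - m)` fraction
of the points. -/
theorem card_support [Fintype V] [DecidableEq M] {m : ℕ} {f : V → M} (hf : DegLT m f)
    (h0 : f ≠ 0) :
    2 * Fintype.card V ≤ 2 ^ m * (Finset.univ.filter fun x => f x ≠ 0).card := by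
  induction m generalizing f with
  | zero => exact absurd hf h0
  | succ m ih =>
    by_cases h : ∃ v, (fun x => f (x + v) - f x) ≠ 0
    · obtain ⟨v, hv⟩ := h
      refine (ih (hf v) hv).trans ?_
      rw [pow_succ, mul_assoc]
      refine Nat.mul_le_mul_left _ ?_
      classical
      have hsub : (Finset.univ.filter fun x => f (x + v) - f x ≠ 0) ⊆
          (Finset.univ.filter fun x => f (x + v) ≠ 0) ∪
            (Finset.univ.filter fun x => f x ≠ 0) := by
        intro x
        simp only [Finset.mem_filter, Finset.mem_univ, true_and, Finset.mem_union]
        intro hx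
        by_contra hcon
        push Not at hcon
        exact hx (by rw [hcon.1, hcon.2, sub_zero])
      have hcard : (Finset.univ.filter fun x => f (x + v) ≠ 0).card =
          (Finset.univ.filter fun x => f x ≠ 0).card := by
        refine Finset.card_bij (fun x _ => x + v) ?_ ?_ ?_
        · intro x hx; simpa using hx
        · intro x _ y _ hxy; exact add_right_cancel hxy
        · intro y hy; exact ⟨y - v, by simpa using hy, by simp⟩
      have := (Finset.card_le_card hsub).trans (Finset.card_union_le _ _)
      omega
    · push Not at h
      have hc : ∀ x, f x = f 0 := fun x => by
        have := congrFun (h x) 0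
        simpa [sub_eq_zero] using this
      have hne : f 0 ≠ 0 := fun h => h0 (funext fun x => (hc x).trans h)
      have : (Finset.univ.filter fun x => f x ≠ 0) = Finset.univ := by
        ext x; simp [hc x, hne]
      rw [this, Finset.card_univ, pow_succ, mul_assoc]
      exact Nat.le_mul_of_pos_left _ (by positivity)

variable [Module (ZMod 2) M]

/-- Degrees add under products, by the Leibniz rule for discrete derivatives. -/
theorem smul {a b : ℕ} {s : V → ZMod 2} {f : V → M} (hs : DegLT (a + 1) s) (hf : DegLT b f) :
    DegLT (a + b) (fun x => s x • f x) := by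
  induction hn : a + b using Nat.strong_induction_on generalizing a b s f with
  | _ N ih =>
  cases b with
  | zero =>
    have : (fun x => s x • f x) = 0 := by
      funext x
      have : f = 0 := hf
      simp [this]
    rw [this]; exact zero _
  | succ b =>
    subst hn
    intro v
    have key : (fun x => s (x + v) • f (x + v) - s x • f x) =
        (fun x => (s (x + v) - s x) • f x) + (fun x => s x • (f (x + v) - f x)) +
        (fun x => (s (x + v) - s x) • (f (x + v) - f x)) := by
      funext x
      simp only [Pi.add_apply, sub_smul, smul_sub]
      abel
    rw [key]
    have h2 : DegLT (a + b) (fun x => s x • (f (x + v) - f x)) :=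
      ih (a + b) (by omega) hs (hf v) rfl
    cases a with
    | zero =>
      have h0 : (fun x => s (x + v) - s x) = 0 := hs v
      have h0' : ∀ x, s (x + v) - s x = 0 := fun x => congrFun h0 x
      have e1 : (fun x => (s (x + v) - s x) • f x) = 0 := by funext x; simp [h0']
      have e2 : (fun x => (s (x + v) - s x) • (f (x + v) - f x)) = 0 := by funext x; simp [h0']
      rw [e1, e2]
      exact ((zero _).add h2).add (zero _)
    | succ a =>
      have h1 : DegLT (a + (b + 1)) (fun x => (s (x + v) - s x) • f x) :=
        ih (a + (b + 1)) (by omega) (hs v) hf rfl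
      have h3 : DegLT (a + b) (fun x => (s (x + v) - s x) • (f (x + v) - f x)) :=
        ih (a + b) (by omega) (hs v) (hf v) rfl
      exact ((h1.mono (by omega)).add h2).add (h3.mono (by omega))

end DegLT

theorem sum_F2Vec_succ {n : ℕ} (f : F2Vec (n + 1) → M) :
    ∑ x, f x = ∑ y : F2Vec n, (f (Fin.cons 0 y : F2Vec (n + 1)) +
      f (Fin.cons 1 y : F2Vec (n + 1))) := by
  rw [← (Fin.consEquiv (fun _ : Fin (n + 1) => ZMod 2)).sum_comp, Fintype.sum_prod_type]
  have : (Finset.univ : Finset (ZMod 2)) = {0, 1} := rfl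
  rw [this, Finset.sum_pair (by decide), ← Finset.sum_add_distrib]
  rfl

variable [Module (ZMod 2) M]

theorem add_self_of_module_two (x : M) : x + x = 0 := by
  rw [← two_smul (ZMod 2) x, show (2 : ZMod 2) = 0 from rfl, zero_smul]

theorem sub_eq_add_of_module_two (x y : M) : x - y = x + y := by
  rw [sub_eq_iff_eq_add, add_assoc, add_self_of_module_two, add_zero]

theorem degLT_dotProduct {n : ℕ} (l : F2Vec n) (c : ZMod 2) :
    DegLT 2 (fun x : F2Vec n => l ⬝ᵥ x + c) := by
  intro v
  have : (fun x : F2Vec n => l ⬝ᵥ (x + v) + c - (l ⬝ᵥ x + c)) = fun _ => l ⬝ᵥ v := by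
    funext x; rw [dotProduct_add]; ring
  rw [this]; exact DegLT.const _

theorem degLT_prod {ι : Type*} (s : Finset ι) (f : ι → V → ZMod 2)
    (hf : ∀ i ∈ s, DegLT 2 (f i)) : DegLT (s.card + 1) (fun x => ∏ i ∈ s, f i x) := by
  classical
  induction s using Finset.induction_on with
  | empty => simpa using DegLT.const _
  | insert i s hi ih =>
    simp only [Finset.prod_insert hi, Finset.card_insert_of_notMem hi]
    have := DegLT.smul (a := 1) (hf i (by simp)) (ih fun j hj => hf j (by simp [hj]))
    exact this.mono (by omega)

/-- A function of degree less than `n` on `𝔽₂ⁿ` sums to zero. -/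
theorem DegLT.sum_eq_zero {n : ℕ} {f : F2Vec n → M} (hf : DegLT n f) : ∑ x, f x = 0 := by
  induction n with
  | zero => have : f = 0 := hf
            simp [this]
  | succ n ih =>
    rw [sum_F2Vec_succ]
    have h := (hf (Fin.cons 1 0 : F2Vec (n + 1))).comp
      (fun y : F2Vec n => (Fin.cons 0 y : F2Vec (n + 1)))
      (fun v => ⟨Fin.cons 0 v, fun x => by
        funext i; refine Fin.cases ?_ (fun j => ?_) i <;> simp⟩)
    rw [← ih h]
    refine Finset.sum_congr rfl fun y _ => ?_
    have : (Fin.cons 0 y + Fin.cons 1 0 : F2Vec (n + 1)) = Fin.cons 1 y := by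
      funext i; refine Fin.cases ?_ (fun j => ?_) i <;> simp
    rw [this, sub_eq_add_of_module_two, add_comm]

/-- The point mass at `0` is the product of the `n` affine forms `x i + 1`. -/
theorem degLT_single_zero (n : ℕ) :
    DegLT (n + 1) (fun x : F2Vec n => if x = 0 then (1 : ZMod 2) else 0) := by
  have h := degLT_prod (V := F2Vec n) Finset.univ (fun (i : Fin n) x => Pi.single i 1 ⬝ᵥ x + 1)
    (fun i _ => degLT_dotProduct _ _)
  rw [Finset.card_univ, Fintype.card_fin] at h
  convert h using 1
  funext x
  split_ifs with hx
  · simp [hx]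
  · obtain ⟨i, hi⟩ : ∃ i, x i ≠ 0 := by
      by_contra hcon; push Not at hcon; exact hx (funext hcon)
    refine (Finset.prod_eq_zero (Finset.mem_univ i) ?_).symm
    rw [single_one_dotProduct]
    revert hi; generalize x i = a; revert a; decide

/-- The converse of `DegLT.sum_eq_zero`: such a function is a combination of the differences of
point masses, which are derivatives of the point mass at `0`. -/
theorem degLT_of_sum_eq_zero {n : ℕ} {f : F2Vec n → M} (hf : ∑ x, f x = 0) : DegLT n f := by
  have key : f = ∑ a : F2Vec n, fun x => ((if x + a = 0 then (1 : ZMod 2) else 0) -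
      (if x = 0 then (1 : ZMod 2) else 0)) • f a := by
    funext x
    simp only [Finset.sum_apply, sub_smul, Finset.sum_sub_distrib, ← Finset.smul_sum, hf,
      smul_zero, sub_zero]
    rw [Finset.sum_eq_single x]
    · rw [if_pos (add_self_of_module_two x), one_smul]
    · intro b _ hb
      rw [if_neg, zero_smul]
      intro h
      rw [← sub_eq_add_of_module_two, sub_eq_zero] at h
      exact hb h.symm
    · simp
  rw [key]
  refine DegLT.sum _ fun a _ => ?_
  cases n with
  | zero =>
    show _ = _
    funext x
    rw [if_pos (Subsingleton.elim _ _), if_pos (Subsingleton.elim _ _), sub_self, zero_smul]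
    rfl
  | succ n => exact DegLT.smul (b := 1) (degLT_single_zero (n + 1) a) (DegLT.const _) |>.mono le_rfl

end Degree

/-! ### Gluing functions of bounded degree along hyperplanes -/

section Gluing

variable {N : ℕ} {M : Type*} [AddCommGroup M]

/-- The vectors `e j` are dual to the linear forms `j ∈ J`. -/
def DualSystem (J : Finset (F2Vec N)) (e : F2Vec N → F2Vec N) : Prop :=
  ∀ i ∈ J, ∀ j ∈ J, i ⬝ᵥ e j = if i = j then 1 else 0

theorem DualSystem.subset {J J' : Finset (F2Vec N)} {e : F2Vec N → F2Vec N}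
    (h : DualSystem J e) (hJ : J' ⊆ J) : DualSystem J' e :=
  fun i hi j hj => h i (hJ hi) j (hJ hj)

theorem zmod_two_eq_one {a : ZMod 2} (h : a ≠ 0) : a = 1 := by
  revert a; decide

theorem zmod_two_add_self (a : ZMod 2) : a + a = 0 := by
  revert a; decide

theorem zmod_two_eq_add_one {a b : ZMod 2} (h : a ≠ b) : a = b + 1 := by
  revert a b; decide

theorem exists_dotProduct_eq_one {v : F2Vec N} (hv : v ≠ 0) : ∃ e : F2Vec N, v ⬝ᵥ e = 1 := by
  obtain ⟨i, hi⟩ : ∃ i, v i ≠ 0 := by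
    by_contra hcon; push Not at hcon; exact hv (funext hcon)
  exact ⟨Pi.single i 1, by rw [dotProduct_single_one]; exact zmod_two_eq_one hi⟩

/-- A dual system can be enlarged by any form outside the span of its forms. -/
theorem DualSystem.insert {J : Finset (F2Vec N)} {e : F2Vec N → F2Vec N} (h : DualSystem J e)
    {L : F2Vec N} (hL : L ≠ ∑ j ∈ J, (L ⬝ᵥ e j) • j) :
    L ∉ J ∧ ∃ e', DualSystem (insert L J) e' := by
  have hLJ : L ∉ J := by
    intro hmem
    apply hL
    rw [Finset.sum_eq_single L]
    · rw [h L hmem L hmem, if_pos rfl, one_smul]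
    · intro j hj hne
      rw [h L hmem j hj, if_neg hne.symm, zero_smul]
    · exact fun h => absurd hmem h
  refine ⟨hLJ, ?_⟩
  obtain ⟨e0, he0⟩ := exists_dotProduct_eq_one (sub_ne_zero.2 hL)
  set e1 : F2Vec N := e0 - ∑ j ∈ J, (j ⬝ᵥ e0) • e j with he1
  have h1 : ∀ i ∈ J, i ⬝ᵥ e1 = 0 := by
    intro i hi
    rw [he1, dotProduct_sub, dotProduct_sum, Finset.sum_eq_single i]
    · rw [dotProduct_smul, h i hi i hi, if_pos rfl]; simp
    · intro j hj hne
      rw [dotProduct_smul, h i hi j hj, if_neg hne.symm, smul_zero]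
    · exact fun h => absurd hi h
  have h2 : L ⬝ᵥ e1 = 1 := by
    rw [he1, dotProduct_sub, dotProduct_sum, ← he0, sub_dotProduct, sum_dotProduct]
    congr 1
    refine Finset.sum_congr rfl fun j _ => ?_
    rw [dotProduct_smul, smul_dotProduct, smul_eq_mul, smul_eq_mul, mul_comm]
  refine ⟨fun j => if j = L then e1 else e j - (L ⬝ᵥ e j) • e1, ?_⟩
  intro i hi j hj
  by_cases hjL : j = L
  · subst hjL
    simp only [if_true]
    rcases Finset.mem_insert.1 hi with rfl | hi'
    · simp [h2]
    · have hne : i ≠ j := by rintro rfl; exact hLJ hi'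
      rw [h1 i hi', if_neg hne]
  · have hjJ : j ∈ J := (Finset.mem_insert.1 hj).resolve_left hjL
    simp only [if_neg hjL]
    rw [dotProduct_sub, dotProduct_smul]
    rcases Finset.mem_insert.1 hi with rfl | hi
    · rw [h2, if_neg (Ne.symm hjL)]; simp
    · rw [h1 i hi, smul_zero, sub_zero, h i hi j hjJ]

/-- Among `2 ^ r` nonzero forms there are `r + 1` independent ones, as the span of `r` forms has fewer
than `2 ^ r` nonzero elements. -/
theorem exists_dualSystem {S : Finset (F2Vec N)} (h0 : (0 : F2Vec N) ∉ S) {r : ℕ}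
    (hS : 2 ^ r ≤ S.card) : ∃ J ⊆ S, J.card = r + 1 ∧ ∃ e, DualSystem J e := by
  classical
  suffices H : ∀ l ≤ r + 1, ∃ J ⊆ S, J.card = l ∧ ∃ e, DualSystem J e from H _ le_rfl
  intro l
  induction l with
  | zero => exact fun _ => ⟨∅, by simp, rfl, 0, by intro i hi; simp at hi⟩
  | succ l ih =>
    intro hl
    obtain ⟨J, hJS, hJ, e, he⟩ := ih (by omega)
    -- the span of `J` has at most `2 ^ l` elements, one of which is `0 ∉ S`
    have hex : ∃ L ∈ S, L ≠ ∑ j ∈ J, (L ⬝ᵥ e j) • j := by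
      by_contra hcon
      push Not at hcon
      have hsub : S ⊆ (J.powerset.image fun T => ∑ j ∈ T, j).erase 0 := by
        intro L hL
        refine Finset.mem_erase.2 ⟨fun h => h0 (h ▸ hL), Finset.mem_image.2
          ⟨J.filter fun j => L ⬝ᵥ e j ≠ 0, by simp, ?_⟩⟩
        rw [Finset.sum_filter]
        conv_rhs => rw [hcon L hL]
        refine Finset.sum_congr rfl fun j _ => ?_
        split_ifs with h
        · rw [zmod_two_eq_one h, one_smul]
        · rw [not_not.1 h, zero_smul]
      have hc := Finset.card_le_card hsub
      rw [Finset.card_erase_of_mem (Finset.mem_image.2 ⟨∅, by simp, by simp⟩)] at hc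
      have hi := Finset.card_image_le (s := J.powerset) (f := fun T => ∑ j ∈ T, j)
      rw [Finset.card_powerset, hJ] at hi
      have : 2 ^ l ≤ 2 ^ r := Nat.pow_le_pow_right (by norm_num) (by omega)
      have : 0 < 2 ^ r := by positivity
      omega
    obtain ⟨L, hLS, hL⟩ := hex
    obtain ⟨hn, e', he'⟩ := he.insert hL
    exact ⟨insert L J, Finset.insert_subset hLS hJS, by rw [Finset.card_insert_of_notMem hn, hJ],
      e', he'⟩

/-- The projection onto the hyperplane `l ⬝ᵥ x = c` along a vector `e` with `l ⬝ᵥ e = 1`. -/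
def hyperProj (l : F2Vec N) (c : ZMod 2) (e x : F2Vec N) : F2Vec N := x + (l ⬝ᵥ x + c) • e

theorem hyperProj_add (l : F2Vec N) (c : ZMod 2) (e v : F2Vec N) :
    ∃ w, ∀ x, hyperProj l c e (x + v) = hyperProj l c e x + w := by
  refine ⟨v + (l ⬝ᵥ v) • e, fun x => ?_⟩
  simp only [hyperProj, dotProduct_add, add_smul]
  abel

theorem dotProduct_hyperProj {l e : F2Vec N} (c : ZMod 2) (h : l ⬝ᵥ e = 1) (x : F2Vec N) :
    l ⬝ᵥ hyperProj l c e x = c := by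
  rw [hyperProj, dotProduct_add, dotProduct_smul, h, smul_eq_mul, mul_one, ← add_assoc,
    zmod_two_add_self, zero_add]

theorem dotProduct_hyperProj_of_eq_zero {l e i : F2Vec N} (c : ZMod 2) (h : i ⬝ᵥ e = 0)
    (x : F2Vec N) : i ⬝ᵥ hyperProj l c e x = i ⬝ᵥ x := by
  rw [hyperProj, dotProduct_add, dotProduct_smul, h, smul_zero, add_zero]

theorem hyperProj_of_mem {l x : F2Vec N} {c : ZMod 2} (e : F2Vec N) (h : l ⬝ᵥ x = c) :
    hyperProj l c e x = x := by
  rw [hyperProj, h, zmod_two_add_self, zero_smul, add_zero]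

/-- Compatible functions of degree less than `m` on independent hyperplanes have a common extension
of degree less than `m`. -/
theorem exists_glue {m : ℕ} {J : Finset (F2Vec N)} {e : F2Vec N → F2Vec N} (he : DualSystem J e)
    (c : F2Vec N → ZMod 2) (P : F2Vec N → F2Vec N → M) (hP : ∀ j ∈ J, DegLT m (P j))
    (hc : ∀ i ∈ J, ∀ j ∈ J, ∀ x, i ⬝ᵥ x = c i → j ⬝ᵥ x = c j → P i x = P j x) :
    ∃ Q : F2Vec N → M, DegLT m Q ∧ ∀ j ∈ J, ∀ x, j ⬝ᵥ x = c j → Q x = P j x := by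
  classical
  induction J using Finset.induction_on with
  | empty => exact ⟨0, DegLT.zero m, by simp⟩
  | insert j J hj ih =>
    obtain ⟨Q, hQ, hQJ⟩ := ih (he.subset (Finset.subset_insert _ _))
      (fun i hi => hP i (by simp [hi])) (fun i hi k hk => hc i (by simp [hi]) k (by simp [hk]))
    have hPj := hP j (by simp)
    refine ⟨Q + fun x => (P j - Q) (hyperProj j (c j) (e j) x),
      hQ.add ((hPj.sub hQ).comp _ (hyperProj_add _ _ _)), ?_⟩
    have hjj : j ⬝ᵥ e j = 1 := by rw [he j (by simp) j (by simp), if_pos rfl]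
    intro i hi x hx
    rcases Finset.mem_insert.1 hi with rfl | hi'
    · simp [hyperProj_of_mem _ hx]
    · have hij : i ⬝ᵥ e j = 0 := by
        rw [he i hi j (by simp), if_neg]; rintro rfl; exact hj hi'
      have h1 : i ⬝ᵥ hyperProj j (c j) (e j) x = c i := by
        rw [dotProduct_hyperProj_of_eq_zero _ hij, hx]
      simp only [Pi.add_apply, Pi.sub_apply]
      rw [hQJ i hi' _ h1, hc j (by simp) i hi _ (dotProduct_hyperProj _ hjj x) h1, sub_self,
        add_zero, hQJ i hi' x hx]

/-- A function of degree less than `m` that vanishes on `m` independent hyperplanes vanishes. -/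
theorem DegLT.eq_zero_of_hyperplanes {m : ℕ} {g : F2Vec N → M} (hg : DegLT m g)
    {J : Finset (F2Vec N)} {e : F2Vec N → F2Vec N} (he : DualSystem J e) (hm : m ≤ J.card)
    (c : F2Vec N → ZMod 2) (h0 : ∀ j ∈ J, ∀ x, j ⬝ᵥ x = c j → g x = 0) : g = 0 := by
  classical
  induction m generalizing g J with
  | zero => exact hg
  | succ m ih =>
    obtain ⟨j, hj⟩ : J.Nonempty := Finset.card_pos.1 (by omega)
    have h := ih (hg (e j)) (he.subset (Finset.erase_subset j J))
      (by rw [Finset.card_erase_of_mem hj]; omega) (by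
        intro i hi x hx
        have hij : i ⬝ᵥ e j = 0 := by
          rw [he i (Finset.mem_of_mem_erase hi) j hj, if_neg (Finset.ne_of_mem_erase hi)]
        rw [h0 i (Finset.mem_of_mem_erase hi) x hx, h0 i (Finset.mem_of_mem_erase hi) (x + e j)
          (by rw [dotProduct_add, hij, hx, add_zero]), sub_zero])
    funext x
    by_cases hx : j ⬝ᵥ x = c j
    · exact h0 j hj x hx
    · have h1 := congrFun h x
      simp only [Pi.zero_apply, sub_eq_zero] at h1
      rw [← h1]
      refine h0 j hj _ ?_
      rw [dotProduct_add, he j hj j hj, if_pos rfl, zmod_two_eq_add_one hx, add_assoc,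
        zmod_two_add_self, add_zero]

/-- A function of degree less than `m` on a hyperplane that vanishes on its intersections with
`m + 1` independent hyperplanes vanishes on the hyperplane. -/
theorem DegLT.eq_zero_on_hyperplane {m : ℕ} {g : F2Vec N → M} (hg : DegLT m g)
    {J : Finset (F2Vec N)} {e : F2Vec N → F2Vec N} (he : DualSystem J e) (hm : m + 1 ≤ J.card)
    (c : F2Vec N → ZMod 2) {L : F2Vec N} (hL : L ≠ 0) (a : ZMod 2)
    (h0 : ∀ j ∈ J, ∀ x, L ⬝ᵥ x = a → j ⬝ᵥ x = c j → g x = 0) {x : F2Vec N} (hx : L ⬝ᵥ x = a) :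
    g x = 0 := by
  classical
  -- a direction transversal to `L` and parallel to all but one of the hyperplanes of `J`
  have key : ∃ v : F2Vec N, L ⬝ᵥ v = 1 ∧ ∃ J' ⊆ J, m ≤ J'.card ∧ ∀ j ∈ J', j ⬝ᵥ v = 0 := by
    by_cases h : ∃ j ∈ J, L ⬝ᵥ e j ≠ 0
    · obtain ⟨j, hj, hLj⟩ := h
      refine ⟨e j, zmod_two_eq_one hLj, J.erase j, Finset.erase_subset _ _,
        by rw [Finset.card_erase_of_mem hj]; omega, fun i hi => ?_⟩
      rw [he i (Finset.mem_of_mem_erase hi) j hj, if_neg (Finset.ne_of_mem_erase hi)]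
    · push Not at h
      obtain ⟨e0, he0⟩ := exists_dotProduct_eq_one hL
      refine ⟨e0 - ∑ j ∈ J, (j ⬝ᵥ e0) • e j, ?_, J, subset_rfl, by omega, fun i hi => ?_⟩
      · rw [dotProduct_sub, dotProduct_sum, Finset.sum_eq_zero, he0, sub_zero]
        intro j hj
        rw [dotProduct_smul, h j hj, smul_zero]
      · rw [dotProduct_sub, dotProduct_sum, Finset.sum_eq_single i]
        · rw [dotProduct_smul, he i hi i hi, if_pos rfl]; simp
        · intro j hj hne
          rw [dotProduct_smul, he i hi j hj, if_neg hne.symm, smul_zero]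
        · exact fun h => absurd hi h
  obtain ⟨v, hv, J', hJ', hmJ', hv'⟩ := key
  have h1 := (hg.comp _ (hyperProj_add L a v)).eq_zero_of_hyperplanes (he.subset hJ') hmJ' c
    fun j hj y hy => h0 j (hJ' hj) _ (dotProduct_hyperProj _ hv y)
      (by rw [dotProduct_hyperProj_of_eq_zero _ (hv' j hj), hy])
  have h2 := congrFun h1 x
  simpa [hyperProj_of_mem v hx] using h2

/-- Compatible functions of degree less than `m` on at least `2 ^ m` hyperplanes with distinct
directions come from one function of degree less than `m`. -/
theorem exists_common_extension {m : ℕ} {S : Finset (F2Vec N)} (h0 : (0 : F2Vec N) ∉ S)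
    (hS : 2 ^ m ≤ S.card) (I : Set (F2Vec N × ZMod 2)) (hI : ∀ i ∈ I, i.1 ∈ S)
    (c : F2Vec N → ZMod 2) (hIc : ∀ l ∈ S, (l, c l) ∈ I)
    (P : F2Vec N × ZMod 2 → F2Vec N → M) (hP : ∀ i ∈ I, DegLT m (P i))
    (hc : ∀ i ∈ I, ∀ j ∈ I, ∀ x, i.1 ⬝ᵥ x = i.2 → j.1 ⬝ᵥ x = j.2 → P i x = P j x) :
    ∃ Q : F2Vec N → M, DegLT m Q ∧ ∀ i ∈ I, ∀ x, i.1 ⬝ᵥ x = i.2 → Q x = P i x := by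
  obtain ⟨J, hJS, hJ, e, he⟩ := exists_dualSystem h0 hS
  obtain ⟨Q, hQ, hQJ⟩ := exists_glue he c (fun l => P (l, c l)) (fun j hj => hP _ (hIc j (hJS hj)))
    (fun i hi j hj => hc _ (hIc i (hJS hi)) _ (hIc j (hJS hj)))
  refine ⟨Q, hQ, fun i hi x hx => ?_⟩
  have hne : i.1 ≠ 0 := fun h => h0 (h ▸ hI i hi)
  have := (hQ.sub (hP i hi)).eq_zero_on_hyperplane he hJ.ge c hne i.2 (fun j hj y hy hy' => by
    rw [Pi.sub_apply, hQJ j hj y hy', hc _ (hIc j (hJS hj)) i hi y hy' hy, sub_self]) hx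
  simpa [sub_eq_zero] using this

end Gluing

/-! ### The minimum-weight test for low degree -/

section Rejection

open scoped BigOperators
open Matrix

theorem expect_nonneg' {ι : Type*} [Fintype ι] {f : ι → ℝ} (h : ∀ i, 0 ≤ f i) : 0 ≤ 𝔼 i, f i :=
  Finset.expect_nonneg fun i _ => h i

theorem expect_mono {ι : Type*} [Fintype ι] {f g : ι → ℝ} (h : ∀ i, f i ≤ g i) :
    𝔼 i, f i ≤ 𝔼 i, g i :=
  Finset.expect_le_expect fun i _ => h i

theorem expect_prod {ι κ : Type*} [Fintype ι] [Fintype κ] (f : ι × κ → ℝ) :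
    𝔼 p, f p = 𝔼 i, 𝔼 j, f (i, j) := by
  rw [← Finset.univ_product_univ, Finset.expect_product]

variable {n : ℕ}

/-- The matrix acting as `A` on all coordinates but the first, which it fixes. -/
def consMatrix (A : Matrix (Fin n) (Fin n) (ZMod 2)) :
    Matrix (Fin (n + 1)) (Fin (n + 1)) (ZMod 2) :=
  Matrix.of (Fin.cons (Fin.cons 1 0) fun i => Fin.cons 0 (A i))

theorem consMatrix_mulVec (A : Matrix (Fin n) (Fin n) (ZMod 2)) (x : F2Vec (n + 1)) :
    consMatrix A *ᵥ x = Fin.cons (x 0) (A *ᵥ Fin.tail x) := by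
  funext i
  refine Fin.cases ?_ (fun j => ?_) i
  · simp [consMatrix, mulVec, dotProduct, Fin.sum_univ_succ]
  · simp [consMatrix, mulVec, dotProduct, Fin.sum_univ_succ, Fin.tail]

theorem consMatrix_mul (A B : Matrix (Fin n) (Fin n) (ZMod 2)) :
    consMatrix A * consMatrix B = consMatrix (A * B) := by
  refine Matrix.ext_of_mulVec_single fun i => ?_
  rw [← mulVec_mulVec, consMatrix_mulVec, consMatrix_mulVec, consMatrix_mulVec]
  simp

theorem consMatrix_one : consMatrix (1 : Matrix (Fin n) (Fin n) (ZMod 2)) = 1 := by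
  refine Matrix.ext_of_mulVec_single fun i => ?_
  rw [consMatrix_mulVec, one_mulVec, one_mulVec]
  exact Fin.cons_self_tail _

/-- The invertible matrix acting as `A` on all coordinates but the first, which it fixes. -/
def consGL (A : GL (Fin n) (ZMod 2)) : GL (Fin (n + 1)) (ZMod 2) where
  val := consMatrix A.val
  inv := consMatrix A.inv
  val_inv := by rw [consMatrix_mul, A.val_inv, consMatrix_one]
  inv_val := by rw [consMatrix_mul, A.inv_val, consMatrix_one]

theorem GL_mulVec_injective (A : GL (Fin n) (ZMod 2)) :
    Function.Injective fun x : F2Vec n => A.val *ᵥ x :=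
  mulVec_injective_of_isUnit A.isUnit

/-- An invertible matrix as a permutation of `𝔽₂ⁿ`. -/
def mulVecEquiv (A : GL (Fin n) (ZMod 2)) : F2Vec n ≃ F2Vec n where
  toFun x := A.val *ᵥ x
  invFun x := (A⁻¹).val *ᵥ x
  left_inv x := by simp
  right_inv x := by simp

theorem exists_GL_mulVec_eq {v w : F2Vec n} (hv : v ≠ 0) (hw : w ≠ 0) :
    ∃ B : GL (Fin n) (ZMod 2), B.val *ᵥ v = w := by
  obtain ⟨φ, h1, h2⟩ : ∃ φ : F2Vec n, φ ⬝ᵥ v = 1 ∧ φ ⬝ᵥ w = 1 := by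
    obtain ⟨a, ha⟩ := exists_dotProduct_eq_one hv
    obtain ⟨b, hb⟩ := exists_dotProduct_eq_one hw
    rw [dotProduct_comm] at ha hb
    by_cases haw : a ⬝ᵥ w = 0
    · by_cases hbv : b ⬝ᵥ v = 0
      · exact ⟨a + b, by rw [add_dotProduct, ha, hbv, add_zero],
          by rw [add_dotProduct, haw, hb, zero_add]⟩
      · exact ⟨b, zmod_two_eq_one hbv, hb⟩
    · exact ⟨a, ha, zmod_two_eq_one haw⟩
  have hact : ∀ x, (1 + vecMulVec (v + w) φ) *ᵥ x = x + (φ ⬝ᵥ x) • (v + w) := by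
    intro x
    rw [add_mulVec, one_mulVec, vecMulVec_mulVec, op_smul_eq_smul]
  have hsq : (1 + vecMulVec (v + w) φ) * (1 + vecMulVec (v + w) φ) = 1 := by
    refine Matrix.ext_of_mulVec_single fun i => ?_
    rw [← mulVec_mulVec, hact, hact, dotProduct_add, dotProduct_smul, dotProduct_add, h1, h2,
      zmod_two_add_self, smul_zero, add_zero, one_mulVec, add_assoc, add_self_of_module_two,
      add_zero]
  refine ⟨⟨_, _, hsq, hsq⟩, ?_⟩
  show (1 + vecMulVec (v + w) φ) *ᵥ v = w
  rw [hact, h1, one_smul, ← add_assoc, add_self_of_module_two, zero_add]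

/-- A uniformly random invertible matrix maps a nonzero vector to a uniformly random nonzero
vector. -/
theorem expect_mulVec_mem {v : F2Vec n} (hv : v ≠ 0) {S : Finset (F2Vec n)} (h0 : 0 ∉ S) :
    ((2 : ℝ) ^ n - 1) * 𝔼 A : GL (Fin n) (ZMod 2), (if A.val *ᵥ v ∈ S then (1 : ℝ) else 0) =
      S.card := by
  have hconst : ∀ w : F2Vec n, (𝔼 A : GL (Fin n) (ZMod 2), (if A.val *ᵥ w ∈ S then (1 : ℝ) else 0))
      = if w = 0 then 0 else
        𝔼 A : GL (Fin n) (ZMod 2), (if A.val *ᵥ v ∈ S then (1 : ℝ) else 0) := by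
    intro w
    split_ifs with hw
    · simp [hw, h0]
    · obtain ⟨B, hB⟩ := exists_GL_mulVec_eq hv hw
      refine Fintype.expect_equiv (Equiv.mulRight B) _ _ fun A => ?_
      rw [Equiv.coe_mulRight, Units.val_mul, ← mulVec_mulVec, hB]
  have hsum : ∑ w : F2Vec n, 𝔼 A : GL (Fin n) (ZMod 2),
      (if A.val *ᵥ w ∈ S then (1 : ℝ) else 0) = S.card := by
    rw [← Finset.expect_sum_comm]
    have : ∀ A : GL (Fin n) (ZMod 2), ∑ w : F2Vec n, (if A.val *ᵥ w ∈ S then (1 : ℝ) else 0) =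
        S.card := by
      intro A
      refine ((mulVecEquiv A).sum_comp (fun w => if w ∈ S then (1 : ℝ) else 0)).trans ?_
      simp
    simp only [this]
    exact Fintype.expect_const _
  rw [← hsum, Finset.sum_congr rfl fun w _ => hconst w]
  rw [Finset.sum_ite, Finset.sum_const_zero, zero_add, Finset.sum_const, nsmul_eq_mul]
  congr 1
  have : (Finset.univ.filter fun w : F2Vec n => ¬ w = 0) = Finset.univ.erase 0 := by
    ext; simp
  rw [this, Finset.card_erase_of_mem (Finset.mem_univ _), Finset.card_univ, Fintype.card_fun,
    ZMod.card, Fintype.card_fin, Nat.cast_sub Nat.one_le_two_pow]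
  simp

/-- Transposition, as a permutation of the invertible matrices. -/
def transposeGL : GL (Fin n) (ZMod 2) ≃ GL (Fin n) (ZMod 2) where
  toFun A := ⟨A.valᵀ, A.invᵀ, by rw [← transpose_mul, A.inv_val, transpose_one],
    by rw [← transpose_mul, A.val_inv, transpose_one]⟩
  invFun A := ⟨A.valᵀ, A.invᵀ, by rw [← transpose_mul, A.inv_val, transpose_one],
    by rw [← transpose_mul, A.val_inv, transpose_one]⟩
  left_inv A := by ext; rfl
  right_inv A := by ext; rfl

/-- The first row of a uniformly random invertible matrix is a uniformly random nonzero vector. -/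
theorem expect_row_mem {S : Finset (F2Vec (n + 1))} (h0 : 0 ∉ S) :
    ((2 : ℝ) ^ (n + 1) - 1) * 𝔼 A : GL (Fin (n + 1)) (ZMod 2),
      (if A.val 0 ∈ S then (1 : ℝ) else 0) = S.card := by
  rw [← expect_mulVec_mem (v := Pi.single 0 1) (by simp) h0]
  congr 1
  refine Fintype.expect_equiv transposeGL _ _ fun A => ?_
  have : (transposeGL A).val *ᵥ Pi.single 0 1 = A.val 0 := by
    rw [mulVec_single_one]; rfl
  rw [this]

theorem GL_row_ne_zero (A : GL (Fin (n + 1)) (ZMod 2)) : A.val 0 ≠ 0 := by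
  intro h
  have h1 := congrFun (congrFun A.val_inv 0) 0
  rw [Matrix.mul_apply] at h1
  simp [h] at h1

variable {M : Type*}

/-- The restriction of `f` to the hyperplane on which the first coordinate of `A x + z` is `1`,
in the remaining coordinates. -/
def restr (f : F2Vec (n + 1) → M) (p : GL (Fin (n + 1)) (ZMod 2) × F2Vec (n + 1)) (y : F2Vec n) :
    M :=
  f ((p.1⁻¹).val *ᵥ (Fin.cons 1 y - p.2))

/-- The point of the hyperplane in the coordinates used by `restr`. -/
theorem restr_tail (f : F2Vec (n + 1) → M) (p : GL (Fin (n + 1)) (ZMod 2) × F2Vec (n + 1))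
    {x : F2Vec (n + 1)} (hx : p.1.val 0 ⬝ᵥ x = 1 + p.2 0) :
    restr f p (Fin.tail (p.1.val *ᵥ x + p.2)) = f x := by
  have h0 : (p.1.val *ᵥ x + p.2) 0 = 1 := by
    show p.1.val 0 ⬝ᵥ x + p.2 0 = 1
    rw [hx, add_assoc, zmod_two_add_self, add_zero]
  have : (Fin.cons 1 (Fin.tail (p.1.val *ᵥ x + p.2)) : F2Vec (n + 1)) = p.1.val *ᵥ x + p.2 := by
    conv_rhs => rw [← Fin.cons_self_tail (p.1.val *ᵥ x + p.2), h0]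
  rw [restr, this, add_sub_cancel_right]
  simp

variable [AddCommGroup M] [Module (ZMod 2) M]

theorem minWord_apply (d : ℕ) (A : GL (Fin n) (ZMod 2)) (z x : F2Vec n) :
    (minWord d A z).1 x = ∏ i : Fin n with i.val < d, (A.val *ᵥ x + z) i := rfl

/-- The first affine form of a minimum-weight codeword restricts the summation to a hyperplane. -/
theorem sum_minWord_succ (d : ℕ) (f : F2Vec (n + 1) → M)
    (p : GL (Fin (n + 1)) (ZMod 2) × F2Vec (n + 1)) (p' : GL (Fin n) (ZMod 2) × F2Vec n) :
    ∑ x, (minWord (d + 1) (consGL p'.1 * p.1)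
      (consMatrix p'.1.val *ᵥ p.2 + Fin.cons 0 p'.2)).1 x • f x =
    ∑ y, (minWord d p'.1 p'.2).1 y • restr f p y := by
  set e : F2Vec (n + 1) ≃ F2Vec (n + 1) :=
    (Equiv.subRight p.2).trans (mulVecEquiv (p.1⁻¹)) with he
  have hq : ∀ w : F2Vec (n + 1), (minWord (d + 1) (consGL p'.1 * p.1)
      (consMatrix p'.1.val *ᵥ p.2 + Fin.cons 0 p'.2)).1 (e w) =
      w 0 * (minWord d p'.1 p'.2).1 (Fin.tail w) := by
    intro w
    have hv : (consGL p'.1 * p.1).val *ᵥ (e w) +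
        (consMatrix p'.1.val *ᵥ p.2 + Fin.cons 0 p'.2) =
        (Fin.cons (w 0) (p'.1.val *ᵥ Fin.tail w + p'.2) : F2Vec (n + 1)) := by
      have h1 : p.1.val *ᵥ (e w) = w - p.2 := by
        show p.1.val *ᵥ ((p.1⁻¹).val *ᵥ (w - p.2)) = w - p.2
        simp
      have h2 : (consGL p'.1 * p.1).val *ᵥ (e w) = consMatrix p'.1.val *ᵥ (w - p.2) := by
        rw [Units.val_mul, ← mulVec_mulVec, h1]; rfl
      rw [h2, ← add_assoc, ← mulVec_add, sub_add_cancel, consMatrix_mulVec]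
      funext i; refine Fin.cases ?_ (fun j => ?_) i <;> simp
    rw [minWord_apply, hv, minWord_apply, Finset.prod_filter, Fin.prod_univ_succ,
      Finset.prod_filter]
    simp
  rw [← e.sum_comp, sum_F2Vec_succ]
  refine Finset.sum_congr rfl fun y _ => ?_
  rw [hq, hq]
  simp only [Fin.cons_zero, zero_mul, zero_smul, zero_add, one_mul, Fin.tail_cons]
  rfl

variable [DecidableEq M]

/-- The probability that a random minimum-weight codeword of degree `d` is not orthogonal
to `f`. -/
noncomputable def rej (d : ℕ) (f : F2Vec n → M) : ℝ :=
  𝔼 p : GL (Fin n) (ZMod 2) × F2Vec n,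
    if ∑ x, (minWord d p.1 p.2).1 x • f x = 0 then (0 : ℝ) else 1

/-- A minimum-weight codeword of degree `d + 1` is a minimum-weight codeword of degree `d` on a random
hyperplane, so rejection probabilities can be bounded by induction on the degree. -/
theorem rej_succ (d : ℕ) (f : F2Vec (n + 1) → M) :
    rej (d + 1) f = 𝔼 p : GL (Fin (n + 1)) (ZMod 2) × F2Vec (n + 1), rej d (restr f p) := by
  have h : ∀ p' : GL (Fin n) (ZMod 2) × F2Vec n, rej (d + 1) f =
      𝔼 p : GL (Fin (n + 1)) (ZMod 2) × F2Vec (n + 1),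
        if ∑ y, (minWord d p'.1 p'.2).1 y • restr f p y = 0 then (0 : ℝ) else 1 := by
    intro p'
    set φ : GL (Fin (n + 1)) (ZMod 2) × F2Vec (n + 1) → GL (Fin (n + 1)) (ZMod 2) × F2Vec (n + 1) :=
      fun p => (consGL p'.1 * p.1, consMatrix p'.1.val *ᵥ p.2 + Fin.cons 0 p'.2) with hφ
    have hinj : Function.Injective φ := by
      rintro ⟨A, z⟩ ⟨B, w⟩ hab
      simp only [hφ, Prod.mk.injEq] at hab
      refine Prod.ext (mul_left_cancel hab.1) (GL_mulVec_injective (consGL p'.1) ?_)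
      exact add_right_cancel hab.2
    rw [rej]
    symm
    refine Fintype.expect_bijective φ (Finite.injective_iff_bijective.1 hinj) _ _ fun p => ?_
    simp only [← sum_minWord_succ]
    rfl
  calc rej (d + 1) f = 𝔼 p' : GL (Fin n) (ZMod 2) × F2Vec n, rej (d + 1) f :=
        (Fintype.expect_const _).symm
    _ = _ := by
      rw [Finset.expect_congr rfl fun p' _ => h p', Finset.expect_comm]
      rfl

theorem rej_nonneg (d : ℕ) (f : F2Vec n → M) : 0 ≤ rej d f :=
  expect_nonneg' fun p => by split_ifs <;> norm_num

theorem rej_zero (f : F2Vec n → M) (hf : ¬ DegLT n f) : rej 0 f = 1 := by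
  have hs : ∑ x, f x ≠ 0 := fun h => hf (degLT_of_sum_eq_zero h)
  rw [rej]
  have : ∀ p : GL (Fin n) (ZMod 2) × F2Vec n,
      (if ∑ x, (minWord 0 p.1 p.2).1 x • f x = 0 then (0 : ℝ) else 1) = 1 := by
    intro p
    have h1 : ∀ x, (minWord 0 p.1 p.2).1 x = 1 := fun x => by rw [minWord_apply]; simp
    simp only [h1, one_smul]
    rw [if_neg hs]
  simp only [this]
  exact Fintype.expect_const _

/-- `f` differs in at most `w` points of the hyperplane `l ⬝ᵥ x = c` from a function of degree less
than `m`. -/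
def CloseOn (m w : ℕ) (f : F2Vec n → M) (l : F2Vec n) (c : ZMod 2) : Prop :=
  ∃ Q : F2Vec n → M, DegLT m Q ∧ (Finset.univ.filter fun x => l ⬝ᵥ x = c ∧ f x ≠ Q x).card ≤ w

/-- An approximation of the restriction of `f` to a hyperplane extends, along the projection to the
hyperplane, to a function of the same degree on the whole space. -/
theorem closeOn_of_restr {m w : ℕ} (f : F2Vec (n + 1) → M)
    (p : GL (Fin (n + 1)) (ZMod 2) × F2Vec (n + 1)) {P : F2Vec n → M} (hP : DegLT m P)
    (hw : (Finset.univ.filter fun y => restr f p y ≠ P y).card ≤ w) :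
    CloseOn m w f (p.1.val 0) (1 + p.2 0) := by
  refine ⟨fun x => P (Fin.tail (p.1.val *ᵥ x + p.2)), hP.comp _ fun v =>
    ⟨Fin.tail (p.1.val *ᵥ v), fun x => ?_⟩, le_trans ?_ hw⟩
  · rw [mulVec_add]
    funext i
    simp only [Fin.tail, Pi.add_apply]
    ring
  · refine Finset.card_le_card_of_injOn (fun x => Fin.tail (p.1.val *ᵥ x + p.2)) ?_ ?_
    · intro x hx
      simp only [Finset.coe_filter, Finset.mem_univ, true_and, Set.mem_ofPred_eq] at hx ⊢
      rw [restr_tail f p hx.1]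
      exact hx.2
    · intro x hx y hy hxy
      simp only [Finset.coe_filter, Finset.mem_univ, true_and, Set.mem_ofPred_eq] at hx hy
      have h0 : (p.1.val *ᵥ x + p.2) 0 = (p.1.val *ᵥ y + p.2) 0 := by
        show p.1.val 0 ⬝ᵥ x + p.2 0 = p.1.val 0 ⬝ᵥ y + p.2 0
        rw [hx.1, hy.1]
      have : p.1.val *ᵥ x + p.2 = p.1.val *ᵥ y + p.2 := by
        rw [← Fin.cons_self_tail (p.1.val *ᵥ x + p.2), ← Fin.cons_self_tail (p.1.val *ᵥ y + p.2), h0]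
        congr 1
      exact GL_mulVec_injective p.1 (add_right_cancel this)

end Rejection

section RejectionBounds

open scoped BigOperators
open Matrix

/-! ### Signs -/

/-- The real character of `𝔽₂`. -/
def sgn (a : ZMod 2) : ℝ := if a = 0 then 1 else -1

theorem sgn_zero : sgn 0 = 1 := if_pos rfl

theorem sgn_one : sgn 1 = -1 := if_neg (by decide)

theorem zmod_two_cases (a : ZMod 2) : a = 0 ∨ a = 1 := by revert a; decide

theorem sgn_add (a b : ZMod 2) : sgn (a + b) = sgn a * sgn b := by
  rcases zmod_two_cases a with rfl | rfl <;> rcases zmod_two_cases b with rfl | rfl <;>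
    simp [sgn_zero, sgn_one, zmod_two_add_self]

theorem sgn_mul_self (a : ZMod 2) : sgn a * sgn a = 1 := by
  rw [← sgn_add, zmod_two_add_self, sgn_zero]

/-- A nontrivial character sums to zero. -/
theorem sum_sgn_eq_zero {G : Type*} [Fintype G] [AddCommGroup G] (φ : G →+ ZMod 2) (hφ : φ ≠ 0) :
    ∑ x, sgn (φ x) = 0 := by
  obtain ⟨g, hg⟩ : ∃ g, φ g ≠ 0 := by
    by_contra hcon; push Not at hcon; exact hφ (AddMonoidHom.ext hcon)
  have h : ∑ x, sgn (φ x) = ∑ x, sgn (φ (x + g)) :=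
    (Equiv.sum_comp (Equiv.addRight g) fun x => sgn (φ x)).symm
  simp only [map_add, sgn_add, zmod_two_eq_one hg, sgn_one, mul_neg_one,
    Finset.sum_neg_distrib] at h
  linarith

variable {N : ℕ} {M : Type*} [AddCommGroup M] [Module (ZMod 2) M] [DecidableEq M]

/-- The linear form `x ↦ l ⬝ᵥ x`. -/
def dotHom (l : F2Vec N) : F2Vec N →+ ZMod 2 where
  toFun x := l ⬝ᵥ x
  map_zero' := dotProduct_zero l
  map_add' := dotProduct_add l

theorem dotHom_ne_zero {l : F2Vec N} (hl : l ≠ 0) : dotHom l ≠ 0 := by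
  obtain ⟨e, he⟩ := exists_dotProduct_eq_one hl
  intro h
  have : dotHom l e = 0 := by rw [h]; rfl
  exact one_ne_zero (he.symm.trans this)

/-! ### Lower bounds on the rejection probability -/

/-- Distinct hyperplane directions are pairwise independent, so most points lie on about half of the
hyperplanes; hence a set that is small on each hyperplane is small. -/
theorem card_le_of_hyperplanes {S : Finset (F2Vec N)} (c : F2Vec N → ZMod 2)
    (D : Finset (F2Vec N)) {w : ℕ} (hw : ∀ l ∈ S, (D.filter fun x => l ⬝ᵥ x = c l).card ≤ w) :
    S.card * D.card ≤ 4 * S.card * w + 4 * 2 ^ N := by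
  classical
  rcases S.eq_empty_or_nonempty with rfl | hne
  · simp
  have hK : (0 : ℝ) < S.card := by exact_mod_cast Finset.card_pos.2 hne
  set s : F2Vec N → F2Vec N → ℝ := fun l x => sgn (l ⬝ᵥ x + c l) with hs
  set T : F2Vec N → ℝ := fun x => ∑ l ∈ S, s l x with hT
  -- the signs `s l` are orthogonal for distinct directions
  have hT2 : ∑ x, T x ^ 2 = S.card * 2 ^ N := by
    have : ∀ x, T x ^ 2 = ∑ l ∈ S, ∑ l' ∈ S, s l x * s l' x := fun x => by
      rw [sq, hT, Finset.sum_mul_sum]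
    simp only [this]
    rw [Finset.sum_comm]
    have h1 : ∀ l ∈ S, ∑ x, ∑ l' ∈ S, s l x * s l' x = 2 ^ N := by
      intro l hl
      rw [Finset.sum_comm, Finset.sum_eq_single l]
      · simp only [hs, sgn_mul_self]
        simp
      · intro l' hl' hne
        have h2 : ∀ x, s l x * s l' x = sgn (dotHom (l + l') x) * sgn (c l + c l') := by
          intro x
          simp only [hs]
          rw [← sgn_add, ← sgn_add]
          congr 1
          show _ = (l + l') ⬝ᵥ x + (c l + c l')
          rw [add_dotProduct]; ring
        simp only [h2]
        rw [← Finset.sum_mul, sum_sgn_eq_zero, zero_mul]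
        apply dotHom_ne_zero
        rw [← sub_eq_add_of_module_two, sub_ne_zero]
        exact hne.symm
      · exact fun h => absurd hl h
    rw [Finset.sum_congr rfl h1, Finset.sum_const, nsmul_eq_mul]
  -- the number of hyperplanes through `x` is `(|S| + T x) / 2`
  set t : F2Vec N → ℝ := fun x => ∑ l ∈ S, if l ⬝ᵥ x = c l then (1 : ℝ) else 0 with ht
  have htT : ∀ x, T x = 2 * t x - S.card := by
    intro x
    rw [hT, ht, Finset.mul_sum, Finset.card_eq_sum_ones, Nat.cast_sum, ← Finset.sum_sub_distrib]
    refine Finset.sum_congr rfl fun l _ => ?_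
    simp only [hs]
    split_ifs with h
    · rw [h, zmod_two_add_self, sgn_zero]; norm_num
    · rw [zmod_two_eq_add_one h, add_right_comm, zmod_two_add_self, zero_add, sgn_one]; norm_num
  have hpt : ∀ x, (S.card : ℝ) ^ 2 ≤ 4 * S.card * t x + 4 * T x ^ 2 := by
    intro x
    have := htT x
    nlinarith [sq_nonneg (T x), sq_nonneg (S.card + T x)]
  have ht_sum : ∑ x ∈ D, t x ≤ S.card * w := by
    rw [ht, Finset.sum_comm, ← nsmul_eq_mul]
    refine Finset.sum_le_card_nsmul _ _ _ fun l hl => ?_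
    rw [← Finset.sum_filter, Finset.sum_const, nsmul_eq_mul, mul_one]
    exact_mod_cast hw l hl
  have hmain : (S.card : ℝ) * (S.card * D.card) ≤ S.card * (4 * S.card * w + 4 * 2 ^ N) := by
    calc (S.card : ℝ) * (S.card * D.card) = ∑ x ∈ D, (S.card : ℝ) ^ 2 := by
          rw [Finset.sum_const, nsmul_eq_mul]; ring
      _ ≤ ∑ x ∈ D, (4 * S.card * t x + 4 * T x ^ 2) := Finset.sum_le_sum fun x _ => hpt x
      _ = 4 * S.card * ∑ x ∈ D, t x + 4 * ∑ x ∈ D, T x ^ 2 := by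
          rw [Finset.sum_add_distrib, Finset.mul_sum, Finset.mul_sum]
      _ ≤ 4 * S.card * (S.card * w) + 4 * (S.card * 2 ^ N) := by
          refine add_le_add (mul_le_mul_of_nonneg_left ht_sum (by positivity)) ?_
          rw [← hT2]
          exact mul_le_mul_of_nonneg_left (Finset.sum_le_sum_of_subset_of_nonneg
            (Finset.subset_univ _) fun _ _ _ => sq_nonneg _) (by norm_num)
      _ = _ := by ring
  have := le_of_mul_le_mul_left hmain hK
  exact_mod_cast this

theorem expect_shift_mem (d : ℕ) (hd : d ≤ N) (u : F2Vec N) :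
    𝔼 z : F2Vec N, (if ∀ i : Fin N, i.val < d → (u + z) i = 1 then (1 : ℝ) else 0) =
      (1 / 2) ^ d := by
  have h1 : 𝔼 z : F2Vec N, (if ∀ i : Fin N, i.val < d → (u + z) i = 1 then (1 : ℝ) else 0) =
      𝔼 z : F2Vec N, (if ∀ i : Fin N, i.val < d → z i = 1 then (1 : ℝ) else 0) :=
    Fintype.expect_equiv (Equiv.addLeft u) _ _ fun z => rfl
  have h2 : (Finset.univ.filter fun z : F2Vec N => ∀ i : Fin N, i.val < d → z i = 1) =
      Fintype.piFinset fun i : Fin N => if i.val < d then {1} else Finset.univ := by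
    ext z
    simp only [Finset.mem_filter, Finset.mem_univ, true_and, Fintype.mem_piFinset]
    refine forall_congr' fun i => ?_
    split_ifs with h <;> simp [h]
  have h3 : (Finset.univ.filter fun z : F2Vec N => ∀ i : Fin N, i.val < d → z i = 1).card =
      2 ^ (N - d) := by
    rw [h2, Fintype.card_piFinset]
    have : ∀ i : Fin N, (if i.val < d then {1} else Finset.univ : Finset (ZMod 2)).card =
        if i.val < d then 1 else 2 := fun i => by split_ifs <;> simp [ZMod.card]
    simp only [this]
    rw [Finset.prod_ite, Finset.prod_const_one, one_mul, Finset.prod_const]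
    congr 1
    have h4 := Finset.card_filter_add_card_filter_not (s := (Finset.univ : Finset (Fin N)))
      (fun i : Fin N => i.val < d)
    rw [Fin.card_filter_val_lt, Finset.card_univ, Fintype.card_fin] at h4
    omega
  rw [h1, Fintype.expect_eq_sum_div_card, Finset.sum_boole, h3, Fintype.card_fun, ZMod.card,
    Fintype.card_fin]
  push_cast
  rw [div_eq_iff (by positivity), one_div, inv_pow, inv_mul_eq_div, eq_div_iff (by positivity),
    ← pow_add, Nat.sub_add_cancel hd]

theorem minWord_eq_one_iff (d : ℕ) (A : GL (Fin N) (ZMod 2)) (z x : F2Vec N) :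
    (minWord d A z).1 x = 1 ↔ ∀ i : Fin N, i.val < d → (A.val *ᵥ x + z) i = 1 := by
  rw [minWord_apply]
  constructor
  · intro h i hi
    by_contra hne
    have h0 : (A.val *ᵥ x + z) i = 0 := by
      by_contra h'; exact hne (zmod_two_eq_one h')
    rw [Finset.prod_eq_zero (Finset.mem_filter.2 ⟨Finset.mem_univ i, hi⟩) h0] at h
    exact absurd h (by decide)
  · intro h
    exact Finset.prod_eq_one fun i hi => h i (Finset.mem_filter.1 hi).2

theorem expect_minWord (d : ℕ) (hd : d ≤ N) (x : F2Vec N) :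
    𝔼 p : GL (Fin N) (ZMod 2) × F2Vec N, (if (minWord d p.1 p.2).1 x = 1 then (1 : ℝ) else 0) =
      (1 / 2) ^ d := by
  rw [expect_prod]
  simp only [minWord_eq_one_iff, expect_shift_mem d hd]
  exact Fintype.expect_const _

/-- Membership of two distinct points in the support of a random minimum-weight codeword is not
positively correlated: given that `x` is in the support, `y` is too if and only if `A (x + y)` vanishes
in the first `d` coordinates. -/
theorem expect_minWord_pair (m d : ℕ) {x y : F2Vec (m + d)} (hxy : x ≠ y) :
    𝔼 p : GL (Fin (m + d)) (ZMod 2) × F2Vec (m + d),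
      ((if (minWord d p.1 p.2).1 x = 1 then (1 : ℝ) else 0) *
        if (minWord d p.1 p.2).1 y = 1 then (1 : ℝ) else 0) ≤ (1 / 2) ^ d * (1 / 2) ^ d := by
  set S : Finset (F2Vec (m + d)) :=
    (Finset.univ.filter fun z => ∀ i : Fin (m + d), i.val < d → z i = 0).erase 0 with hS
  have hcard : (S.card : ℝ) + 1 = 2 ^ m := by
    have h2 : (Finset.univ.filter fun z : F2Vec (m + d) =>
        ∀ i : Fin (m + d), i.val < d → z i = 0).card = 2 ^ m := by
      have := expect_shift_mem d (Nat.le_add_left d m) 1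
      rw [Fintype.expect_eq_sum_div_card, Finset.sum_boole, Fintype.card_fun, ZMod.card,
        Fintype.card_fin, div_eq_iff (by positivity)] at this
      have hcongr : ∀ z : F2Vec (m + d), (∀ i : Fin (m + d), i.val < d → (1 + z) i = 1) ↔
          ∀ i : Fin (m + d), i.val < d → z i = 0 := fun z => by
        simp
      simp only [hcongr] at this
      have h3 : ((1 : ℝ) / 2) ^ d * ((2 ^ (m + d) : ℕ) : ℝ) = 2 ^ m := by
        push_cast
        rw [pow_add, one_div, inv_pow]
        field_simp
      rw [h3] at this
      exact_mod_cast this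
    rw [hS, Finset.card_erase_of_mem (by simp), h2, Nat.cast_sub Nat.one_le_two_pow]
    simp
  have h1 : ∀ p : GL (Fin (m + d)) (ZMod 2) × F2Vec (m + d),
      ((if (minWord d p.1 p.2).1 x = 1 then (1 : ℝ) else 0) *
        if (minWord d p.1 p.2).1 y = 1 then (1 : ℝ) else 0) ≤
      (if p.1.val *ᵥ (x + y) ∈ S then (1 : ℝ) else 0) *
        if ∀ i : Fin (m + d), i.val < d → (p.1.val *ᵥ x + p.2) i = 1 then (1 : ℝ) else 0 := by
    intro p
    simp only [minWord_eq_one_iff]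
    split_ifs with hx hy hm <;> norm_num
    apply hm
    rw [hS, Finset.mem_erase]
    refine ⟨fun h => hxy ?_, ?_⟩
    · have := GL_mulVec_injective p.1 (h.trans (mulVec_zero _).symm)
      rwa [← sub_eq_add_of_module_two, sub_eq_zero] at this
    · simp only [Finset.mem_filter, Finset.mem_univ, true_and]
      intro i hi
      have hxi := hx i hi
      have hyi := hy i hi
      rw [mulVec_add]
      simp only [Pi.add_apply] at hxi hyi ⊢
      have : (p.1.val *ᵥ x) i = (p.1.val *ᵥ y) i := add_right_cancel (hxi.trans hyi.symm)
      rw [this, zmod_two_add_self]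
  refine (expect_mono h1).trans ?_
  rw [expect_prod]
  have hin : ∀ A : GL (Fin (m + d)) (ZMod 2), 𝔼 z : F2Vec (m + d),
      ((if A.val *ᵥ (x + y) ∈ S then (1 : ℝ) else 0) *
        if ∀ i : Fin (m + d), i.val < d → (A.val *ᵥ x + z) i = 1 then (1 : ℝ) else 0) =
      (if A.val *ᵥ (x + y) ∈ S then (1 : ℝ) else 0) * (1 / 2) ^ d := fun A => by
    rw [← Finset.mul_expect, expect_shift_mem d (Nat.le_add_left d m)]
  rw [Finset.expect_congr rfl fun A _ => hin A, ← Finset.expect_mul]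
  refine mul_le_mul_of_nonneg_right ?_ (by positivity)
  have h0 : (0 : F2Vec (m + d)) ∉ S := by simp [hS]
  have hv : x + y ≠ 0 := by rw [← sub_eq_add_of_module_two, sub_ne_zero]; exact hxy
  have h4 := expect_mulVec_mem hv h0
  set q := 𝔼 A : GL (Fin (m + d)) (ZMod 2), (if A.val *ᵥ (x + y) ∈ S then (1 : ℝ) else 0) with hq
  have hq1 : q ≤ 1 := (expect_mono fun A => by split_ifs <;> norm_num).trans
    (Fintype.expect_const (ι := GL (Fin (m + d)) (ZMod 2)) (1 : ℝ)).le
  have h5 : (2 : ℝ) ^ m * (2 ^ d * q) ≤ 2 ^ m * 1 := by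
    rw [pow_add] at h4
    nlinarith
  have h6 : 2 ^ d * q ≤ 1 := le_of_mul_le_mul_left h5 (by positivity)
  rw [one_div, inv_pow, ← one_div, le_div_iff₀ (by positivity)]
  linarith

theorem degLT_minWord (d : ℕ) (A : GL (Fin N) (ZMod 2)) (z : F2Vec N) :
    DegLT (d + 1) fun x => (minWord d A z).1 x := by
  have h := degLT_prod (V := F2Vec N) (Finset.univ.filter fun i : Fin N => i.val < d)
    (fun i x => A.val i ⬝ᵥ x + z i) (fun i _ => degLT_dotProduct _ _)
  refine DegLT.mono ?_ h
  rw [Fin.card_filter_val_lt]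
  omega

/-- The test detects a small deviation from degree less than `m`, by inclusion-exclusion. -/
theorem rej_ge_of_near {m d : ℕ} (f P : F2Vec (m + d) → M) (hP : DegLT m P) {x : ℝ}
    (hx : x = (Finset.univ.filter fun y => f y ≠ P y).card * (1 / 2) ^ d) : x - x ^ 2 ≤ rej d f := by
  set D := Finset.univ.filter fun y => f y ≠ P y with hD
  set a : F2Vec (m + d) → GL (Fin (m + d)) (ZMod 2) × F2Vec (m + d) → ℝ := fun y p =>
    if (minWord d p.1 p.2).1 y = 1 then (1 : ℝ) else 0 with ha
  have hsum : ∀ p : GL (Fin (m + d)) (ZMod 2) × F2Vec (m + d),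
      ∑ y, (minWord d p.1 p.2).1 y • f y =
        ∑ y ∈ D.filter fun y => (minWord d p.1 p.2).1 y = 1, (f y - P y) := by
    intro p
    have h0 : ∑ y, (minWord d p.1 p.2).1 y • P y = 0 := by
      exact ((DegLT.smul (degLT_minWord d p.1 p.2) hP).mono (add_comm d m).le).sum_eq_zero
    rw [← sub_zero (∑ y, _), ← h0, ← Finset.sum_sub_distrib, Finset.sum_filter, hD,
      Finset.sum_filter]
    refine Finset.sum_congr rfl fun y _ => ?_
    rw [← smul_sub]
    by_cases hf : f y = P y
    · simp [hf]
    · rcases zmod_two_cases ((minWord d p.1 p.2).1 y) with h | h <;> simp [h, hf]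
  -- `2 k - k² ≤ 1` for the number `k` of deviations hit by the codeword, which is rejected if `k = 1`
  have hind : ∀ p : GL (Fin (m + d)) (ZMod 2) × F2Vec (m + d),
      2 * ∑ y ∈ D, a y p - (∑ y ∈ D, a y p) ^ 2 ≤
      if ∑ y, (minWord d p.1 p.2).1 y • f y = 0 then (0 : ℝ) else 1 := by
    intro p
    have hT : ∑ y ∈ D, a y p = (D.filter fun y => (minWord d p.1 p.2).1 y = 1).card := by
      rw [ha, Finset.sum_boole]
    rw [hT, hsum p]
    generalize hk : (D.filter fun y => (minWord d p.1 p.2).1 y = 1).card = k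
    split_ifs with h
    · have hk1 : k ≠ 1 := by
        rintro rfl
        obtain ⟨y, hy⟩ := Finset.card_eq_one.1 hk
        rw [hy, Finset.sum_singleton, sub_eq_zero] at h
        have hyD : y ∈ D := (Finset.mem_filter.1 (hy ▸ Finset.mem_singleton_self y)).1
        exact (Finset.mem_filter.1 hyD).2 h
      rcases Nat.lt_or_ge k 1 with h1 | h1
      · have : k = 0 := by omega
        subst this; norm_num
      · have : (2 : ℝ) ≤ k := by exact_mod_cast (by omega : 2 ≤ k)
        nlinarith
    · nlinarith [sq_nonneg ((k : ℝ) - 1)]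
  have h1 : ∀ y, 𝔼 p, a y p = (1 / 2) ^ d := expect_minWord d (Nat.le_add_left d m)
  have h2 : ∀ y y', 𝔼 p, (a y p * a y' p) ≤ (1 / 2) ^ d * (1 / 2) ^ d +
      if y = y' then (1 / 2) ^ d else 0 := by
    intro y y'
    split_ifs with h
    · subst h
      have : ∀ p, a y p * a y p = a y p := fun p => by simp only [ha]; split_ifs <;> norm_num
      simp only [this, h1]
      have : (0 : ℝ) ≤ (1 / 2) ^ d * (1 / 2) ^ d := by positivity
      linarith
    · rw [add_zero]; exact expect_minWord_pair m d h
  have hlow : 𝔼 p, (2 * ∑ y ∈ D, a y p - (∑ y ∈ D, a y p) ^ 2) ≤ rej d f := expect_mono hind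
  refine le_trans ?_ hlow
  rw [Finset.expect_sub_distrib, ← Finset.mul_expect, Finset.expect_sum_comm]
  simp only [h1, sq, Finset.sum_mul_sum]
  rw [Finset.expect_sum_comm]
  simp only [Finset.expect_sum_comm]
  have h3 : ∑ y ∈ D, ∑ y' ∈ D, 𝔼 p, (a y p * a y' p) ≤ ∑ y ∈ D, ∑ y' ∈ D,
      ((1 / 2) ^ d * (1 / 2) ^ d + if y = y' then (1 / 2) ^ d else 0) :=
    Finset.sum_le_sum fun y _ => Finset.sum_le_sum fun y' _ => h2 y y'
  have h4 : ∑ y ∈ D, ∑ y' ∈ D, (((1 : ℝ) / 2) ^ d * (1 / 2) ^ d + if y = y' then (1 / 2) ^ d else 0)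
      = x ^ 2 + x := by
    simp only [Finset.sum_add_distrib, Finset.sum_const, nsmul_eq_mul, Finset.sum_ite_eq]
    rw [Finset.sum_congr rfl (g := fun _ => ((1 : ℝ) / 2) ^ d) (fun y hy => if_pos hy)]
    rw [Finset.sum_const, nsmul_eq_mul, hx]
    ring
  rw [h4] at h3
  rw [Finset.sum_const, nsmul_eq_mul, ← hx]
  linarith

end RejectionBounds

section RejectionTheorem

open scoped BigOperators
open Matrix

variable {M : Type*} [AddCommGroup M] [Module (ZMod 2) M] [DecidableEq M]

/-- Pairing each `z` with `z + v` bounds a mean by the sums over the pairs. -/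
theorem two_mul_expect_le_of_flip {n : ℕ} {u : F2Vec (n + 1) → ℝ} {b : ℝ} (v : F2Vec (n + 1))
    (h : ∀ z, b ≤ u z + u (z + v)) : b ≤ 2 * 𝔼 z, u z := by
  have h1 : 𝔼 z, u z = 𝔼 z, u (z + v) :=
    (Fintype.expect_equiv (Equiv.addRight v) (fun z => u (z + v)) u fun z => rfl).symm
  have h2 : b ≤ 𝔼 z, (u z + u (z + v)) := by
    rw [← Fintype.expect_const (ι := F2Vec (n + 1)) b]
    exact expect_mono h
  rw [Finset.expect_add_distrib, ← h1] at h2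
  linarith

/-- A function that is not of degree less than `m` is not so on at least a quarter of all
hyperplanes. -/
theorem rej_ge_of_not_degLT {m : ℕ} (d : ℕ) (f : F2Vec (m + d) → M) (hf : ¬ DegLT m f) :
    (1 / 4 : ℝ) ^ d ≤ rej d f := by
  classical
  induction d with
  | zero => rw [pow_zero, rej_zero (n := m) f hf]
  | succ d ih =>
    have key : ∀ f : F2Vec ((m + d) + 1) → M, ¬ DegLT m f → (1 / 4 : ℝ) ^ (d + 1) ≤ rej (d + 1) f := by
      intro f hf
      -- the directions both of whose hyperplanes carry a restriction of degree less than `m`: if there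
      -- were too many of them, `f` itself would be of degree less than `m`
      set S : Finset (F2Vec ((m + d) + 1)) :=
        Finset.univ.filter fun l => l ≠ 0 ∧ ∀ c, CloseOn m 0 f l c with hS
      have hS0 : (0 : F2Vec ((m + d) + 1)) ∉ S := by simp [hS]
      have hScard : S.card < 2 ^ (m + d) := by
        by_contra hcon
        push Not at hcon
        have hmem : ∀ l ∈ S, ∀ c, ∃ Q : F2Vec ((m + d) + 1) → M, DegLT m Q ∧
            ∀ x, l ⬝ᵥ x = c → Q x = f x := by
          intro l hl c
          obtain ⟨Q, hQ, hQ0⟩ := (Finset.mem_filter.1 hl).2.2 c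
          refine ⟨Q, hQ, fun x hx => ?_⟩
          by_contra hne
          have : x ∈ (∅ : Finset (F2Vec ((m + d) + 1))) := by
            rw [← Finset.card_eq_zero.1 (Nat.le_zero.1 hQ0)]
            simpa using ⟨hx, Ne.symm hne⟩
          simp at this
        choose! P hP hPf using hmem
        obtain ⟨Q, hQ, hQf⟩ := exists_common_extension (m := m) hS0
          ((Nat.pow_le_pow_right (by norm_num) (by omega)).trans hcon) {i | i.1 ∈ S}
          (fun i hi => hi) 0 (fun l hl => hl) (fun i => P i.1 i.2) (fun i hi => hP _ hi _)
          (fun i hi j hj x hx hx' => by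
            rw [hPf _ hi _ x hx, hPf _ hj _ x hx'])
        obtain ⟨l, hl⟩ : S.Nonempty := by
          rw [← Finset.card_pos]; exact lt_of_lt_of_le (by positivity) hcon
        refine hf ?_
        have hfQ : f = Q := funext fun x => by
          rw [hQf (l, l ⬝ᵥ x) hl x rfl, hPf l hl _ x rfl]
        rw [hfQ]
        exact hQ
      have hprob := expect_row_mem hS0
      set q := 𝔼 A : GL (Fin ((m + d) + 1)) (ZMod 2), (if A.val 0 ∈ S then (1 : ℝ) else 0) with hq
      have hq2 : q ≤ 1 / 2 := by
        have h1 : (S.card : ℝ) + 1 ≤ 2 ^ (m + d) := by exact_mod_cast hScard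
        have h2 : (1 : ℝ) ≤ 2 ^ (m + d) := one_le_pow₀ (by norm_num)
        rw [pow_succ] at hprob
        nlinarith
      rw [rej_succ, expect_prod]
      have hA : ∀ A : GL (Fin ((m + d) + 1)) (ZMod 2),
          (1 - (if A.val 0 ∈ S then (1 : ℝ) else 0)) * ((1 / 4) ^ d / 2) ≤
          𝔼 z : F2Vec ((m + d) + 1), rej d (restr f (A, z)) := by
        intro A
        split_ifs with hAS
        · rw [sub_self, zero_mul]
          exact expect_nonneg' fun z => rej_nonneg _ _
        · obtain ⟨c, hc⟩ : ∃ c, ¬ CloseOn m 0 f (A.val 0) c := by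
            by_contra hcon
            push Not at hcon
            exact hAS (Finset.mem_filter.2 ⟨Finset.mem_univ _, GL_row_ne_zero A, hcon⟩)
          have hgood : ∀ z : F2Vec ((m + d) + 1), 1 + z 0 = c →
              (1 / 4 : ℝ) ^ d ≤ rej d (restr f (A, z)) := by
            intro z hz
            refine ih _ fun hdeg => hc ?_
            rw [← hz]
            exact closeOn_of_restr f (A, z) hdeg (by simp)
          have := two_mul_expect_le_of_flip (u := fun z => rej d (restr f (A, z)))
            (b := (1 / 4 : ℝ) ^ d) (Pi.single 0 1) (fun z => by
              by_cases hz : 1 + z 0 = c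
              · have := hgood z hz
                have := rej_nonneg d (restr f (A, z + Pi.single 0 1))
                linarith
              · have := hgood (z + Pi.single 0 1) (by
                  rw [Pi.add_apply, Pi.single_eq_same, ← add_assoc, zmod_two_eq_add_one hz,
                    add_assoc, zmod_two_add_self, add_zero])
                have := rej_nonneg d (restr f (A, z))
                linarith)
          linarith
      refine le_trans ?_ (expect_mono hA)
      rw [← Finset.expect_mul, Finset.expect_sub_distrib, ← hq,
        Fintype.expect_const (ι := GL (Fin ((m + d) + 1)) (ZMod 2)) (1 : ℝ), pow_succ]
      have : (0 : ℝ) ≤ (1 / 4) ^ d := by positivity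
      nlinarith
    exact key f hf

/-- Two functions of degree less than `m` that differ in few points of the intersection of two
hyperplanes agree there. -/
theorem eq_of_close_on_inter {m d : ℕ} {P Q : F2Vec (m + d + 1) → M} (hP : DegLT m P)
    (hQ : DegLT m Q) {l l' : F2Vec (m + d + 1)} (hl : l ≠ 0) (hl' : l' ≠ 0) (hne : l ≠ l')
    (c c' : ZMod 2)
    (hcard : 2 * (Finset.univ.filter fun x => (l ⬝ᵥ x = c ∧ l' ⬝ᵥ x = c') ∧ P x ≠ Q x).card < 2 ^ d)
    {x : F2Vec (m + d + 1)} (hx : l ⬝ᵥ x = c) (hx' : l' ⬝ᵥ x = c') : P x = Q x := by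
  classical
  obtain ⟨J, hJS, hJ, e, he⟩ := exists_dualSystem (S := {l, l'}) (r := 1)
    (by simp [hl.symm, hl'.symm]) (by rw [Finset.card_pair hne]; norm_num)
  have hJe : J = {l, l'} := Finset.eq_of_subset_of_card_le hJS (by
    rw [hJ]; exact Finset.card_le_two)
  subst hJe
  have hll : l ⬝ᵥ e l = 1 := by rw [he l (by simp) l (by simp), if_pos rfl]
  have hl'l' : l' ⬝ᵥ e l' = 1 := by rw [he l' (by simp) l' (by simp), if_pos rfl]
  have hll' : l ⬝ᵥ e l' = 0 := by rw [he l (by simp) l' (by simp), if_neg hne]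
  have hl'l : l' ⬝ᵥ e l = 0 := by rw [he l' (by simp) l (by simp), if_neg hne.symm]
  set π : F2Vec (m + d + 1) → F2Vec (m + d + 1) :=
    fun x => hyperProj l' c' (e l') (hyperProj l c (e l) x) with hπ
  set g : F2Vec (m + d + 1) → M := fun x => (P - Q) (π x) with hg
  have hgdeg : DegLT m g :=
    ((hP.sub hQ).comp _ (hyperProj_add l' c' (e l'))).comp _ (hyperProj_add l c (e l))
  have hπ1 : ∀ y, l ⬝ᵥ π y = c := fun y => by
    rw [hπ, dotProduct_hyperProj_of_eq_zero _ hll', dotProduct_hyperProj _ hll]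
  have hπ2 : ∀ y, l' ⬝ᵥ π y = c' := fun y => dotProduct_hyperProj _ hl'l' _
  by_contra hPQ
  have hg0 : g ≠ 0 := by
    intro h0
    have h1 := congrFun h0 x
    simp only [hg, hπ, hyperProj_of_mem (e l) hx, hyperProj_of_mem (e l') hx', Pi.sub_apply,
      Pi.zero_apply, sub_eq_zero] at h1
    exact hPQ h1
  have h2 := hgdeg.card_support hg0
  rw [Fintype.card_fun, ZMod.card, Fintype.card_fin] at h2
  set T := Finset.univ.filter fun x => (l ⬝ᵥ x = c ∧ l' ⬝ᵥ x = c') ∧ P x ≠ Q x with hT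
  have h3 : (Finset.univ.filter fun x => g x ≠ 0).card ≤ (T ×ˢ
      (Finset.univ : Finset (ZMod 2 × ZMod 2))).card := by
    refine Finset.card_le_card_of_injOn (fun y => (π y, (l ⬝ᵥ y, l' ⬝ᵥ y))) ?_ ?_
    · intro y hy
      simp only [Finset.coe_filter, Finset.mem_univ, true_and, Set.mem_ofPred_eq] at hy
      simp only [Finset.coe_product, Finset.coe_univ, Set.mem_prod, Set.mem_univ, and_true,
        Finset.mem_coe, hT, Finset.mem_filter, Finset.mem_univ, true_and]
      refine ⟨⟨hπ1 y, hπ2 y⟩, fun h => hy ?_⟩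
      simp [hg, h]
    · intro y _ y' _ hyy
      simp only [Prod.mk.injEq] at hyy
      obtain ⟨h1, h2, h3⟩ := hyy
      simp only [hπ] at h1
      have hz : hyperProj l c (e l) y = hyperProj l c (e l) y' := by
        have h4 : l' ⬝ᵥ hyperProj l c (e l) y = l' ⬝ᵥ hyperProj l c (e l) y' := by
          rw [dotProduct_hyperProj_of_eq_zero _ hl'l, dotProduct_hyperProj_of_eq_zero _ hl'l, h3]
        rw [hyperProj, hyperProj.eq_1 l' c' (e l') (hyperProj l c (e l) y'), h4] at h1
        exact add_right_cancel h1
      rw [hyperProj, hyperProj, h2] at hz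
      exact add_right_cancel hz
  rw [Finset.card_product, Finset.card_univ, Fintype.card_prod, ZMod.card] at h3
  have h4 : 2 * 2 ^ (m + d + 1) = 2 ^ m * (4 * 2 ^ d) := by
    rw [pow_succ, pow_add]; ring
  rw [h4] at h2
  have h5 := Nat.le_of_mul_le_mul_left h2 (by positivity)
  omega

/-- A function far from degree less than `m` is rejected with constant probability. On a typical
hyperplane it is far as well, unless it is close on so many hyperplanes that the approximations
glue; then it is at an intermediate distance, where inclusion-exclusion applies. -/
theorem rej_ge_of_far {m : ℕ} (d : ℕ) (f : F2Vec (m + d) → M)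
    (hf : ∀ g, DegLT m g → 2 ^ d ≤ 4 * (Finset.univ.filter fun x => f x ≠ g x).card) :
    (1 / 2 : ℝ) ^ 17 ≤ rej d f := by
  classical
  have hbase : ∀ d ≤ 8, ∀ f : F2Vec (m + d) → M,
      (∀ g, DegLT m g → 2 ^ d ≤ 4 * (Finset.univ.filter fun x => f x ≠ g x).card) →
      (1 / 2 : ℝ) ^ 16 ≤ rej d f := by
    intro d hd f hf
    have h1 : ¬ DegLT m f := by
      intro h
      have := hf f h
      simp at this
    refine le_trans ?_ (rej_ge_of_not_degLT d f h1)
    calc (1 / 2 : ℝ) ^ 16 = (1 / 4) ^ 8 := by norm_num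
      _ ≤ (1 / 4) ^ d := pow_le_pow_of_le_one (by norm_num) (by norm_num) hd
  by_cases hd8 : d ≤ 8
  · exact le_trans (by norm_num) (hbase d hd8 f hf)
  -- the bound improves on the claimed one by a factor that absorbs the losses in the induction
  suffices H : ∀ d, 8 ≤ d → ∀ f : F2Vec (m + d) → M,
      (∀ g, DegLT m g → 2 ^ d ≤ 4 * (Finset.univ.filter fun x => f x ≠ g x).card) →
      (1 / 2 : ℝ) ^ 17 * (1 + 256 * (1 / 2) ^ d) ≤ rej d f by
    refine le_trans ?_ (H d (by omega) f hf)
    have : (0 : ℝ) ≤ (1 / 2) ^ d := by positivity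
    nlinarith
  clear hf f hd8 d
  intro d hd
  induction d, hd using Nat.le_induction with
  | base =>
    intro f hf
    refine le_trans ?_ (hbase 8 le_rfl f hf)
    norm_num
  | succ d hd ih =>
    have key : ∀ f : F2Vec (m + d + 1) → M,
      (∀ g, DegLT m g → 2 ^ (d + 1) ≤ 4 * (Finset.univ.filter fun x => f x ≠ g x).card) →
      (1 / 2 : ℝ) ^ 17 * (1 + 256 * (1 / 2) ^ (d + 1)) ≤ rej (d + 1) f := by
      intro f hf
      -- the largest `w` with `4 * w < 2 ^ d`, so that `CloseOn m w` negates the induction hypothesis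
      set w : ℕ := (2 ^ d - 1) / 4 with hw
      have h2d : 256 ≤ 2 ^ d := (Nat.pow_le_pow_right (by norm_num) hd : 2 ^ 8 ≤ 2 ^ d)
      have hw4 : 4 * w < 2 ^ d := by omega
      have hy : ((1 : ℝ) / 2) ^ d ≤ 1 / 256 := by
        calc ((1 : ℝ) / 2) ^ d ≤ (1 / 2) ^ 8 :=
              pow_le_pow_of_le_one (by norm_num) (by norm_num) hd
          _ = 1 / 256 := by norm_num
      have hy0 : (0 : ℝ) < (1 / 2) ^ d := by positivity
      set S : Finset (F2Vec (m + d + 1)) :=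
        Finset.univ.filter fun l => l ≠ 0 ∧ ∃ c, CloseOn m w f l c with hS
      have hS0 : (0 : F2Vec (m + d + 1)) ∉ S := by simp [hS]
      rcases Nat.lt_or_ge S.card (64 * 2 ^ m) with hcard | hcard
      · -- few exceptional directions: average over hyperplanes
        have hprob := expect_row_mem hS0
        set q := 𝔼 A : GL (Fin ((m + d) + 1)) (ZMod 2), (if A.val 0 ∈ S then (1 : ℝ) else 0) with hq
        have hq0 : 0 ≤ q := expect_nonneg' fun A => by split_ifs <;> norm_num
        have hq2 : q ≤ 64 * (1 / 2) ^ d := by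
          have h1 : (S.card : ℝ) ≤ 64 * 2 ^ m := by exact_mod_cast hcard.le
          have h2 : (1 : ℝ) ≤ 2 ^ (m + d) := one_le_pow₀ (by norm_num)
          rw [pow_succ] at hprob
          have h3 : (2 : ℝ) ^ (m + d) * q ≤ 64 * 2 ^ m := by nlinarith
          rw [pow_add] at h3
          have h4 : (2 : ℝ) ^ m * (2 ^ d * q) ≤ 2 ^ m * 64 := by linarith
          have h5 := le_of_mul_le_mul_left h4 (by positivity)
          rw [one_div, inv_pow, ← div_eq_mul_inv, le_div_iff₀ (by positivity)]
          linarith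
        rw [rej_succ, expect_prod]
        have hA : ∀ A : GL (Fin ((m + d) + 1)) (ZMod 2),
            (1 - (if A.val 0 ∈ S then (1 : ℝ) else 0)) *
              ((1 / 2 : ℝ) ^ 17 * (1 + 256 * (1 / 2) ^ d)) ≤
            𝔼 z : F2Vec ((m + d) + 1), rej d (restr f (A, z)) := by
          intro A
          split_ifs with hAS
          · rw [sub_self, zero_mul]
            exact expect_nonneg' fun z => rej_nonneg _ _
          · rw [sub_zero, one_mul,
              ← Fintype.expect_const (ι := F2Vec (m + d + 1)) ((1 / 2 : ℝ) ^ 17 * _)]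
            refine expect_mono fun z => ih _ fun g hg => ?_
            by_contra hcon
            push Not at hcon
            refine hAS (Finset.mem_filter.2 ⟨Finset.mem_univ _, GL_row_ne_zero A, _,
              closeOn_of_restr f (A, z) hg ?_⟩)
            omega
        refine le_trans ?_ (expect_mono hA)
        rw [← Finset.expect_mul, Finset.expect_sub_distrib, ← hq,
          Fintype.expect_const (ι := GL (Fin ((m + d) + 1)) (ZMod 2)) (1 : ℝ)]
        have hpow : ((1 : ℝ) / 2) ^ (d + 1) = (1 / 2) ^ d / 2 := by rw [pow_succ]; ring
        rw [hpow]
        set y := ((1 : ℝ) / 2) ^ d with hydef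
        have hgoal : 1 + 256 * (y / 2) ≤ (1 - q) * (1 + 256 * y) := by nlinarith
        have : (0 : ℝ) < (1 / 2) ^ 17 := by positivity
        nlinarith
      · -- many exceptional directions: glue the approximations
        have hmem : ∀ l ∈ S, ∃ c, ∃ Q : F2Vec (m + d + 1) → M, DegLT m Q ∧
            (Finset.univ.filter fun x => l ⬝ᵥ x = c ∧ f x ≠ Q x).card ≤ w :=
          fun l hl => (Finset.mem_filter.1 hl).2.2
        choose! c P hP hPw using hmem
        obtain ⟨Q, hQ, hQP⟩ := exists_common_extension (m := m) hS0
          (le_trans (by omega) hcard) {i | i.1 ∈ S ∧ i.2 = c i.1}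
          (fun i hi => hi.1) c (fun l hl => ⟨hl, rfl⟩) (fun i => P i.1) (fun i hi => hP _ hi.1)
          (fun i hi j hj x hx hx' => by
            by_cases hij : i.1 = j.1
            · rw [hij]
            · refine eq_of_close_on_inter (hP _ hi.1) (hP _ hj.1)
                (Finset.mem_filter.1 hi.1).2.1 (Finset.mem_filter.1 hj.1).2.1 hij _ _ ?_ hx hx'
              have h1 := hPw _ hi.1
              have h2 := hPw _ hj.1
              rw [← hi.2] at h1
              rw [← hj.2] at h2
              have h3 : (Finset.univ.filter fun x => (i.1 ⬝ᵥ x = i.2 ∧ j.1 ⬝ᵥ x = j.2) ∧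
                  P i.1 x ≠ P j.1 x) ⊆ (Finset.univ.filter fun x => i.1 ⬝ᵥ x = i.2 ∧ f x ≠ P i.1 x)
                  ∪ (Finset.univ.filter fun x => j.1 ⬝ᵥ x = j.2 ∧ f x ≠ P j.1 x) := by
                intro y
                simp only [Finset.mem_filter, Finset.mem_univ, true_and, Finset.mem_union]
                rintro ⟨⟨h4, h5⟩, h6⟩
                by_cases h7 : f y = P i.1 y
                · exact Or.inr ⟨h5, fun h8 => h6 (h7.symm.trans h8)⟩
                · exact Or.inl ⟨h4, h7⟩
              have h4 := (Finset.card_le_card h3).trans (Finset.card_union_le _ _)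
              omega)
        set D := Finset.univ.filter fun x => f x ≠ Q x with hD
        have hDcard := card_le_of_hyperplanes (S := S) c D (w := w) (fun l hl => by
          refine le_trans (Finset.card_le_card ?_) (hPw l hl)
          intro y
          simp only [hD, Finset.mem_filter, Finset.mem_univ, true_and]
          rintro ⟨h1, h2⟩
          exact ⟨h2, by rw [← hQP (l, c l) ⟨hl, rfl⟩ y h2]; exact h1⟩)
        have hDlow := hf Q hQ
        have hDup : 8 * D.card ≤ 9 * 2 ^ d := by
          have h1 : 8 * (S.card * D.card) ≤ S.card * (32 * w + 2 ^ d) := by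
            have h2 : 2 ^ (m + d + 1) * 32 ≤ S.card * 2 ^ d := by
              calc 2 ^ (m + d + 1) * 32 = 64 * 2 ^ m * 2 ^ d := by rw [pow_succ, pow_add]; ring
                _ ≤ _ := Nat.mul_le_mul_right _ hcard
            nlinarith
          have hSpos : 0 < S.card := lt_of_lt_of_le (by positivity) hcard
          have h3 : S.card * (8 * D.card) ≤ S.card * (32 * w + 2 ^ d) := by linarith
          have := Nat.le_of_mul_le_mul_left h3 hSpos
          omega
        have hrej := rej_ge_of_near (m := m) (d := d + 1) f Q hQ rfl
        refine le_trans ?_ hrej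
        set x : ℝ := (D.card : ℝ) * (1 / 2) ^ (d + 1) with hx
        have hpow : (2 : ℝ) ^ (d + 1) * (1 / 2) ^ (d + 1) = 1 := by
          rw [← mul_pow]; norm_num
        have hp0 : (0 : ℝ) < (1 / 2) ^ (d + 1) := by positivity
        have hx1 : 1 / 4 ≤ x := by
          have : (2 : ℝ) ^ (d + 1) ≤ 4 * D.card := by exact_mod_cast hDlow
          nlinarith
        have hx2 : x ≤ 9 / 16 := by
          have : 16 * (D.card : ℝ) ≤ 9 * 2 ^ (d + 1) := by
            have : 8 * (D.card : ℝ) ≤ 9 * 2 ^ d := by exact_mod_cast hDup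
            rw [pow_succ]; linarith
          nlinarith
        have hpow' : ((1 : ℝ) / 2) ^ (d + 1) ≤ 1 := pow_le_one₀ (by norm_num) (by norm_num)
        have h1 : (1 / 2 : ℝ) ^ 17 * (1 + 256 * (1 / 2) ^ (d + 1)) ≤ 3 / 16 := by
          have : (1 / 2 : ℝ) ^ 17 = 1 / 131072 := by norm_num
          rw [this]; linarith
        exact h1.trans (show 3 / 16 ≤ x - x ^ 2 by nlinarith)
    exact key

/-- The rejection probability of the minimum-weight test is at least proportional to the distance,
up to the scale at which it is constant. -/
theorem rej_ge_min {m d : ℕ} (f : F2Vec (m + d) → M) (w : ℕ)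
    (hf : ∀ g, DegLT m g → w ≤ (Finset.univ.filter fun x => f x ≠ g x).card) :
    (1 / 2 : ℝ) ^ 17 * min ((w : ℝ) * (1 / 2) ^ d) 1 ≤ rej d f := by
  have h0 : (0 : ℝ) < (1 / 2) ^ d := by positivity
  by_cases hfar : ∀ g, DegLT m g → 2 ^ d ≤ 4 * (Finset.univ.filter fun x => f x ≠ g x).card
  · refine le_trans ?_ (rej_ge_of_far d f hfar)
    exact mul_le_of_le_one_right (by positivity) (min_le_right _ _)
  · push Not at hfar
    obtain ⟨g, hg, hlt⟩ := hfar
    refine le_trans ?_ (rej_ge_of_near f g hg rfl)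
    have h1 : (w : ℝ) ≤ (Finset.univ.filter fun x => f x ≠ g x).card := by exact_mod_cast hf g hg
    have h2 : 4 * ((Finset.univ.filter fun x => f x ≠ g x).card : ℝ) ≤ 2 ^ d := by
      exact_mod_cast hlt.le
    have hpow : (2 : ℝ) ^ d * (1 / 2) ^ d = 1 := by rw [← mul_pow]; norm_num
    set x : ℝ := ((Finset.univ.filter fun x => f x ≠ g x).card : ℝ) * (1 / 2) ^ d with hx
    have hx4 : x ≤ 1 / 4 := by nlinarith
    have hx0 : 0 ≤ x := by positivity
    have hwx : (w : ℝ) * (1 / 2) ^ d ≤ x := mul_le_mul_of_nonneg_right h1 h0.le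
    have hmin : min ((w : ℝ) * (1 / 2) ^ d) 1 ≤ x := (min_le_left _ _).trans hwx
    have h17 : (1 / 2 : ℝ) ^ 17 ≤ 1 / 2 := by norm_num
    calc (1 / 2 : ℝ) ^ 17 * min ((w : ℝ) * (1 / 2) ^ d) 1 ≤ (1 / 2 : ℝ) ^ 17 * x :=
          mul_le_mul_of_nonneg_left hmin (by positivity)
      _ ≤ 1 / 2 * x := mul_le_mul_of_nonneg_right h17 hx0
      _ ≤ x - x ^ 2 := by nlinarith

end RejectionTheorem

/-! ### Averages and expectations with values in a real vector space -/

section Averages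

variable {ι κ E F : Type*} [Fintype ι] [Fintype κ] [AddCommGroup E] [Module ℝ E] [AddCommGroup F]
  [Module ℝ F]

/-- The average of a family of vectors. -/
noncomputable def avg (f : ι → E) : E := (Fintype.card ι : ℝ)⁻¹ • ∑ i, f i

/-- The expectation of a vector-valued function under a probability mass function. -/
noncomputable def pmfMean (p : PMF ι) (f : ι → E) : E := ∑ i, (p i).toReal • f i

theorem avg_add (f g : ι → E) : avg (fun i => f i + g i) = avg f + avg g := by
  simp only [avg, Finset.sum_add_distrib, smul_add]

theorem avg_sub (f g : ι → E) : avg (fun i => f i - g i) = avg f - avg g := by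
  simp only [avg, Finset.sum_sub_distrib, smul_sub]

theorem avg_smul (c : ℝ) (f : ι → E) : avg (fun i => c • f i) = c • avg f := by
  simp only [avg, ← Finset.smul_sum, smul_comm c]

theorem avg_sum {τ : Type*} (s : Finset τ) (f : τ → ι → E) :
    avg (fun i => ∑ j ∈ s, f j i) = ∑ j ∈ s, avg (f j) := by
  simp only [avg, Finset.smul_sum]
  rw [Finset.sum_comm]

theorem map_avg (L : E →ₗ[ℝ] F) (f : ι → E) : L (avg f) = avg fun i => L (f i) := by
  simp only [avg, map_smul, map_sum]

theorem avg_equiv (e : ι ≃ κ) (f : κ → E) : avg (fun i => f (e i)) = avg f := by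
  simp only [avg, Fintype.card_congr e, e.sum_comp]

theorem avg_const [Nonempty ι] (a : E) : avg (fun _ : ι => a) = a := by
  have : (Fintype.card ι : ℝ) ≠ 0 := by exact_mod_cast Fintype.card_ne_zero
  rw [avg, Finset.sum_const, Finset.card_univ, ← Nat.cast_smul_eq_nsmul ℝ, smul_smul,
    inv_mul_cancel₀ this, one_smul]

theorem avg_comm (f : ι → κ → E) : avg (fun i => avg (f i)) = avg fun j => avg fun i => f i j := by
  simp only [avg, ← Finset.smul_sum]
  rw [smul_comm, Finset.sum_comm]

theorem avg_prod (f : ι × κ → E) : avg f = avg fun i => avg fun j => f (i, j) := by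
  simp only [avg, ← Finset.smul_sum, Fintype.sum_prod_type, smul_smul, Fintype.card_prod,
    Nat.cast_mul, mul_inv]

theorem avg_mono {f g : ι → ℝ} (h : ∀ i, f i ≤ g i) : avg f ≤ avg g :=
  mul_le_mul_of_nonneg_left (Finset.sum_le_sum fun i _ => h i) (by positivity)

theorem avg_le {f : ι → ℝ} [Nonempty ι] {b : ℝ} (h : ∀ i, f i ≤ b) : avg f ≤ b :=
  (avg_mono h).trans (avg_const b).le

theorem pmf_sum_toReal (p : PMF ι) : ∑ i, (p i).toReal = 1 := by
  rw [← ENNReal.toReal_sum fun i _ => p.apply_ne_top i, ← tsum_fintype (L := .unconditional ι), p.tsum_coe, ENNReal.toReal_one]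

theorem pmfMean_add (p : PMF ι) (f g : ι → E) :
    pmfMean p (fun i => f i + g i) = pmfMean p f + pmfMean p g := by
  simp only [pmfMean, Finset.sum_add_distrib, smul_add]

theorem pmfMean_smul (p : PMF ι) (c : ℝ) (f : ι → E) :
    pmfMean p (fun i => c • f i) = c • pmfMean p f := by
  simp only [pmfMean, Finset.smul_sum, smul_comm c]

theorem map_pmfMean (L : E →ₗ[ℝ] F) (p : PMF ι) (f : ι → E) :
    L (pmfMean p f) = pmfMean p fun i => L (f i) := by
  simp only [pmfMean, map_smul, map_sum]

theorem pmfMean_const (p : PMF ι) (a : E) : pmfMean p (fun _ => a) = a := by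
  rw [pmfMean, ← Finset.sum_smul, pmf_sum_toReal, one_smul]

theorem pmfMean_mono (p : PMF ι) {f g : ι → ℝ} (h : ∀ i, f i ≤ g i) : pmfMean p f ≤ pmfMean p g :=
  Finset.sum_le_sum fun i _ => mul_le_mul_of_nonneg_left (h i) ENNReal.toReal_nonneg

theorem pmfMean_avg_comm (p : PMF ι) (f : ι → κ → E) :
    pmfMean p (fun i => avg (f i)) = avg fun j => pmfMean p fun i => f i j := by
  simp only [pmfMean, avg, Finset.smul_sum]
  rw [Finset.sum_comm]
  refine Finset.sum_congr rfl fun i _ => Finset.sum_congr rfl fun j _ => ?_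
  rw [smul_comm]

theorem pmfMean_bind (p : PMF κ) (q : κ → PMF ι) (f : ι → E) :
    pmfMean (p.bind q) f = pmfMean p fun a => pmfMean (q a) f := by
  simp only [pmfMean, PMF.bind_apply, Finset.smul_sum]
  rw [Finset.sum_comm]
  refine Finset.sum_congr rfl fun i _ => ?_
  rw [tsum_fintype, ENNReal.toReal_sum fun a _ =>
    ENNReal.mul_ne_top (p.apply_ne_top a) ((q a).apply_ne_top i), Finset.sum_smul]
  simp only [ENNReal.toReal_mul, smul_smul]

theorem pmfMean_pure (a : ι) (f : ι → E) : pmfMean (PMF.pure a) f = f a := by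
  classical
  rw [pmfMean, Finset.sum_eq_single a]
  · simp
  · intro b _ hb; simp [hb]
  · simp

theorem pmfMean_map (p : PMF κ) (g : κ → ι) (f : ι → E) :
    pmfMean (p.map g) f = pmfMean p fun a => f (g a) := by
  rw [PMF.map, pmfMean_bind]
  simp only [Function.comp_apply, pmfMean_pure]

theorem pmfMean_uniform [Nonempty ι] (f : ι → E) :
    pmfMean (PMF.uniformOfFintype ι) f = avg f := by
  simp only [pmfMean, PMF.uniformOfFintype_apply, avg, Finset.smul_sum, ENNReal.toReal_inv,
    ENNReal.toReal_natCast]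

end Averages

/-! ### Characters of the noise distributions -/

section Noise

theorem pmfMean_poisson_bind {M : Type*} [Fintype M] (s : NNReal) (q : ℕ → PMF M) (χ : M → ℝ) :
    pmfMean ((ProbabilityTheory.poissonMeasure s).toPMF.bind q) χ =
      ∑' n : ℕ, (Real.exp (-s) * s ^ n / n.factorial) * pmfMean (q n) χ := by
  have hp : ∀ n, ((ProbabilityTheory.poissonMeasure s).toPMF n).toReal =
      Real.exp (-s) * s ^ n / n.factorial := fun n => by
    rw [MeasureTheory.Measure.toPMF_apply, ProbabilityTheory.poissonMeasure_singleton,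
      ENNReal.toReal_ofReal (by positivity)]
  have hne : ∀ x, ∑' n, (ProbabilityTheory.poissonMeasure s).toPMF n * q n x ≠ ⊤ := fun x =>
    ((ProbabilityTheory.poissonMeasure s).toPMF.bind q).apply_ne_top x
  have hsum : ∀ x, Summable fun n => (Real.exp (-s) * s ^ n / n.factorial) * (q n x).toReal := by
    intro x
    have := ENNReal.summable_toReal (hne x)
    simpa only [ENNReal.toReal_mul, hp] using this
  simp only [pmfMean, smul_eq_mul, PMF.bind_apply, Finset.mul_sum]
  rw [Summable.tsum_finsetSum]
  · refine Finset.sum_congr rfl fun x _ => ?_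
    rw [ENNReal.tsum_toReal_eq fun n => ENNReal.mul_ne_top (PMF.apply_ne_top _ n)
      (PMF.apply_ne_top _ x), ← tsum_mul_right]
    refine tsum_congr fun n => ?_
    rw [ENNReal.toReal_mul, hp, mul_assoc]
  · intro x _
    simpa only [mul_assoc] using (hsum x).mul_right (χ x)

/-- A character is multiplicative along independent steps. -/
theorem pmfMean_iidSum {M : Type} [AddCommMonoid M] [Fintype M] (step : PMF M) {χ : M → ℝ}
    (h0 : χ 0 = 1) (hadd : ∀ x y, χ (x + y) = χ x * χ y) (m : ℕ) :
    pmfMean (iidSum step m) χ = pmfMean step χ ^ m := by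
  induction m with
  | zero => rw [iidSum, pmfMean_pure, h0, pow_zero]
  | succ m ih =>
    rw [iidSum, pmfMean_bind]
    simp only [pmfMean_map, hadd]
    rw [pow_succ, ← ih]
    simp only [pmfMean, smul_eq_mul]
    rw [Finset.sum_mul_sum]
    refine Finset.sum_congr rfl fun x _ => ?_
    rw [Finset.mul_sum]
    refine Finset.sum_congr rfl fun y _ => ?_
    ring

/-- The Fourier transform of a continuous-time random walk. -/
theorem pmfMean_continuousWalk {M : Type} [AddCommMonoid M] [Fintype M] {s : ℝ} (hs : 0 ≤ s)
    (step : PMF M) {χ : M → ℝ} (h0 : χ 0 = 1) (hadd : ∀ x y, χ (x + y) = χ x * χ y) :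
    pmfMean (continuousWalk s step) χ = Real.exp (-(s * (1 - pmfMean step χ))) := by
  rw [continuousWalk, pmfMean_poisson_bind]
  simp only [pmfMean_iidSum step h0 hadd]
  have hS : ((s.toNNReal : NNReal) : ℝ) = s := Real.coe_toNNReal s hs
  rw [hS]
  set r := pmfMean step χ
  have h1 : ∀ n : ℕ, Real.exp (-s) * s ^ n / n.factorial * r ^ n =
      Real.exp (-s) * ((s * r) ^ n / n.factorial) := fun n => by rw [mul_pow]; ring
  simp only [h1]
  rw [tsum_mul_left, (NormedSpace.expSeries_div_hasSum_exp (s * r)).tsum_eq,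
    ← Real.exp_eq_exp_ℝ, ← Real.exp_add]
  congr 1; ring

variable {n d t : ℕ}

/-- The character of the short code given by a word `α`, as a linear form. -/
def pairHom (d : ℕ) (α : F2Vec n → F2Vec t) : ShortCode n d t →+ ZMod 2 where
  toFun x := ∑ i, ∑ j, α i j * (x j).1 i
  map_zero' := by simp
  map_add' x y := by simp [mul_add, Finset.sum_add_distrib]

theorem avg_sgn_dotProduct (v : F2Vec t) :
    avg (fun w : F2Vec t => sgn (v ⬝ᵥ w)) = if v = 0 then 1 else 0 := by
  split_ifs with h
  · simp only [h, zero_dotProduct, sgn_zero]; exact avg_const 1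
  · rw [avg, show ∑ w : F2Vec t, sgn (v ⬝ᵥ w) = 0 from sum_sgn_eq_zero (dotHom v) (dotHom_ne_zero h),
      smul_zero]

open scoped BigOperators in
theorem rej_eq_avg {M : Type*} [AddCommGroup M] [Module (ZMod 2) M] [DecidableEq M]
    (f : F2Vec n → M) : rej d f = avg fun p : GL (Fin n) (ZMod 2) × F2Vec n =>
      if ∑ x, (minWord d p.1 p.2).1 x • f x = 0 then (0 : ℝ) else 1 := by
  rw [rej, Fintype.expect_eq_sum_div_card, avg, smul_eq_mul, div_eq_inv_mul]

/-- A jump of the short code multiplies the character of `α` by the probability that a random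
minimum-weight codeword `q` does not detect `α`: averaging over `w ∈ Ω` kills the character unless
`∑ q x • α x = 0`. -/
theorem pmfMean_shortCodeStep (α : F2Vec n → F2Vec t) :
    pmfMean (shortCodeStep n d t) (fun x => sgn (pairHom d α x)) = 1 - rej d α := by
  rw [shortCodeStep, pmfMean_bind, pmfMean_uniform]
  simp only [pmfMean_map, rmStep, pmfMean_uniform]
  rw [avg_comm]
  have h1 : ∀ (p : GL (Fin n) (ZMod 2) × F2Vec n) (w : F2Vec t),
      pairHom d α (fun j => w j • minWord d p.1 p.2) =
        (∑ x, (minWord d p.1 p.2).1 x • α x) ⬝ᵥ w := by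
    intro p w
    rw [sum_dotProduct]
    refine Finset.sum_congr rfl fun i _ => ?_
    rw [smul_dotProduct, dotProduct, smul_eq_mul, Finset.mul_sum]
    refine Finset.sum_congr rfl fun j _ => ?_
    show α i j * (w j * (minWord d p.1 p.2).1 i) = _
    ring
  simp only [h1, avg_sgn_dotProduct]
  have h2 : ∀ p : GL (Fin n) (ZMod 2) × F2Vec n,
      (if ∑ x, (minWord d p.1 p.2).1 x • α x = 0 then (1 : ℝ) else 0) =
        1 - if ∑ x, (minWord d p.1 p.2).1 x • α x = 0 then (0 : ℝ) else 1 := fun p => by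
    split_ifs <;> norm_num
  simp only [h2]
  rw [avg_sub, avg_const, ← rej_eq_avg]

/-- A jump of the base code is not averaged over the alphabet, so it contracts twice as much as a jump
of the short code. The factor `2` compensates the shorter time of the walk. -/
theorem pmfMean_rmStep (α : F2Vec n → F2Vec 1) :
    pmfMean (rmStep n d) (fun x => sgn (pairHom d α fun _ => x)) = 1 - 2 * rej d α := by
  rw [rmStep, pmfMean_map, pmfMean_uniform]
  have h2 : ∀ p : GL (Fin n) (ZMod 2) × F2Vec n, sgn (pairHom d α fun _ => minWord d p.1 p.2) =
      1 - (2 : ℝ) • if ∑ x, (minWord d p.1 p.2).1 x • α x = 0 then (0 : ℝ) else 1 := ?_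
  · simp only [h2]
    rw [avg_sub, avg_const, avg_smul, ← rej_eq_avg, smul_eq_mul]
  intro p
  have h1 : (pairHom d α fun _ => minWord d p.1 p.2) =
      (∑ x, (minWord d p.1 p.2).1 x • α x) 0 := by
    simp only [pairHom, AddMonoidHom.coe_mk, ZeroHom.coe_mk, Finset.univ_unique,
      Finset.sum_singleton, Finset.sum_apply, Pi.smul_apply, smul_eq_mul]
    exact Finset.sum_congr rfl fun i _ => mul_comm _ _
  have h3 : (∑ x, (minWord d p.1 p.2).1 x • α x) = 0 ↔
      (∑ x, (minWord d p.1 p.2).1 x • α x) 0 = 0 := by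
    refine ⟨fun h => congrFun h 0, fun h => funext fun j => ?_⟩
    rw [Subsingleton.elim j 0]; exact h
  simp only [h1, sgn, h3]
  split_ifs <;> norm_num

theorem le_log_one_div_one_sub {ε : ℝ} (h1 : ε < 1) : ε ≤ Real.log (1 / (1 - ε)) := by
  have h2 : 0 < 1 - ε := by linarith
  rw [one_div, Real.log_inv]
  have := Real.log_le_sub_one_of_pos h2
  linarith

/-- The noise of the short code is diagonal in the characters, and its multipliers are given by the
rejection probabilities of the minimum-weight test. -/
theorem pmfMean_shortCodeNoise {ε : ℝ} (h0 : 0 < ε) (h1 : ε < 1) (α : F2Vec n → F2Vec t) :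
    pmfMean (shortCodeNoise n d t ε) (fun x => sgn (pairHom d α x)) =
      Real.exp (-(2 ^ d * Real.log (1 / (1 - ε)) * rej d α)) := by
  have hl := le_log_one_div_one_sub h1
  rw [shortCodeNoise, pmfMean_continuousWalk (mul_nonneg (by positivity) (h0.le.trans hl)) _ (by rw [map_zero, sgn_zero])
    (fun x y => by rw [map_add, sgn_add]), pmfMean_shortCodeStep, sub_sub_cancel]

theorem pmfMean_rmNoise {η : ℝ} (h0 : 0 < η) (h1 : η < 1) (α : F2Vec n → F2Vec 1) :
    pmfMean (rmNoise n d η) (fun x => sgn (pairHom d α fun _ => x)) =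
      Real.exp (-(2 ^ d * Real.log (1 / (1 - η)) * rej d α)) := by
  have hl := le_log_one_div_one_sub h1
  rw [rmNoise, pmfMean_continuousWalk (mul_nonneg (by positivity) (h0.le.trans hl)) _ (by
    rw [← sgn_zero, ← map_zero (pairHom d α)]; rfl) (fun x y => by
    rw [← sgn_add, ← map_add]; rfl), pmfMean_rmStep, sub_sub_cancel]
  congr 1; ring

end Noise

/-! ### Fourier analysis on finite elementary abelian 2-groups -/

section Fourier

variable {G : Type*} [AddCommGroup G] [Fintype G]

instance instFiniteF2Dual : Finite (G →+ ZMod 2) :=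
  Finite.of_injective (fun f => (f : G → ZMod 2)) DFunLike.coe_injective

noncomputable instance instFintypeF2Dual : Fintype (G →+ ZMod 2) := Fintype.ofFinite _

theorem avg_sgn [DecidableEq (G →+ ZMod 2)] (φ : G →+ ZMod 2) :
    avg (fun x => sgn (φ x)) = if φ = 0 then 1 else 0 := by
  split_ifs with h
  · simp only [h, AddMonoidHom.zero_apply, sgn_zero]; exact avg_const 1
  · rw [avg, sum_sgn_eq_zero φ h, smul_zero]

variable [Module (ZMod 2) G]

theorem sum_dual_sgn_aux {x : G} (hx : x ≠ 0) : ∑ φ : G →+ ZMod 2, sgn (φ x) = 0 := by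
  obtain ⟨f, hf⟩ : ∃ f : Module.Dual (ZMod 2) G, f x ≠ 0 := by
    by_contra hcon
    push Not at hcon
    exact hx ((Module.forall_dual_apply_eq_zero_iff (ZMod 2) x).1 hcon)
  refine sum_sgn_eq_zero (AddMonoidHom.eval x) fun h => hf ?_
  exact congrArg (fun g : (G →+ ZMod 2) →+ ZMod 2 => g f.toAddMonoidHom) h

theorem card_F2Dual : Fintype.card (G →+ ZMod 2) = Fintype.card G := by
  have h1 : ∑ x : G, ∑ φ : G →+ ZMod 2, sgn (φ x) = Fintype.card (G →+ ZMod 2) := by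
    rw [Finset.sum_eq_single 0 (fun x _ hx => sum_dual_sgn_aux hx) (by simp)]
    simp [sgn_zero]
  have h2 : ∑ x : G, ∑ φ : G →+ ZMod 2, sgn (φ x) = Fintype.card G := by
    rw [Finset.sum_comm, Finset.sum_eq_single 0 (fun φ _ hφ => sum_sgn_eq_zero φ hφ) (by simp)]
    simp [sgn_zero]
  exact_mod_cast h1.symm.trans h2

theorem sum_dual_sgn [DecidableEq G] (x : G) :
    ∑ φ : G →+ ZMod 2, sgn (φ x) = if x = 0 then (Fintype.card G : ℝ) else 0 := by
  split_ifs with hx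
  · simp [hx, sgn_zero, card_F2Dual]
  · exact sum_dual_sgn_aux hx

variable {E : Type*} [AddCommGroup E] [Module ℝ E]

/-- The Fourier coefficient of a vector-valued function. -/
noncomputable def fhat (f : G → E) (φ : G →+ ZMod 2) : E := avg fun x => sgn (φ x) • f x

theorem fourier_inversion (f : G → E) (x : G) : f x = ∑ φ, sgn (φ x) • fhat f φ := by
  classical
  simp only [fhat, avg, smul_smul, Finset.smul_sum]
  rw [Finset.sum_comm]
  have h : ∀ y, ∑ φ : G →+ ZMod 2, (sgn (φ x) * ((Fintype.card G : ℝ)⁻¹ * sgn (φ y))) • f y =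
      if y = x then f x else 0 := by
    intro y
    have h1 : ∀ φ : G →+ ZMod 2, sgn (φ x) * ((Fintype.card G : ℝ)⁻¹ * sgn (φ y)) =
        (Fintype.card G : ℝ)⁻¹ * sgn (φ (x + y)) := fun φ => by
      rw [map_add, sgn_add]; ring
    simp only [h1]
    rw [← Finset.sum_smul, ← Finset.mul_sum, sum_dual_sgn]
    by_cases hxy : y = x
    · subst hxy
      rw [if_pos (add_self_of_module_two y), if_pos rfl, inv_mul_cancel₀, one_smul]
      exact_mod_cast Fintype.card_ne_zero
    · rw [if_neg hxy, if_neg, mul_zero, zero_smul]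
      rw [← sub_eq_add_of_module_two, sub_eq_zero]
      exact fun h => hxy h.symm
  simp only [h]
  simp

/-- Convolution multiplies Fourier coefficients. -/
theorem fhat_pmfMean (μ : PMF G) (f : G → E) (φ : G →+ ZMod 2) :
    fhat (fun x => pmfMean μ fun z => f (x + z)) φ =
      pmfMean μ (fun z => sgn (φ z)) • fhat f φ := by
  have h1 : fhat (fun x => pmfMean μ fun z => f (x + z)) φ =
      avg fun x => pmfMean μ fun z => sgn (φ x) • f (x + z) := by
    simp only [fhat, pmfMean_smul]
  rw [h1, ← pmfMean_avg_comm]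
  simp only [pmfMean, smul_eq_mul, Finset.sum_smul]
  refine Finset.sum_congr rfl fun z _ => ?_
  rw [mul_smul]
  congr 1
  rw [fhat, ← avg_smul, ← avg_equiv (Equiv.addRight z)]
  congr 1; funext x
  simp only [Equiv.coe_addRight, map_add, sgn_add, smul_smul]
  rw [mul_comm (sgn (φ x)), add_assoc, add_self_of_module_two, add_zero]

variable {A : Type*} [CommRing A] [Algebra ℝ A]

theorem avg_mul_left {ι : Type*} [Fintype ι] (a : A) (f : ι → A) :
    avg (fun i => a * f i) = a * avg f := by
  simp only [avg, ← Finset.mul_sum, mul_smul_comm]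

theorem parseval (f g : G → A) : avg (fun x => f x * g x) = ∑ φ, fhat f φ * fhat g φ := by
  have h : ∀ x, f x * g x = ∑ φ : G →+ ZMod 2, fhat f φ * (sgn (φ x) • g x) := by
    intro x
    conv_lhs => rw [fourier_inversion f x]
    rw [Finset.sum_mul]
    refine Finset.sum_congr rfl fun φ _ => ?_
    rw [smul_mul_assoc, mul_smul_comm]
  simp only [h]
  rw [avg_sum]
  refine Finset.sum_congr rfl fun φ _ => ?_
  rw [avg_mul_left]
  rfl

/-- The moment `avg f² g²` of two trigonometric polynomials, in terms of their coefficients. -/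
theorem avg_quartic [DecidableEq (G →+ ZMod 2)] {K : Type*} [Fintype K] [AddCommGroup K]
    (Ψ : K →+ (G →+ ZMod 2)) (c e : K → A) :
    avg (fun x => (∑ α, sgn (Ψ α x) • c α) ^ 2 * (∑ α, sgn (Ψ α x) • e α) ^ 2) =
      ∑ α, ∑ α', ∑ β, ∑ β', if Ψ (α + α' + β + β') = 0 then c α * c α' * (e β * e β') else 0 := by
  have h : ∀ x, (∑ α, sgn (Ψ α x) • c α) ^ 2 * (∑ α, sgn (Ψ α x) • e α) ^ 2 =
      ∑ α, ∑ α', ∑ β, ∑ β', sgn (Ψ (α + α' + β + β') x) • (c α * c α' * (e β * e β')) := by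
    intro x
    rw [sq, sq, Finset.sum_mul_sum, Finset.sum_mul_sum, Finset.sum_mul]
    refine Finset.sum_congr rfl fun α _ => ?_
    rw [Finset.sum_mul]
    refine Finset.sum_congr rfl fun α' _ => ?_
    rw [Finset.mul_sum]
    refine Finset.sum_congr rfl fun β _ => ?_
    rw [Finset.mul_sum]
    refine Finset.sum_congr rfl fun β' _ => ?_
    rw [smul_mul_smul_comm, smul_mul_smul_comm, smul_mul_smul_comm]
    congr 1
    simp only [map_add, AddMonoidHom.add_apply, sgn_add]
    ring
  simp only [h, avg_sum]
  refine Finset.sum_congr rfl fun α _ => Finset.sum_congr rfl fun α' _ =>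
    Finset.sum_congr rfl fun β _ => Finset.sum_congr rfl fun β' _ => ?_
  have h2 := avg_sgn (Ψ (α + α' + β + β'))
  rw [avg, ← Finset.sum_smul, smul_smul]
  rw [avg, smul_eq_mul] at h2
  rw [h2]
  split_ifs <;> simp

end Fourier

/-! ### Characters of the short code -/

section Characters

variable {n d t : ℕ}

theorem degLT_of_mem_RM {f : F2Vec n → ZMod 2} (hf : f ∈ RM n d) : DegLT (d + 1) f := by
  obtain ⟨p, hp, rfl⟩ := hf
  have hp' := (MvPolynomial.mem_restrictTotalDegree _ _ _).1 hp
  have h : (MvPolynomial.evalₗ (ZMod 2) (Fin n) p : F2Vec n → ZMod 2) =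
      ∑ m ∈ p.support, fun x => (∏ i ∈ m.support, x i) • p.coeff m := by
    funext x
    rw [MvPolynomial.evalₗ_apply, MvPolynomial.eval_eq, Finset.sum_apply]
    refine Finset.sum_congr rfl fun m _ => ?_
    rw [smul_eq_mul, mul_comm]
    congr 1
    refine Finset.prod_congr rfl fun i hi => ?_
    have hmi : m i ≠ 0 := Finsupp.mem_support_iff.1 hi
    rcases zmod_two_cases (x i) with h | h <;> simp [h, hmi]
  rw [h]
  refine DegLT.sum _ fun m hm => ?_
  have h1 : DegLT (m.support.card + 1) fun x : F2Vec n => ∏ i ∈ m.support, x i :=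
    degLT_prod m.support (fun i (x : F2Vec n) => x i) fun i _ => by
      have := degLT_dotProduct (Pi.single i 1 : F2Vec n) 0
      simpa only [single_one_dotProduct, add_zero] using this
  refine (DegLT.smul h1 (DegLT.const (p.coeff m))).mono ?_
  have h2 : m.support.card ≤ ∑ i ∈ m.support, m i := by
    rw [Finset.card_eq_sum_ones]
    exact Finset.sum_le_sum fun i hi => Nat.one_le_iff_ne_zero.2 (Finsupp.mem_support_iff.1 hi)
  have h3 : ∑ i ∈ m.support, m i ≤ p.totalDegree := MvPolynomial.le_totalDegree hm
  omega

/-- Low degree is orthogonal to the Reed–Muller code. -/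
theorem pairHom_eq_zero_of_degLT {m : ℕ} {α : F2Vec (m + d) → F2Vec t} (hα : DegLT m α) :
    pairHom d α = 0 := by
  refine AddMonoidHom.ext fun x => ?_
  show ∑ i, ∑ j, α i j * (x j).1 i = 0
  rw [Finset.sum_comm]
  refine Finset.sum_eq_zero fun j _ => ?_
  have h := ((DegLT.smul (degLT_of_mem_RM (x j).2) hα).mono (add_comm d m).le).sum_eq_zero
  have h2 := congrFun h j
  rw [Finset.sum_apply] at h2
  rw [← Pi.zero_apply (M := fun _ : Fin t => ZMod 2) j, ← h2]
  exact Finset.sum_congr rfl fun i _ => mul_comm _ _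

/-- The number of nonzero positions of a word. -/
def wt {ι : Type*} [Fintype ι] {t : ℕ} (α : ι → F2Vec t) : ℕ := (Finset.univ.filter fun i => α i ≠ 0).card

theorem wt_add_le (α β : F2Vec n → F2Vec t) : wt (α + β) ≤ wt α + wt β := by
  refine (Finset.card_le_card ?_).trans (Finset.card_union_le _ _)
  intro i
  simp only [Finset.mem_filter, Finset.mem_univ, true_and, Finset.mem_union, Pi.add_apply]
  intro h
  by_contra hcon
  push Not at hcon
  exact h (by rw [hcon.1, hcon.2, add_zero])

/-- A nonzero function of small support is not orthogonal to the Reed–Muller code: separate the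
points of its support by coordinate hyperplanes, always keeping the smaller half. -/
theorem exists_mem_RM_sum_ne_zero (g : F2Vec n → ZMod 2) (hg : g ≠ 0)
    (hw : (Finset.univ.filter fun i => g i ≠ 0).card < 2 ^ (d + 1)) :
    ∃ q ∈ RM n d, ∑ i, g i * q i ≠ 0 := by
  obtain ⟨x, hx⟩ : ∃ x, g x ≠ 0 := by
    by_contra hcon; push Not at hcon; exact hg (funext hcon)
  by_cases hsing : ∀ y, g y ≠ 0 → y = x
  · refine ⟨fun _ => 1, const_mem_RM n d 1, ?_⟩
    rw [Finset.sum_eq_single x]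
    · simpa using hx
    · intro y _ hy
      rw [not_not.1 fun h => hy (hsing y h), zero_mul]
    · simp
  push Not at hsing
  obtain ⟨y, hy, hyx⟩ := hsing
  induction d generalizing g x y with
  | zero =>
    have : 1 < (Finset.univ.filter fun i => g i ≠ 0).card :=
      Finset.one_lt_card.2 ⟨x, by simpa using hx, y, by simpa using hy, hyx.symm⟩
    omega
  | succ d ih =>
    obtain ⟨k, hk⟩ : ∃ k, y k ≠ x k := by
      by_contra hcon; push Not at hcon; exact hyx (funext hcon)
    set h : ZMod 2 → F2Vec n → ZMod 2 := fun b i => if i k = b then g i else 0 with hh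
    have hne : ∀ b, ∃ i, h b i ≠ 0 := by
      intro b
      by_cases hb : x k = b
      · exact ⟨x, by simpa [hh, hb] using hx⟩
      · refine ⟨y, ?_⟩
        have : y k = b := by
          revert hb hk; generalize x k = p; generalize y k = q; revert p q b; decide
        simpa [hh, this] using hy
    have hcard : (Finset.univ.filter fun i => h 0 i ≠ 0).card +
        (Finset.univ.filter fun i => h 1 i ≠ 0).card ≤
        (Finset.univ.filter fun i => g i ≠ 0).card := by
      rw [← Finset.card_union_of_disjoint]
      · refine Finset.card_le_card fun i => ?_
        simp only [hh, Finset.mem_union, Finset.mem_filter, Finset.mem_univ, true_and]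
        rintro (h | h) hg0 <;> exact h (by simp [hg0])
      · rw [Finset.disjoint_left]
        intro i
        simp only [hh, Finset.mem_filter, Finset.mem_univ, true_and]
        intro h1 h2
        rcases zmod_two_cases (i k) with h | h <;> simp [h] at h1 h2
    obtain ⟨b, hb⟩ : ∃ b, (Finset.univ.filter fun i => h b i ≠ 0).card < 2 ^ (d + 1) := by
      rw [pow_succ] at hw
      by_contra hcon
      push Not at hcon
      have := hcon 0
      have := hcon 1
      omega
    obtain ⟨q, hq, hsum⟩ : ∃ q ∈ RM n d, ∑ i, h b i * q i ≠ 0 := by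
      obtain ⟨x', hx'⟩ := hne b
      by_cases hsing : ∀ y, h b y ≠ 0 → y = x'
      · refine ⟨fun _ => 1, const_mem_RM n d 1, ?_⟩
        rw [Finset.sum_eq_single x']
        · simpa using hx'
        · intro y _ hy
          rw [not_not.1 fun h => hy (hsing y h), zero_mul]
        · simp
      · push Not at hsing
        obtain ⟨y', hy', hyx'⟩ := hsing
        exact ih (h b) (fun h0 => hx' (congrFun h0 x')) hb x' hx' y' hy' hyx'
    obtain ⟨p, hp, rfl⟩ := hq
    refine ⟨fun i => MvPolynomial.eval i (p * (MvPolynomial.X k + MvPolynomial.C (b + 1))),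
      mem_RM _ ?_ (fun i => rfl), ?_⟩
    · refine (MvPolynomial.totalDegree_mul _ _).trans
        (add_le_add ((MvPolynomial.mem_restrictTotalDegree _ _ _).1 hp) ?_)
      refine (MvPolynomial.totalDegree_add _ _).trans (max_le ?_ ?_)
      · rw [MvPolynomial.totalDegree_X]
      · rw [MvPolynomial.totalDegree_C]; exact zero_le_one
    · convert hsum using 1
      refine Finset.sum_congr rfl fun i _ => ?_
      simp only [hh, map_mul, map_add, MvPolynomial.eval_X, MvPolynomial.eval_C,
        MvPolynomial.evalₗ_apply]
      split_ifs with hi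
      · rw [hi, ← add_assoc, zmod_two_add_self, zero_add, mul_one]
      · rw [zmod_two_eq_add_one hi, zmod_two_add_self, mul_zero, mul_zero, zero_mul]

/-- The dual of the short code has minimum distance at least `2 ^ (d + 1)`. -/
theorem eq_zero_of_pairHom_eq_zero {α : F2Vec n → F2Vec t} (hα : pairHom d α = 0)
    (hw : wt α < 2 ^ (d + 1)) : α = 0 := by
  classical
  by_contra hne
  obtain ⟨j, hj⟩ : ∃ j, (fun i => α i j) ≠ 0 := by
    by_contra hcon
    push Not at hcon
    exact hne (funext fun i => funext fun j => congrFun (hcon j) i)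
  obtain ⟨q, hq, hsum⟩ := exists_mem_RM_sum_ne_zero (d := d) (fun i => α i j) hj (by
    refine lt_of_le_of_lt (Finset.card_le_card ?_) hw
    intro i
    simp only [Finset.mem_filter, Finset.mem_univ, true_and]
    exact fun h h0 => h (by rw [h0]; rfl))
  apply hsum
  have h := DFunLike.congr_fun hα (Pi.single j ⟨q, hq⟩ : ShortCode n d t)
  have h' : ∑ i, ∑ j', α i j' * ((Pi.single j ⟨q, hq⟩ : ShortCode n d t) j').1 i = 0 := h
  rw [← h']
  refine Finset.sum_congr rfl fun i _ => ?_
  rw [Finset.sum_eq_single j]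
  · simp
  · intro j' _ hj'; simp [hj']
  · simp

theorem pairHom_add (α β : F2Vec n → F2Vec t) :
    pairHom d (α + β) = pairHom d α + pairHom d β := by
  refine AddMonoidHom.ext fun x => ?_
  show ∑ i, ∑ j, (α + β) i j * (x j).1 i = ∑ i, ∑ j, α i j * (x j).1 i + ∑ i, ∑ j, β i j * (x j).1 i
  simp only [Pi.add_apply, add_mul, Finset.sum_add_distrib]

/-- `pairHom` as a homomorphism in the word. -/
noncomputable def pairHomHom (n d t : ℕ) : (F2Vec n → F2Vec t) →+ (ShortCode n d t →+ ZMod 2) :=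
  AddMonoidHom.mk' (pairHom d) pairHom_add

/-- Characters of low weight have a unique word of low weight. -/
theorem pairHom_injOn {α β : F2Vec n → F2Vec t} {l : ℕ} (hα : wt α ≤ l) (hβ : wt β ≤ l)
    (hl : 2 * l < 2 ^ (d + 1)) (h : pairHom d α = pairHom d β) : α = β := by
  have h1 : pairHom d (α + β) = 0 := by
    rw [pairHom_add, h]; exact AddMonoidHom.ext fun x => zmod_two_add_self _
  have h2 := eq_zero_of_pairHom_eq_zero h1 (by have := wt_add_le α β; omega)
  rwa [← sub_eq_add_of_module_two, sub_eq_zero] at h2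

/-- Every character of the short code is given by a word, not uniquely. -/
theorem exists_pairHom_eq (φ : ShortCode n d t →+ ZMod 2) : ∃ α, φ = pairHom d α := by
  classical
  have h : ∀ j : Fin t, ∃ a : F2Vec n → ZMod 2, ∀ q : RM n d,
      φ (Pi.single j q) = ∑ i, a i * q.1 i := by
    intro j
    set f : RM n d →ₗ[ZMod 2] ZMod 2 :=
      (φ.comp (AddMonoidHom.single (fun _ : Fin t => RM n d) j)).toZModLinearMap 2 with hf
    obtain ⟨g, hg⟩ := LinearMap.exists_extend f
    refine ⟨fun i => g (Pi.single i 1), fun q => ?_⟩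
    have h1 : φ (Pi.single j q) = g q.1 := (LinearMap.congr_fun hg q).symm
    rw [h1, LinearMap.pi_apply_eq_sum_univ g q.1]
    refine Finset.sum_congr rfl fun i _ => ?_
    rw [smul_eq_mul, mul_comm]
    congr 2
    funext k
    simp [Pi.single_apply, eq_comm]
  choose a ha using h
  refine ⟨fun i j => a j i, ?_⟩
  refine AddMonoidHom.ext fun x => ?_
  show φ x = ∑ i, ∑ j, a j i * (x j).1 i
  conv_lhs => rw [← Finset.univ_sum_single x]
  rw [map_sum, Finset.sum_comm]
  exact Finset.sum_congr rfl fun j _ => ha j (x j)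

/-- A character of the short code either has low weight or is likely to be rejected by a random
minimum-weight codeword. -/
theorem pairHom_dichotomy (hd : d ≤ n) (l : ℕ) (φ : ShortCode n d t →+ ZMod 2) :
    (∃ α, wt α ≤ l ∧ φ = pairHom d α) ∨ ∃ α : F2Vec n → F2Vec t, φ = pairHom d α ∧
      (1 / 2 : ℝ) ^ 17 * min (((l + 1 : ℕ) : ℝ) * (1 / 2) ^ d) 1 ≤ rej d α := by
  obtain ⟨m, rfl⟩ : ∃ m, n = m + d := ⟨n - d, by omega⟩
  obtain ⟨α, rfl⟩ := exists_pairHom_eq φ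
  by_cases h : ∃ g, DegLT m g ∧ (Finset.univ.filter fun x => α x ≠ g x).card ≤ l
  · obtain ⟨g, hg, hcard⟩ := h
    left
    refine ⟨α + g, ?_, ?_⟩
    · refine le_trans (Finset.card_le_card ?_) hcard
      intro i
      simp only [Finset.mem_filter, Finset.mem_univ, true_and, Pi.add_apply]
      rw [← sub_eq_add_of_module_two, sub_ne_zero]
      exact id
    · rw [pairHom_add, pairHom_eq_zero_of_degLT hg, add_zero]
  · push Not at h
    exact Or.inr ⟨α, rfl, rej_ge_min α _ fun g hg => h g hg⟩

end Characters

/-! ### Sums of squares of linear polynomials -/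

section SumsOfSquares

open MvPolynomial

variable {σ : Type}

/-- The polynomials of degree at most `j`. -/
noncomputable abbrev polyDeg (σ : Type) (j : ℕ) : Submodule ℝ (MvPolynomial σ ℝ) := restrictTotalDegree σ ℝ j

theorem mem_polyDeg {j : ℕ} {p : MvPolynomial σ ℝ} : p ∈ polyDeg σ j ↔ p.totalDegree ≤ j :=
  mem_restrictTotalDegree _ _ _

theorem polyDeg_mono {i j : ℕ} (h : i ≤ j) {p : MvPolynomial σ ℝ} (hp : p ∈ polyDeg σ i) :
    p ∈ polyDeg σ j := mem_polyDeg.2 ((mem_polyDeg.1 hp).trans h)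

theorem polyDeg_mul {i j k : ℕ} (hk : i + j ≤ k) {p q : MvPolynomial σ ℝ} (hp : p ∈ polyDeg σ i)
    (hq : q ∈ polyDeg σ j) : p * q ∈ polyDeg σ k :=
  mem_polyDeg.2 ((totalDegree_mul _ _).trans
    ((add_le_add (mem_polyDeg.1 hp) (mem_polyDeg.1 hq)).trans hk))

theorem avg_mem {V ι : Type*} [Fintype ι] [AddCommGroup V] [Module ℝ V] (S : Submodule ℝ V)
    {f : ι → V} (h : ∀ i, f i ∈ S) : avg f ∈ S :=
  S.smul_mem _ (S.sum_mem fun i _ => h i)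

theorem pmfMean_mem {V ι : Type*} [Fintype ι] [AddCommGroup V] [Module ℝ V] (S : Submodule ℝ V)
    (μ : PMF ι) {f : ι → V} (h : ∀ i, f i ∈ S) : pmfMean μ f ∈ S :=
  S.sum_mem fun i _ => S.smul_mem _ (h i)

/-- The sums of squares of polynomials of degree at most one. -/
noncomputable def sqCone (σ : Type) : AddSubmonoid (MvPolynomial σ ℝ) :=
  AddSubmonoid.closure {p | ∃ q ∈ polyDeg σ 1, p = q * q}

theorem mul_self_mem_sqCone {q : MvPolynomial σ ℝ} (hq : q ∈ polyDeg σ 1) : q * q ∈ sqCone σ :=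
  AddSubmonoid.subset_closure ⟨q, hq, rfl⟩

theorem smul_mem_sqCone {c : ℝ} (hc : 0 ≤ c) {p : MvPolynomial σ ℝ} (hp : p ∈ sqCone σ) :
    c • p ∈ sqCone σ := by
  induction hp using AddSubmonoid.closure_induction with
  | mem p hp =>
    obtain ⟨q, hq, rfl⟩ := hp
    have : c • (q * q) = (√c • q) * (√c • q) := by
      rw [smul_mul_smul_comm, Real.mul_self_sqrt hc]
    rw [this]
    exact mul_self_mem_sqCone (Submodule.smul_mem _ _ hq)
  | zero => rw [smul_zero]; exact zero_mem _
  | add p q _ _ hp hq => rw [smul_add]; exact add_mem hp hq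

theorem avg_mem_sqCone {ι : Type*} [Fintype ι] {f : ι → MvPolynomial σ ℝ}
    (h : ∀ i, f i ∈ sqCone σ) : avg f ∈ sqCone σ :=
  smul_mem_sqCone (by positivity) (sum_mem fun i _ => h i)

theorem pmfMean_mem_sqCone {ι : Type*} [Fintype ι] (μ : PMF ι) {f : ι → MvPolynomial σ ℝ}
    (h : ∀ i, f i ∈ sqCone σ) : pmfMean μ f ∈ sqCone σ :=
  sum_mem fun i _ => smul_mem_sqCone ENNReal.toReal_nonneg (h i)

theorem sqCone_le_polyDeg {p : MvPolynomial σ ℝ} (hp : p ∈ sqCone σ) : p ∈ polyDeg σ 2 := by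
  induction hp using AddSubmonoid.closure_induction with
  | mem p hp => obtain ⟨q, hq, rfl⟩ := hp; exact polyDeg_mul le_rfl hq hq
  | zero => exact zero_mem _
  | add p q _ _ hp hq => exact add_mem hp hq

/-- The Cauchy–Schwarz inequality for finite sums, as a sum of squares. -/
theorem cauchy_schwarz_mem_sqCone {ι : Type*} (S : Finset ι) {a : ι → MvPolynomial σ ℝ}
    (ha : ∀ i, a i ∈ polyDeg σ 1) :
    (S.card : ℝ) • ∑ i ∈ S, a i * a i - (∑ i ∈ S, a i) * ∑ i ∈ S, a i ∈ sqCone σ := by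
  have h : (S.card : ℝ) • ∑ i ∈ S, a i * a i - (∑ i ∈ S, a i) * ∑ i ∈ S, a i =
      (1 / 2 : ℝ) • ∑ i ∈ S, ∑ j ∈ S, (a i - a j) * (a i - a j) := by
    have h1 : ∀ i j, (a i - a j) * (a i - a j) = a i * a i + a j * a j - (2 : ℝ) • (a i * a j) := by
      intro i j
      rw [two_smul]; ring
    simp only [h1, Finset.sum_sub_distrib, Finset.sum_add_distrib, Finset.sum_const,
      ← Finset.smul_sum]
    rw [← Finset.sum_mul_sum, ← Nat.cast_smul_eq_nsmul ℝ]
    module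
  rw [h]
  exact smul_mem_sqCone (by norm_num) (sum_mem fun i _ => sum_mem fun j _ =>
    mul_self_mem_sqCone (Submodule.sub_mem _ (ha i) (ha j)))

/-- Jensen's inequality for the square and a probability mass function, as a sum of squares. -/
theorem jensen_mem_sqCone {ι : Type*} [Fintype ι] (μ : PMF ι) {a : ι → MvPolynomial σ ℝ}
    (ha : ∀ i, a i ∈ polyDeg σ 1) :
    pmfMean μ (fun i => a i * a i) - pmfMean μ a * pmfMean μ a ∈ sqCone σ := by
  have h : pmfMean μ (fun i => a i * a i) - pmfMean μ a * pmfMean μ a =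
      pmfMean μ fun i => (a i - pmfMean μ a) * (a i - pmfMean μ a) := by
    have h1 : ∀ i, (a i - pmfMean μ a) * (a i - pmfMean μ a) =
        a i * a i + ((-2 : ℝ) • (a i * pmfMean μ a) + pmfMean μ a * pmfMean μ a) := by
      intro i
      rw [neg_smul, two_smul]; ring
    simp only [h1, pmfMean_add, pmfMean_smul, pmfMean_const]
    have h2 : pmfMean μ (fun i => a i * pmfMean μ a) = pmfMean μ a * pmfMean μ a := by
      conv_rhs => rw [pmfMean, Finset.sum_mul]
      simp only [smul_mul_assoc]
      rfl
    rw [h2]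
    module
  rw [h]
  exact pmfMean_mem_sqCone μ fun i =>
    mul_self_mem_sqCone (Submodule.sub_mem _ (ha i) (pmfMean_mem _ μ ha))

variable {E : MvPolynomial σ ℝ →ₗ[ℝ] ℝ}

theorem IsPseudoExpectation.mul_self_nonneg (hE : IsPseudoExpectation 8 E) {p : MvPolynomial σ ℝ}
    (hp : p ∈ polyDeg σ 4) : 0 ≤ E (p * p) := by
  rw [← sq]
  exact hE.positivity p (by have := mem_polyDeg.1 hp; omega)

theorem IsPseudoExpectation.mul_nonneg (hE : IsPseudoExpectation 8 E) {p q : MvPolynomial σ ℝ}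
    (hp : p ∈ sqCone σ) (hq : q ∈ sqCone σ) : 0 ≤ E (p * q) := by
  induction hp using AddSubmonoid.closure_induction with
  | mem p hp =>
    obtain ⟨a, ha, rfl⟩ := hp
    induction hq using AddSubmonoid.closure_induction with
    | mem q hq =>
      obtain ⟨b, hb, rfl⟩ := hq
      rw [mul_mul_mul_comm]
      exact hE.mul_self_nonneg (polyDeg_mul (by norm_num) ha hb)
    | zero => simp
    | add q r _ _ hq hr => rw [mul_add, map_add]; exact add_nonneg hq hr
  | zero => simp
  | add p r _ _ hp hr => rw [add_mul, map_add]; exact add_nonneg hp hr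

theorem one_mem_sqCone : (1 : MvPolynomial σ ℝ) ∈ sqCone σ := by
  have : (1 : MvPolynomial σ ℝ) ∈ polyDeg σ 1 := mem_polyDeg.2 (by simp)
  simpa using mul_self_mem_sqCone this

theorem IsPseudoExpectation.nonneg (hE : IsPseudoExpectation 8 E) {p : MvPolynomial σ ℝ}
    (hp : p ∈ sqCone σ) : 0 ≤ E p := by
  simpa using hE.mul_nonneg hp one_mem_sqCone

/-- Inequalities that hold up to `sqCone` can be multiplied under a pseudo-expectation of level `8`:
the products of two squares of linear polynomials are squares of degree-`2` polynomials. -/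
theorem IsPseudoExpectation.mul_le_mul (hE : IsPseudoExpectation 8 E)
    {p p' q q' : MvPolynomial σ ℝ} (hp : p' - p ∈ sqCone σ) (hq : q' - q ∈ sqCone σ)
    (hp' : p' ∈ sqCone σ) (hq0 : q ∈ sqCone σ) : E (p * q) ≤ E (p' * q') := by
  have h1 := hE.mul_nonneg hp hq0
  have h2 := hE.mul_nonneg hp' hq
  rw [sub_mul, map_sub] at h1
  rw [mul_sub, map_sub] at h2
  linarith

end SumsOfSquares

/-! ### Hypercontractivity -/

section Hypercontractivity

open MvPolynomial

variable {σ : Type} {t : ℕ}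

section Words

variable {ι : Type*} [Fintype ι] [DecidableEq ι]

/-- The pairing of words over the alphabet `F2Vec t`, whose signs are the characters of the product
space. -/
def wordDot (α y : ι → F2Vec t) : ZMod 2 := ∑ i, α i ⬝ᵥ y i

/-- The function on the product space with Fourier coefficients `c`. -/
noncomputable def wordVal (c : (ι → F2Vec t) → MvPolynomial σ ℝ) (y : ι → F2Vec t) :
    MvPolynomial σ ℝ := ∑ α, sgn (wordDot α y) • c α

/-- The sum of the squares of the coefficients with weights `b ^ wt α`. -/
noncomputable def wtNorm (b : ℝ) (c : (ι → F2Vec t) → MvPolynomial σ ℝ) : MvPolynomial σ ℝ :=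
  ∑ α, b ^ wt α • (c α * c α)

/-- The influence of the position `j`, with weights `b ^ wt α`. -/
noncomputable def wtInf (b : ℝ) (j : ι) (c : (ι → F2Vec t) → MvPolynomial σ ℝ) :
    MvPolynomial σ ℝ :=
  ∑ α, (if α j = 0 then (0 : ℝ) else b ^ wt α) • (c α * c α)

theorem wtNorm_mem {b : ℝ} (hb : 0 ≤ b) {c : (ι → F2Vec t) → MvPolynomial σ ℝ}
    (hc : ∀ α, c α ∈ polyDeg σ 1) : wtNorm b c ∈ sqCone σ :=
  sum_mem fun α _ => smul_mem_sqCone (by positivity) (mul_self_mem_sqCone (hc α))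

theorem wtInf_mem {b : ℝ} (hb : 0 ≤ b) (j : ι) {c : (ι → F2Vec t) → MvPolynomial σ ℝ}
    (hc : ∀ α, c α ∈ polyDeg σ 1) : wtInf b j c ∈ sqCone σ :=
  sum_mem fun α _ => smul_mem_sqCone (by split_ifs <;> positivity) (mul_self_mem_sqCone (hc α))

theorem wordVal_mem {c : (ι → F2Vec t) → MvPolynomial σ ℝ} (hc : ∀ α, c α ∈ polyDeg σ 1)
    (y : ι → F2Vec t) : wordVal c y ∈ polyDeg σ 1 :=
  Submodule.sum_mem _ fun α _ => Submodule.smul_mem _ _ (hc α)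

end Words

theorem sum_words_succ {N : ℕ} {V : Type*} [AddCommMonoid V] (f : (Fin (N + 1) → F2Vec t) → V) :
    ∑ α, f α = ∑ s : F2Vec t, ∑ α : Fin N → F2Vec t, f (Fin.cons s α) := by
  rw [← (Fin.consEquiv (fun _ : Fin (N + 1) => F2Vec t)).sum_comp, Fintype.sum_prod_type]
  rfl

theorem wt_cons {N : ℕ} (s : F2Vec t) (α : Fin N → F2Vec t) :
    wt (Fin.cons s α : Fin (N + 1) → F2Vec t) = (if s = 0 then 0 else 1) + wt α := by
  rw [wt, wt, Finset.card_filter, Finset.card_filter, Fin.sum_univ_succ]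
  simp

theorem sum_eq_zero_add {V : Type*} [AddCommMonoid V] (f : F2Vec t → V) :
    ∑ s, f s = f 0 + ∑ s ∈ Finset.univ.erase 0, f s :=
  (Finset.add_sum_erase _ _ (Finset.mem_univ 0)).symm

theorem wtNorm_succ {N : ℕ} (b : ℝ) (c : (Fin (N + 1) → F2Vec t) → MvPolynomial σ ℝ) :
    wtNorm b c = wtNorm b (fun α => c (Fin.cons 0 α)) +
      b • ∑ s ∈ Finset.univ.erase 0, wtNorm b (fun α => c (Fin.cons s α)) := by
  rw [wtNorm, sum_words_succ, sum_eq_zero_add]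
  congr 1
  · simp only [wt_cons, if_true, zero_add]; rfl
  · rw [Finset.smul_sum]
    refine Finset.sum_congr rfl fun s hs => ?_
    simp only [wt_cons, if_neg (Finset.ne_of_mem_erase hs), wtNorm, Finset.smul_sum, smul_smul,
      pow_add, pow_one]

theorem wtInf_succ {N : ℕ} (b : ℝ) (j : Fin N) (c : (Fin (N + 1) → F2Vec t) → MvPolynomial σ ℝ) :
    wtInf b j.succ c = wtInf b j (fun α => c (Fin.cons 0 α)) +
      b • ∑ s ∈ Finset.univ.erase 0, wtInf b j (fun α => c (Fin.cons s α)) := by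
  rw [wtInf, sum_words_succ, sum_eq_zero_add]
  congr 1
  · simp only [wt_cons, if_true, zero_add, Fin.cons_succ]; rfl
  · rw [Finset.smul_sum]
    refine Finset.sum_congr rfl fun s hs => ?_
    simp only [wt_cons, if_neg (Finset.ne_of_mem_erase hs), wtInf, Finset.smul_sum, smul_smul,
      pow_add, pow_one, Fin.cons_succ, mul_ite, mul_zero]

theorem wtInf_zero {N : ℕ} (b : ℝ) (c : (Fin (N + 1) → F2Vec t) → MvPolynomial σ ℝ) :
    wtInf b 0 c = b • ∑ s ∈ Finset.univ.erase 0, wtNorm b (fun α => c (Fin.cons s α)) := by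
  rw [wtInf, sum_words_succ, sum_eq_zero_add]
  simp only [Fin.cons_zero, if_true, zero_smul, Finset.sum_const_zero, zero_add, Finset.smul_sum]
  refine Finset.sum_congr rfl fun s hs => ?_
  simp only [wt_cons, if_neg (Finset.ne_of_mem_erase hs), wtNorm, Finset.smul_sum, smul_smul,
      pow_add, pow_one]

theorem wordVal_cons {N : ℕ} (c : (Fin (N + 1) → F2Vec t) → MvPolynomial σ ℝ) (s : F2Vec t)
    (y : Fin N → F2Vec t) : wordVal c (Fin.cons s y : Fin (N + 1) → F2Vec t) =
      ∑ a : F2Vec t, sgn (a ⬝ᵥ s) • wordVal (fun α => c (Fin.cons a α)) y := by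
  rw [wordVal, sum_words_succ]
  refine Finset.sum_congr rfl fun a _ => ?_
  rw [wordVal, Finset.smul_sum]
  refine Finset.sum_congr rfl fun α _ => ?_
  rw [smul_smul, ← sgn_add]
  congr 2
  simp [wordDot, Fin.sum_univ_succ]

variable {E : MvPolynomial σ ℝ →ₗ[ℝ] ℝ}

/-- The inductive step of the hypercontractive inequality: two functions of one coordinate. -/
theorem quartic_step (hE : IsPseudoExpectation 8 E) {F H : F2Vec t → MvPolynomial σ ℝ}
    (hF : ∀ s, F s ∈ polyDeg σ 1) (hH : ∀ s, H s ∈ polyDeg σ 1) :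
    E (avg fun y : F2Vec t => (∑ s, sgn (s ⬝ᵥ y) • F s) ^ 2 * (∑ s, sgn (s ⬝ᵥ y) • H s) ^ 2) ≤
      E (F 0 ^ 2 * H 0 ^ 2) + 4 * ∑ s ∈ Finset.univ.erase 0, E (F 0 ^ 2 * H s ^ 2) +
      4 * ∑ s ∈ Finset.univ.erase 0, E (F s ^ 2 * H 0 ^ 2) +
      3 * (2 ^ t) ^ 2 * ∑ s ∈ Finset.univ.erase 0, ∑ s' ∈ Finset.univ.erase 0,
        E (F s ^ 2 * H s' ^ 2) := by
  classical
  set T : Finset (F2Vec t) := Finset.univ.erase 0 with hT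
  set f : F2Vec t → MvPolynomial σ ℝ := fun y => ∑ s ∈ T, sgn (s ⬝ᵥ y) • F s with hf
  set h : F2Vec t → MvPolynomial σ ℝ := fun y => ∑ s ∈ T, sgn (s ⬝ᵥ y) • H s with hh
  have hfm : ∀ y, f y ∈ polyDeg σ 1 := fun y =>
    Submodule.sum_mem _ fun s _ => Submodule.smul_mem _ _ (hF s)
  have hhm : ∀ y, h y ∈ polyDeg σ 1 := fun y =>
    Submodule.sum_mem _ fun s _ => Submodule.smul_mem _ _ (hH s)
  have hsplit : ∀ (F : F2Vec t → MvPolynomial σ ℝ) y, ∑ s, sgn (s ⬝ᵥ y) • F s =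
      F 0 + ∑ s ∈ T, sgn (s ⬝ᵥ y) • F s := fun F y => by
    rw [sum_eq_zero_add, zero_dotProduct, sgn_zero, one_smul]
  -- first and second moments of the mean-zero parts
  have hmean : ∀ F : F2Vec t → MvPolynomial σ ℝ, avg (fun y => ∑ s ∈ T, sgn (s ⬝ᵥ y) • F s) = 0 := by
    intro F
    rw [avg_sum]
    refine Finset.sum_eq_zero fun s hs => ?_
    have h1 := avg_sgn_dotProduct s
    rw [if_neg (Finset.ne_of_mem_erase hs), avg, smul_eq_mul] at h1
    rw [avg, ← Finset.sum_smul, smul_smul, h1, zero_smul]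
  have hsecond : ∀ F : F2Vec t → MvPolynomial σ ℝ,
      avg (fun y => (∑ s ∈ T, sgn (s ⬝ᵥ y) • F s) ^ 2) = ∑ s ∈ T, F s ^ 2 := by
    intro F
    have h1 : ∀ y, (∑ s ∈ T, sgn (s ⬝ᵥ y) • F s) ^ 2 =
        ∑ s ∈ T, ∑ s' ∈ T, sgn ((s + s') ⬝ᵥ y) • (F s * F s') := by
      intro y
      rw [sq, Finset.sum_mul_sum]
      refine Finset.sum_congr rfl fun s _ => Finset.sum_congr rfl fun s' _ => ?_
      rw [smul_mul_smul_comm, ← sgn_add, add_dotProduct]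
    simp only [h1, avg_sum]
    refine Finset.sum_congr rfl fun s hs => ?_
    have h2 : ∀ s', avg (fun y : F2Vec t => sgn ((s + s') ⬝ᵥ y) • (F s * F s')) =
        if s = s' then F s * F s' else 0 := by
      intro s'
      have h3 := avg_sgn_dotProduct (s + s')
      rw [avg, smul_eq_mul] at h3
      rw [avg, ← Finset.sum_smul, smul_smul, h3, ← sub_eq_add_of_module_two]
      simp only [sub_eq_zero]
      split_ifs <;> simp
    simp only [h2, Finset.sum_ite_eq, if_pos hs, sq]
  -- with `a = F 0`, `b = H 0`, add `2 (a h - f b)²`, `(a h - f h)²` and `(f b - f h)²` to the product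
  -- `(a + f)² (b + h)²`; the odd terms that are left are linear in `f` or in `h` and have mean zero
  have hpt : ∀ y, E ((∑ s, sgn (s ⬝ᵥ y) • F s) ^ 2 * (∑ s, sgn (s ⬝ᵥ y) • H s) ^ 2) ≤
      E (F 0 ^ 2 * H 0 ^ 2) + 4 * E (F 0 ^ 2 * h y ^ 2) + 4 * E (H 0 ^ 2 * f y ^ 2) +
      3 * E (f y ^ 2 * h y ^ 2) + 2 * E (F 0 * H 0 ^ 2 * f y) + 2 * E (F 0 ^ 2 * H 0 * h y) := by
    intro y
    rw [hsplit, hsplit]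
    have d2 : ∀ {p q : MvPolynomial σ ℝ}, p ∈ polyDeg σ 1 → q ∈ polyDeg σ 1 → p * q ∈ polyDeg σ 4 :=
      fun hp hq => polyDeg_mul (by norm_num) hp hq
    have e1 := hE.mul_self_nonneg (Submodule.sub_mem _ (d2 (hF 0) (hhm y)) (d2 (hfm y) (hH 0)))
    have e2 := hE.mul_self_nonneg (Submodule.sub_mem _ (d2 (hF 0) (hhm y)) (d2 (hfm y) (hhm y)))
    have e3 := hE.mul_self_nonneg (Submodule.sub_mem _ (d2 (hfm y) (hH 0)) (d2 (hfm y) (hhm y)))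
    have key : E ((F 0 ^ 2 * H 0 ^ 2) + (4 : ℝ) • (F 0 ^ 2 * h y ^ 2) +
        (4 : ℝ) • (H 0 ^ 2 * f y ^ 2) + (3 : ℝ) • (f y ^ 2 * h y ^ 2) +
        (2 : ℝ) • (F 0 * H 0 ^ 2 * f y) + (2 : ℝ) • (F 0 ^ 2 * H 0 * h y)) =
        E ((F 0 + f y) ^ 2 * (H 0 + h y) ^ 2) +
        (2 * E ((F 0 * h y - f y * H 0) * (F 0 * h y - f y * H 0)) +
        E ((F 0 * h y - f y * h y) * (F 0 * h y - f y * h y)) +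
        E ((f y * H 0 - f y * h y) * (f y * H 0 - f y * h y))) := by
      have e4 : (2 : ℝ) * E ((F 0 * h y - f y * H 0) * (F 0 * h y - f y * H 0)) =
        E ((2 : ℝ) • ((F 0 * h y - f y * H 0) * (F 0 * h y - f y * H 0))) := by
        rw [map_smul, smul_eq_mul]
      rw [e4, ← map_add, ← map_add, ← map_add]
      congr 1
      simp only [MvPolynomial.smul_eq_C_mul, map_ofNat]
      ring
    simp only [map_add, map_smul, smul_eq_mul] at key
    simp only [hf, hh] at *
    linarith
  -- the term in which both functions depend on the coordinate is bounded by Cauchy–Schwarz, at the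
  -- cost of the factor `(2 ^ t) ^ 2`
  have hcs : ∀ y, E (f y ^ 2 * h y ^ 2) ≤ (2 ^ t) ^ 2 * ∑ s ∈ T, ∑ s' ∈ T, E (F s ^ 2 * H s' ^ 2) := by
    intro y
    have hcard : ((T.card : ℕ) : ℝ) ≤ 2 ^ t := by
      have : T.card ≤ Fintype.card (F2Vec t) := Finset.card_le_univ _
      rw [Fintype.card_fun, ZMod.card, Fintype.card_fin] at this
      exact_mod_cast this
    have hsq : ∀ F : F2Vec t → MvPolynomial σ ℝ, (∀ s, F s ∈ polyDeg σ 1) →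
        (2 ^ t : ℝ) • ∑ s ∈ T, F s * F s -
          (∑ s ∈ T, sgn (s ⬝ᵥ y) • F s) * (∑ s ∈ T, sgn (s ⬝ᵥ y) • F s) ∈ sqCone σ := by
      intro F hF
      have h1 := cauchy_schwarz_mem_sqCone T (a := fun s => sgn (s ⬝ᵥ y) • F s)
        (fun s => Submodule.smul_mem _ _ (hF s))
      simp only [smul_mul_smul_comm, sgn_mul_self, one_smul] at h1
      have h2 : (2 ^ t - (T.card : ℝ)) • ∑ s ∈ T, F s * F s ∈ sqCone σ :=
        smul_mem_sqCone (by linarith) (sum_mem fun s _ => mul_self_mem_sqCone (hF s))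
      have := add_mem h1 h2
      convert this using 1
      module
    have hcone : ∀ F : F2Vec t → MvPolynomial σ ℝ, (∀ s, F s ∈ polyDeg σ 1) →
        (2 ^ t : ℝ) • ∑ s ∈ T, F s * F s ∈ sqCone σ := fun F hF =>
      smul_mem_sqCone (by positivity) (sum_mem fun s _ => mul_self_mem_sqCone (hF s))
    rw [sq (f y), sq (h y)]
    refine (hE.mul_le_mul (hsq F hF) (hsq H hH) (hcone F hF)
      (mul_self_mem_sqCone (hhm y))).trans (le_of_eq ?_)
    rw [smul_mul_smul_comm, map_smul, smul_eq_mul, ← sq, Finset.sum_mul_sum, map_sum]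
    simp only [map_sum, ← sq]
  rw [map_avg]
  refine (avg_mono hpt).trans ?_
  have hmul : ∀ (p : MvPolynomial σ ℝ) (g : F2Vec t → MvPolynomial σ ℝ),
      avg (fun y => E (p * g y)) = E (p * avg g) := by
    intro p g
    rw [← map_avg, avg_mul_left]
  have hlin : ∀ (r : ℝ) (g : F2Vec t → ℝ), avg (fun y => r * g y) = r * avg g := fun r g =>
    avg_smul r g
  simp only [avg_add, hlin, hmul, hmean F, hmean H, hsecond F, hsecond H, hf, hh, mul_zero, map_zero,
    add_zero, avg_const]
  have h3 : avg (fun y => E ((∑ s ∈ T, sgn (s ⬝ᵥ y) • F s) ^ 2 * (∑ s ∈ T, sgn (s ⬝ᵥ y) • H s) ^ 2)) ≤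
      (2 ^ t) ^ 2 * ∑ s ∈ T, ∑ s' ∈ T, E (F s ^ 2 * H s' ^ 2) := avg_le hcs
  rw [Finset.mul_sum, Finset.mul_sum, map_sum, map_sum]
  have h4 : ∀ s, E (H 0 ^ 2 * F s ^ 2) = E (F s ^ 2 * H 0 ^ 2) := fun s => by rw [mul_comm]
  simp only [h4]
  linarith

end Hypercontractivity

section Hypercontractivity

open MvPolynomial

variable {σ : Type} {t : ℕ} {E : MvPolynomial σ ℝ →ₗ[ℝ] ℝ}

/-- The pseudo-expectation of the mean of the product of two squares on the product space. -/
noncomputable def quarticMean {ι : Type*} [Fintype ι] [DecidableEq ι] (E : MvPolynomial σ ℝ →ₗ[ℝ] ℝ)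
    (c e : (ι → F2Vec t) → MvPolynomial σ ℝ) : ℝ :=
  E (avg fun y => wordVal c y ^ 2 * wordVal e y ^ 2)

theorem avg_words_succ {N : ℕ} {V : Type*} [AddCommGroup V] [Module ℝ V]
    (f : (Fin (N + 1) → F2Vec t) → V) :
    avg f = avg fun y : Fin N → F2Vec t => avg fun s : F2Vec t => f (Fin.cons s y) := by
  rw [avg_comm, ← avg_prod (fun p : F2Vec t × (Fin N → F2Vec t) => f (Fin.cons p.1 p.2)),
    ← avg_equiv (Fin.consEquiv (fun _ : Fin (N + 1) => F2Vec t))]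
  rfl

/-- `quartic_step` in the first coordinate, for each value of the others. -/
theorem quarticMean_succ_le (hE : IsPseudoExpectation 8 E) {N : ℕ}
    {c e : (Fin (N + 1) → F2Vec t) → MvPolynomial σ ℝ}
    (hc : ∀ α, c α ∈ polyDeg σ 1) (he : ∀ α, e α ∈ polyDeg σ 1) :
    quarticMean E c e ≤
      quarticMean E (fun α => c (Fin.cons 0 α)) (fun α => e (Fin.cons 0 α)) +
      4 * ∑ s ∈ Finset.univ.erase 0,
        quarticMean E (fun α => c (Fin.cons 0 α)) (fun α => e (Fin.cons s α)) +
      4 * ∑ s ∈ Finset.univ.erase 0,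
        quarticMean E (fun α => c (Fin.cons s α)) (fun α => e (Fin.cons 0 α)) +
      3 * (2 ^ t) ^ 2 * ∑ s ∈ Finset.univ.erase 0, ∑ s' ∈ Finset.univ.erase 0,
        quarticMean E (fun α => c (Fin.cons s α)) (fun α => e (Fin.cons s' α)) := by
  have h1 : quarticMean E c e = avg fun y : Fin N → F2Vec t => E (avg fun s : F2Vec t =>
      (∑ a : F2Vec t, sgn (a ⬝ᵥ s) • wordVal (fun α => c (Fin.cons a α)) y) ^ 2 *
      (∑ a : F2Vec t, sgn (a ⬝ᵥ s) • wordVal (fun α => e (Fin.cons a α)) y) ^ 2) := by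
    rw [quarticMean, avg_words_succ, map_avg]
    simp only [wordVal_cons]
  rw [h1]
  refine (avg_mono fun y => quartic_step hE (fun s => wordVal_mem (fun α => hc _) y)
    (fun s => wordVal_mem (fun α => he _) y)).trans (le_of_eq ?_)
  have hlin : ∀ (r : ℝ) (g : (Fin N → F2Vec t) → ℝ), avg (fun y => r * g y) = r * avg g :=
    fun r g => avg_smul r g
  simp only [avg_add, hlin, avg_sum, quarticMean, map_avg]

/-- A bound of the shape given by `quartic_step` is absorbed by giving the weight `b` to the words that
are nonzero at the coordinate: `4 ≤ b` suffices for the cross terms, and only the coefficient `r` of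
the terms with the coordinate in both factors requires a large `b`. -/
theorem IsPseudoExpectation.weighted_mul_le (hE : IsPseudoExpectation 8 E) {τ : Type*}
    (S : Finset τ) {p₀ q₀ : MvPolynomial σ ℝ} {p q : τ → MvPolynomial σ ℝ}
    (hp₀ : p₀ ∈ sqCone σ) (hq₀ : q₀ ∈ sqCone σ) (hp : ∀ s, p s ∈ sqCone σ)
    (hq : ∀ s, q s ∈ sqCone σ) {b r : ℝ} (hb : 4 ≤ b) (hr : r ≤ b ^ 2) :
    E (p₀ * q₀) + 4 * ∑ s ∈ S, E (p₀ * q s) + 4 * ∑ s ∈ S, E (p s * q₀) +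
      r * ∑ s ∈ S, ∑ s' ∈ S, E (p s * q s') ≤
    E ((p₀ + b • ∑ s ∈ S, p s) * (q₀ + b • ∑ s ∈ S, q s)) := by
  have h : E ((p₀ + b • ∑ s ∈ S, p s) * (q₀ + b • ∑ s ∈ S, q s)) =
      E (p₀ * q₀) + b * ∑ s ∈ S, E (p₀ * q s) + b * ∑ s ∈ S, E (p s * q₀) +
      b ^ 2 * ∑ s ∈ S, ∑ s' ∈ S, E (p s * q s') := by
    rw [add_mul, mul_add, mul_add, map_add, map_add, map_add, mul_smul_comm, smul_mul_assoc,
      smul_mul_smul_comm, map_smul, map_smul, map_smul, Finset.mul_sum, Finset.sum_mul,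
      Finset.sum_mul_sum, map_sum, map_sum, map_sum]
    simp only [map_sum, smul_eq_mul]
    ring
  rw [h]
  have n1 : 0 ≤ ∑ s ∈ S, E (p₀ * q s) := Finset.sum_nonneg fun s _ => hE.mul_nonneg hp₀ (hq s)
  have n2 : 0 ≤ ∑ s ∈ S, E (p s * q₀) := Finset.sum_nonneg fun s _ => hE.mul_nonneg (hp s) hq₀
  have n3 : 0 ≤ ∑ s ∈ S, ∑ s' ∈ S, E (p s * q s') :=
    Finset.sum_nonneg fun s _ => Finset.sum_nonneg fun s' _ => hE.mul_nonneg (hp s) (hq s')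
  have m1 := mul_le_mul_of_nonneg_right hb n1
  have m2 := mul_le_mul_of_nonneg_right hb n2
  have m3 := mul_le_mul_of_nonneg_right hr n3
  linarith

theorem quarticMean_fin_zero (b : ℝ)
    (c e : (Fin 0 → F2Vec t) → MvPolynomial σ ℝ) :
    quarticMean E c e = E (wtNorm b c * wtNorm b e) := by
  have hsum : ∀ f : (Fin 0 → F2Vec t) → MvPolynomial σ ℝ, ∑ α, f α = f default := fun f => by
    rw [Fintype.sum_unique]; exact congrArg f (Subsingleton.elim _ _)
  have hv : ∀ (c : (Fin 0 → F2Vec t) → MvPolynomial σ ℝ) y, wordVal c y = c default := fun c y => by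
    rw [wordVal, hsum]; simp [wordDot, sgn_zero]
  have hn : ∀ c : (Fin 0 → F2Vec t) → MvPolynomial σ ℝ, wtNorm b c = c default ^ 2 := fun c => by
    rw [wtNorm, hsum]; simp [wt, sq]
  simp only [quarticMean, hv, hn, avg_const]

/-- Crude hypercontractivity, without a degree restriction, for functions on `Ω ^ N`. -/
theorem quarticMean_le_crude_fin (hE : IsPseudoExpectation 8 E) {N : ℕ}
    {c e : (Fin N → F2Vec t) → MvPolynomial σ ℝ}
    (hc : ∀ α, c α ∈ polyDeg σ 1) (he : ∀ α, e α ∈ polyDeg σ 1) :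
    quarticMean E c e ≤ E (wtNorm (4 * 2 ^ t) c * wtNorm (4 * 2 ^ t) e) := by
  induction N with
  | zero => exact (quarticMean_fin_zero _ c e).le
  | succ N ih =>
    have hb : (4 : ℝ) ≤ 4 * 2 ^ t := by
      have : (1 : ℝ) ≤ 2 ^ t := one_le_pow₀ (by norm_num)
      linarith
    have hmem : ∀ {c : (Fin (N + 1) → F2Vec t) → MvPolynomial σ ℝ} (_ : ∀ α, c α ∈ polyDeg σ 1) s,
        wtNorm (4 * 2 ^ t) (fun α => c (Fin.cons s α)) ∈ sqCone σ := fun hc s =>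
      wtNorm_mem (by positivity) fun α => hc _
    have hih := fun s s' => ih (fun α => hc (Fin.cons s α)) (fun α => he (Fin.cons s' α))
    refine (quarticMean_succ_le hE hc he).trans ?_
    rw [wtNorm_succ, wtNorm_succ]
    refine le_trans ?_ (hE.weighted_mul_le _ (hmem hc 0) (hmem he 0) (hmem hc) (hmem he) hb
      (r := 3 * (2 ^ t) ^ 2) (by nlinarith [sq_nonneg ((2 : ℝ) ^ t)]))
    refine add_le_add (add_le_add (add_le_add (hih _ _) ?_) ?_) ?_
    · exact mul_le_mul_of_nonneg_left (Finset.sum_le_sum fun s _ => hih _ _) (by norm_num)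
    · exact mul_le_mul_of_nonneg_left (Finset.sum_le_sum fun s _ => hih _ _) (by norm_num)
    · exact mul_le_mul_of_nonneg_left (Finset.sum_le_sum fun s _ => Finset.sum_le_sum fun s' _ =>
        hih _ _) (by positivity)

/-- By induction on `N`: a position that is nonzero in both factors is paid for once, by
`quarticMean_le_crude_fin` applied to the remaining positions, and goes into the influence of that
position. All the other terms only need weights with base `4`. -/
theorem quarticMean_le_fin (hE : IsPseudoExpectation 8 E) {N : ℕ}
    {c e : (Fin N → F2Vec t) → MvPolynomial σ ℝ}
    (hc : ∀ α, c α ∈ polyDeg σ 1) (he : ∀ α, e α ∈ polyDeg σ 1) :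
    quarticMean E c e ≤ E (wtNorm 4 c * wtNorm 4 e) +
      ∑ j, E (wtInf (4 * 2 ^ t) j c * wtInf (4 * 2 ^ t) j e) := by
  induction N with
  | zero => simpa using (quarticMean_fin_zero 4 c e).le
  | succ N ih =>
    set M : ℝ := 4 * 2 ^ t with hM
    have hb : (4 : ℝ) ≤ M := by
      have : (1 : ℝ) ≤ 2 ^ t := one_le_pow₀ (by norm_num)
      linarith
    have hM2 : 3 * (2 ^ t) ^ 2 ≤ M ^ 2 := by rw [hM]; nlinarith [sq_nonneg ((2 : ℝ) ^ t)]
    set T : Finset (F2Vec t) := Finset.univ.erase 0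
    have hnorm : ∀ {b : ℝ} (_ : 0 ≤ b) {c : (Fin (N + 1) → F2Vec t) → MvPolynomial σ ℝ}
        (_ : ∀ α, c α ∈ polyDeg σ 1) s, wtNorm b (fun α => c (Fin.cons s α)) ∈ sqCone σ :=
      fun hb _ hc s => wtNorm_mem hb fun α => hc _
    have hinf : ∀ {c : (Fin (N + 1) → F2Vec t) → MvPolynomial σ ℝ}
        (_ : ∀ α, c α ∈ polyDeg σ 1) j s, wtInf M j (fun α => c (Fin.cons s α)) ∈ sqCone σ :=
      fun hc j s => wtInf_mem (by linarith) j fun α => hc _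
    have h4 : (0 : ℝ) ≤ 4 := by norm_num
    have hN := hE.weighted_mul_le T (hnorm h4 hc 0) (hnorm h4 he 0)
      (hnorm h4 hc) (hnorm h4 he) le_rfl (r := 0) (by norm_num)
    have hI : ∀ j : Fin N,
        E (wtInf M j (fun α => c (Fin.cons 0 α)) * wtInf M j (fun α => e (Fin.cons 0 α))) +
        4 * ∑ s ∈ T,
          E (wtInf M j (fun α => c (Fin.cons 0 α)) * wtInf M j (fun α => e (Fin.cons s α))) +
        4 * ∑ s ∈ T,
          E (wtInf M j (fun α => c (Fin.cons s α)) * wtInf M j (fun α => e (Fin.cons 0 α))) ≤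
        E (wtInf M j.succ c * wtInf M j.succ e) := fun j => by
      have := hE.weighted_mul_le T (hinf hc j 0) (hinf he j 0) (hinf hc j) (hinf he j) hb (r := 0)
        (by positivity)
      rwa [zero_mul, add_zero, ← wtInf_succ, ← wtInf_succ] at this
    rw [← wtNorm_succ, ← wtNorm_succ] at hN
    have hIsum := Finset.sum_le_sum fun j (_ : j ∈ Finset.univ) => hI j
    have hzero : 3 * (2 ^ t) ^ 2 * ∑ s ∈ T, ∑ s' ∈ T,
        quarticMean E (fun α => c (Fin.cons s α)) (fun α => e (Fin.cons s' α)) ≤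
        E (wtInf M 0 c * wtInf M 0 e) := by
      have h1 : E (wtInf M 0 c * wtInf M 0 e) = M ^ 2 * ∑ s ∈ T, ∑ s' ∈ T,
          E (wtNorm M (fun α => c (Fin.cons s α)) * wtNorm M (fun α => e (Fin.cons s' α))) := by
        rw [wtInf_zero, wtInf_zero, smul_mul_smul_comm, map_smul, smul_eq_mul, ← sq,
          Finset.sum_mul_sum, map_sum]
        simp only [map_sum]
        rfl
      rw [h1]
      have h2 : ∑ s ∈ T, ∑ s' ∈ T,
          quarticMean E (fun α => c (Fin.cons s α)) (fun α => e (Fin.cons s' α)) ≤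
          ∑ s ∈ T, ∑ s' ∈ T,
          E (wtNorm M (fun α => c (Fin.cons s α)) * wtNorm M (fun α => e (Fin.cons s' α))) :=
        Finset.sum_le_sum fun s _ => Finset.sum_le_sum fun s' _ =>
          quarticMean_le_crude_fin hE (fun α => hc _) fun α => he _
      refine (mul_le_mul_of_nonneg_left h2 (by positivity)).trans ?_
      refine mul_le_mul_of_nonneg_right hM2 ?_
      exact Finset.sum_nonneg fun s _ => Finset.sum_nonneg fun s' _ =>
        hE.mul_nonneg (hnorm (by linarith) hc s) (hnorm (by linarith) he s')
    have b0 := ih (fun α => hc (Fin.cons 0 α)) (fun α => he (Fin.cons 0 α))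
    have b1 := Finset.sum_le_sum fun s (_ : s ∈ T) =>
      ih (fun α => hc (Fin.cons 0 α)) (fun α => he (Fin.cons s α))
    have b2 := Finset.sum_le_sum fun s (_ : s ∈ T) =>
      ih (fun α => hc (Fin.cons s α)) (fun α => he (Fin.cons 0 α))
    have key := quarticMean_succ_le hE hc he
    rw [Fin.sum_univ_succ]
    simp only [zero_mul, add_zero, Finset.sum_add_distrib, ← Finset.mul_sum] at hN hIsum b1 b2
    rw [Finset.sum_comm (s := Finset.univ) (t := T), Finset.sum_comm (s := Finset.univ) (t := T)]
      at hIsum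
    linarith

end Hypercontractivity

section Hypercontractivity

open MvPolynomial

variable {σ : Type} {t : ℕ} {E : MvPolynomial σ ℝ →ₗ[ℝ] ℝ}

section Reindex

variable {ι κ : Type*} [Fintype ι] [DecidableEq ι] [Fintype κ] [DecidableEq κ] (r : ι ≃ κ)

theorem wt_comp_equiv (α : κ → F2Vec t) : wt (fun i => α (r i)) = wt α := by
  rw [wt, wt, Finset.card_filter, Finset.card_filter, ← r.sum_comp]

theorem sum_words_reindex {V : Type*} [AddCommMonoid V] (f : (ι → F2Vec t) → V) :
    ∑ α : κ → F2Vec t, f (fun i => α (r i)) = ∑ α, f α :=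
  (Equiv.arrowCongr r.symm (Equiv.refl (F2Vec t))).sum_comp f

theorem wtNorm_reindex (b : ℝ) (c : (ι → F2Vec t) → MvPolynomial σ ℝ) :
    wtNorm b (fun α : κ → F2Vec t => c fun i => α (r i)) = wtNorm b c := by
  rw [wtNorm, wtNorm, ← sum_words_reindex r]
  simp only [wt_comp_equiv]

theorem wtInf_reindex (b : ℝ) (j : ι) (c : (ι → F2Vec t) → MvPolynomial σ ℝ) :
    wtInf b (r j) (fun α : κ → F2Vec t => c fun i => α (r i)) = wtInf b j c := by
  rw [wtInf, wtInf, ← sum_words_reindex r]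
  simp only [wt_comp_equiv]

theorem wordVal_reindex (c : (ι → F2Vec t) → MvPolynomial σ ℝ) (y : κ → F2Vec t) :
    wordVal (fun α : κ → F2Vec t => c fun i => α (r i)) y = wordVal c (fun i => y (r i)) := by
  rw [wordVal, wordVal, ← sum_words_reindex r]
  refine Finset.sum_congr rfl fun α _ => ?_
  rw [wordDot, wordDot, ← r.sum_comp]

theorem quarticMean_reindex (c e : (ι → F2Vec t) → MvPolynomial σ ℝ) :
    quarticMean E (fun α : κ → F2Vec t => c fun i => α (r i)) (fun α => e fun i => α (r i)) =
      quarticMean E c e := by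
  rw [quarticMean, quarticMean, ← avg_equiv (Equiv.arrowCongr r.symm (Equiv.refl (F2Vec t)))]
  simp only [wordVal_reindex]
  rfl

end Reindex

variable {ι : Type*} [Fintype ι] [DecidableEq ι]

/-- Crude hypercontractivity, without a degree restriction, on a product space. -/
theorem quarticMean_le_crude (hE : IsPseudoExpectation 8 E)
    {c e : (ι → F2Vec t) → MvPolynomial σ ℝ}
    (hc : ∀ α, c α ∈ polyDeg σ 1) (he : ∀ α, e α ∈ polyDeg σ 1) :
    quarticMean E c e ≤ E (wtNorm (4 * 2 ^ t) c * wtNorm (4 * 2 ^ t) e) := by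
  have h := quarticMean_le_crude_fin hE (c := fun α => c fun i => α (Fintype.equivFin ι i))
    (e := fun α => e fun i => α (Fintype.equivFin ι i)) (fun α => hc _) fun α => he _
  rwa [quarticMean_reindex, wtNorm_reindex, wtNorm_reindex] at h

/-- Hypercontractivity with an error term for the influences: only terms that share a position
in all the factors cost powers of the alphabet size. -/
theorem quarticMean_le (hE : IsPseudoExpectation 8 E) {c e : (ι → F2Vec t) → MvPolynomial σ ℝ}
    (hc : ∀ α, c α ∈ polyDeg σ 1) (he : ∀ α, e α ∈ polyDeg σ 1) :
    quarticMean E c e ≤ E (wtNorm 4 c * wtNorm 4 e) +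
      ∑ j, E (wtInf (4 * 2 ^ t) j c * wtInf (4 * 2 ^ t) j e) := by
  have h := quarticMean_le_fin hE (c := fun α => c fun i => α (Fintype.equivFin ι i))
    (e := fun α => e fun i => α (Fintype.equivFin ι i)) (fun α => hc _) fun α => he _
  rw [quarticMean_reindex, wtNorm_reindex, wtNorm_reindex, ← (Fintype.equivFin ι).sum_comp] at h
  simpa only [wtInf_reindex] using h

/-- `wordDot` as a homomorphism to the dual. -/
noncomputable def wordDotHom (ι : Type*) [Fintype ι] (t : ℕ) :
    (ι → F2Vec t) →+ ((ι → F2Vec t) →+ ZMod 2) :=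
  AddMonoidHom.mk' (fun α => AddMonoidHom.mk' (wordDot α) fun x y => by
      simp [wordDot, dotProduct_add, Finset.sum_add_distrib])
    fun α β => AddMonoidHom.ext fun x => by
      show wordDot (α + β) x = wordDot α x + wordDot β x
      simp [wordDot, add_dotProduct, Finset.sum_add_distrib]

theorem eq_zero_of_wordDotHom_eq_zero {α : ι → F2Vec t} (h : wordDotHom ι t α = 0) : α = 0 := by
  funext i
  funext j
  have h1 := DFunLike.congr_fun h (Pi.single i (Pi.single j 1))
  have h2 : ∑ i', α i' ⬝ᵥ (Pi.single i (Pi.single j 1) : ι → F2Vec t) i' = 0 := h1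
  rw [Finset.sum_eq_single i (fun i' _ hi' => by rw [Pi.single_eq_of_ne hi', dotProduct_zero])
    (fun hi => absurd (Finset.mem_univ i) hi), Pi.single_eq_same, dotProduct_single, mul_one] at h2
  exact h2

/-- Trigonometric polynomials of low degree have the same fourth moments on the short code as on
the full product space, by the dual distance of the code. -/
theorem avg_pairHom_quartic {n d l : ℕ} (hl : 4 * l < 2 ^ (d + 1))
    {c e : (F2Vec n → F2Vec t) → MvPolynomial σ ℝ} (hc : ∀ α, l < wt α → c α = 0)
    (he : ∀ α, l < wt α → e α = 0) :
    E (avg fun x : ShortCode n d t => (∑ α, sgn (pairHom d α x) • c α) ^ 2 *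
      (∑ α, sgn (pairHom d α x) • e α) ^ 2) = quarticMean E c e := by
  classical
  have h1 := avg_quartic (pairHomHom n d t) c e
  have h2 := avg_quartic (wordDotHom (F2Vec n) t) c e
  rw [quarticMean]
  refine congrArg E (h1.trans (Eq.trans ?_ h2.symm))
  refine Finset.sum_congr rfl fun α _ => Finset.sum_congr rfl fun α' _ =>
    Finset.sum_congr rfl fun β _ => Finset.sum_congr rfl fun β' _ => ?_
  by_cases h0 : c α * c α' * (e β * e β') = 0
  · simp only [h0, ite_self]
  have hwt : wt α ≤ l ∧ wt α' ≤ l ∧ wt β ≤ l ∧ wt β' ≤ l := by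
    refine ⟨?_, ?_, ?_, ?_⟩ <;>
    · by_contra hlt
      rw [not_le] at hlt
      apply h0
      first
        | rw [hc _ hlt]; ring
        | rw [he _ hlt]; ring
  have hw : wt (α + α' + β + β') < 2 ^ (d + 1) := by
    have w1 := wt_add_le (α + α' + β) β'
    have w2 := wt_add_le (α + α') β
    have w3 := wt_add_le α α'
    omega
  have hiff : pairHomHom n d t (α + α' + β + β') = 0 ↔
      wordDotHom (F2Vec n) t (α + α' + β + β') = 0 := by
    constructor
    · intro h
      rw [eq_zero_of_pairHom_eq_zero h hw, map_zero]
    · intro h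
      rw [eq_zero_of_wordDotHom_eq_zero h, map_zero]
  simp only [hiff]

end Hypercontractivity

/-! ### Pseudo-assignments of unique games -/

section PseudoAssignment

open MvPolynomial

variable {σ : Type} {E : MvPolynomial σ ℝ →ₗ[ℝ] ℝ}

theorem X_mem_polyDeg (w : σ) : (X w : MvPolynomial σ ℝ) ∈ polyDeg σ 1 :=
  mem_polyDeg.2 (totalDegree_X w).le

theorem one_mem_polyDeg (j : ℕ) : (1 : MvPolynomial σ ℝ) ∈ polyDeg σ j :=
  mem_polyDeg.2 (by simp)

/-- An equation `P = 0` imposed by `E (P ^ 2) = 0` can be multiplied by polynomials. -/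
theorem IsPseudoExpectation.mul_eq_zero (hE : IsPseudoExpectation 8 E) {p q : MvPolynomial σ ℝ}
    (hp : p ∈ polyDeg σ 4) (hq : q ∈ polyDeg σ 4) (h0 : E (p ^ 2) = 0) : E (p * q) = 0 := by
  have h : ∀ s : ℝ, 0 ≤ 2 * s * E (p * q) + E (q * q) := by
    intro s
    have h1 := hE.mul_self_nonneg (Submodule.add_mem _ (Submodule.smul_mem _ s hp) hq)
    have h2 : (s • p + q) * (s • p + q) = (s ^ 2) • p ^ 2 + (2 * s) • (p * q) + q * q := by
      simp only [MvPolynomial.smul_eq_C_mul, map_pow, map_mul, map_ofNat]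
      ring
    rw [h2, map_add, map_add, map_smul, map_smul, h0, smul_zero, zero_add, smul_eq_mul] at h1
    exact h1
  by_contra hne
  -- this `s` makes the right-hand side equal to `-1`
  have h1 := h (-(E (q * q) + 1) / (2 * E (p * q)))
  have h2 : 2 * (-(E (q * q) + 1) / (2 * E (p * q))) * E (p * q) = -(E (q * q) + 1) := by
    field_simp
  rw [h2] at h1
  linarith

variable {V A : Type} [Fintype A]
  {E : MvPolynomial (V × A) ℝ →ₗ[ℝ] ℝ}

/-- `E` is a feasible point of the level-8 relaxation. -/
structure IsPseudoAssignment (E : MvPolynomial (V × A) ℝ →ₗ[ℝ] ℝ) : Prop where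
  isPseudoExpectation : IsPseudoExpectation 8 E
  sq_eq_zero : ∀ P ∈ UniqueGame.constraints V A, E (P ^ 2) = 0

theorem IsPseudoAssignment.X_mul_X_mul (h : IsPseudoAssignment E) (w : V × A)
    {q : MvPolynomial (V × A) ℝ}
    (hq : q ∈ polyDeg (V × A) 4) : E (X w * X w * q) = E (X w * q) := by
  have hd : (X w ^ 2 - X w : MvPolynomial (V × A) ℝ) ∈ polyDeg (V × A) 4 := by
    refine Submodule.sub_mem _ ?_ (polyDeg_mono (by norm_num) (X_mem_polyDeg w))
    rw [sq]
    exact polyDeg_mul (by norm_num) (X_mem_polyDeg w) (X_mem_polyDeg w)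
  have h1 := h.isPseudoExpectation.mul_eq_zero hd hq
    (h.sq_eq_zero _ (Or.inl ⟨w.1, w.2, rfl⟩))
  rw [sub_mul, map_sub, sq] at h1
  linarith

theorem IsPseudoAssignment.sum_X_mul (h : IsPseudoAssignment E) (v : V)
    {q : MvPolynomial (V × A) ℝ}
    (hq : q ∈ polyDeg (V × A) 4) : ∑ a, E (X (v, a) * q) = E q := by
  have hd : (∑ a, X (v, a) - 1 : MvPolynomial (V × A) ℝ) ∈ polyDeg (V × A) 4 :=
    Submodule.sub_mem _ (Submodule.sum_mem _ fun a _ =>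
      polyDeg_mono (by norm_num) (X_mem_polyDeg _)) (one_mem_polyDeg 4)
  have h1 := h.isPseudoExpectation.mul_eq_zero hd hq (h.sq_eq_zero _ (Or.inr ⟨v, rfl⟩))
  rw [sub_mul, one_mul, map_sub, Finset.sum_mul, map_sum] at h1
  linarith

theorem mul_sub_smul_one_mul_self {B : Type*} [CommRing B] [Algebra ℝ B] (x p : B) (θ : ℝ) :
    x * (p - θ • (1 : B)) * (x * (p - θ • (1 : B))) =
      x * x * (p * p) + (-2 * θ) • (x * x * p) + θ ^ 2 • (x * x * 1) := by
  simp only [Algebra.smul_def, map_pow, map_mul, map_ofNat, map_neg]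
  ring

theorem one_sub_mul_mul_self {B : Type*} [CommRing B] [Algebra ℝ B] (x p : B) :
    (1 - x) * p * ((1 - x) * p) = p * p + (-2 : ℝ) • (x * (p * p)) + x * x * (p * p) := by
  simp only [Algebra.smul_def, map_ofNat, map_neg]
  ring

/-- A pseudo-boolean variable correlates with a linear form only as far as its fourth moment
allows. -/
theorem IsPseudoAssignment.X_mul_le (h : IsPseudoAssignment E) (w : V × A) {p : MvPolynomial (V × A) ℝ}
    (hp : p ∈ polyDeg (V × A) 1) {θ : ℝ} (hθ : 0 < θ) :
    E (X w * p) ≤ 3 * θ / 4 * E (X w) + E (p ^ 2 * p ^ 2) / (4 * θ ^ 3) := by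
  have hE := h.isPseudoExpectation
  have hX := X_mem_polyDeg (σ := V × A) w
  have h1 : ∀ j, (1 : MvPolynomial (V × A) ℝ) ∈ polyDeg (V × A) j := one_mem_polyDeg
  have hp2 : p * p ∈ polyDeg (V × A) 2 := polyDeg_mul le_rfl hp hp
  have hp4 : p * p * (p * p) ∈ polyDeg (V × A) 4 := polyDeg_mul le_rfl hp2 hp2
  have m := fun {q} => h.X_mul_X_mul (q := q) w
  -- `0 ≤ X (p - θ)²`
  have e1 : 0 ≤ E (X w * (p * p)) - 2 * θ * E (X w * p) + θ ^ 2 * E (X w) := by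
    have hd : X w * (p - θ • (1 : MvPolynomial (V × A) ℝ)) ∈ polyDeg (V × A) 4 :=
      polyDeg_mul (i := 1) (j := 1) (by norm_num) hX
        (Submodule.sub_mem _ hp (Submodule.smul_mem _ θ (h1 1)))
    have e := hE.mul_self_nonneg hd
    rw [mul_sub_smul_one_mul_self, map_add, map_add, map_smul, map_smul, m (polyDeg_mono (by norm_num) hp2),
      m (polyDeg_mono (by norm_num) hp), m (h1 4), mul_one, smul_eq_mul, smul_eq_mul] at e
    linarith
  -- `0 ≤ X (p² - θ²)²`
  have e2 : 0 ≤ E (X w * (p * p * (p * p))) - 2 * θ ^ 2 * E (X w * (p * p)) + θ ^ 4 * E (X w) := by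
    have hd : X w * (p * p - θ ^ 2 • (1 : MvPolynomial (V × A) ℝ)) ∈ polyDeg (V × A) 4 :=
      polyDeg_mul (i := 1) (j := 2) (by norm_num) hX
        (Submodule.sub_mem _ hp2 (Submodule.smul_mem _ (θ ^ 2) (h1 2)))
    have e := hE.mul_self_nonneg hd
    rw [mul_sub_smul_one_mul_self, map_add, map_add, map_smul, map_smul, m hp4, m (polyDeg_mono (by norm_num) hp2),
      m (h1 4), mul_one, smul_eq_mul, smul_eq_mul] at e
    linarith [e, (by ring : (θ ^ 2) ^ 2 = θ ^ 4)]
  -- `0 ≤ (1 - X) p⁴`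
  have e3 : E (X w * (p * p * (p * p))) ≤ E (p * p * (p * p)) := by
    have hd : (1 - X w) * (p * p) ∈ polyDeg (V × A) 4 :=
      polyDeg_mul (i := 1) (j := 2) (by norm_num) (Submodule.sub_mem _ (h1 1) hX) hp2
    have e := hE.mul_self_nonneg hd
    rw [one_sub_mul_mul_self, map_add, map_add, map_smul, m hp4, smul_eq_mul] at e
    linarith
  -- eliminate `X p⁴` and `X p²`
  rw [sq p]
  have e4 : E (X w * p) ≤ (E (X w * (p * p)) + θ ^ 2 * E (X w)) / (2 * θ) := by
    rw [le_div_iff₀ (by positivity)]; linarith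
  have e5 : E (X w * (p * p)) ≤ (E (p * p * (p * p)) + θ ^ 4 * E (X w)) / (2 * θ ^ 2) := by
    rw [le_div_iff₀ (by positivity)]; linarith
  refine e4.trans ?_
  calc (E (X w * (p * p)) + θ ^ 2 * E (X w)) / (2 * θ)
      ≤ ((E (p * p * (p * p)) + θ ^ 4 * E (X w)) / (2 * θ ^ 2) + θ ^ 2 * E (X w)) / (2 * θ) := by
        gcongr
    _ = _ := by field_simp; ring

end PseudoAssignment

/-! ### Folded assignments to the vertices of the reduction -/

section Folding

open MvPolynomial

variable {V : Type} [Fintype V] {n d t : ℕ}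

/-- The variables of the relaxation of the reduced instance. -/
abbrev RedVar (V : Type) (n d t : ℕ) : Type := (V × ShortCode n d t) × F2Vec t

/-- The folded assignment `x ↦ 𝔼_a [F_v (x - a 𝟙) = a]` at the vertex `v`, as linear forms. -/
noncomputable def fold (v : V) (x : ShortCode n d t) : MvPolynomial (RedVar V n d t) ℝ :=
  avg fun a : F2Vec t => X ((v, x - constWord n d a), a)

/-- The mean of the folded assignments of the neighbours of `u`, transported along the
constraints. -/
noncomputable def nbrMean (U : V → PMF (V × F2Vec n)) (u : V) (x : ShortCode n d t) :
    MvPolynomial (RedVar V n d t) ℝ :=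
  pmfMean (U u) fun e => fold e.1 (translateWord e.2 x)

theorem fold_mem (v : V) (x : ShortCode n d t) : fold v x ∈ polyDeg (RedVar V n d t) 1 :=
  avg_mem _ fun _ => X_mem_polyDeg _

theorem nbrMean_mem (U : V → PMF (V × F2Vec n)) (u : V) (x : ShortCode n d t) :
    nbrMean U u x ∈ polyDeg (RedVar V n d t) 1 :=
  pmfMean_mem _ _ fun _ => fold_mem _ _

theorem constWord_add (a b : F2Vec t) :
    constWord n d (a + b) = constWord n d a + constWord n d b := rfl

theorem translateWord_translateWord (b b' : F2Vec n) (x : ShortCode n d t) :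
    translateWord b (translateWord b' x) = translateWord (b + b') x := by
  funext j
  refine Subtype.ext (funext fun i => ?_)
  show (x j).1 (i + b + b') = (x j).1 (i + (b + b'))
  rw [add_assoc]

theorem translateWord_zero (x : ShortCode n d t) : translateWord 0 x = x := by
  funext j
  refine Subtype.ext (funext fun i => ?_)
  show (x j).1 (i + 0) = (x j).1 i
  rw [add_zero]

/-- Translation of positions, as a permutation of the code. -/
def translateEquiv (n d t : ℕ) (b : F2Vec n) : ShortCode n d t ≃ ShortCode n d t where
  toFun := translateWord b
  invFun := translateWord b
  left_inv x := by
    rw [translateWord_translateWord, add_self_of_module_two, translateWord_zero]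
  right_inv x := by
    rw [translateWord_translateWord, add_self_of_module_two, translateWord_zero]

theorem pmfMean_mul_pmfMean {ι κ A : Type*} [Fintype ι] [Fintype κ] [CommRing A] [Algebra ℝ A]
    (p : PMF ι) (q : PMF κ) (f : ι → A) (g : κ → A) :
    pmfMean p f * pmfMean q g = pmfMean p fun i => pmfMean q fun j => f i * g j := by
  simp only [pmfMean, Finset.sum_mul_sum, Finset.smul_sum]
  refine Finset.sum_congr rfl fun i _ => Finset.sum_congr rfl fun j _ => ?_
  rw [smul_mul_smul_comm, smul_smul]

theorem mul_pmfMean {ι A : Type*} [Fintype ι] [CommRing A] [Algebra ℝ A]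
    (p : PMF ι) (a : A) (f : ι → A) : a * pmfMean p f = pmfMean p fun i => a * f i := by
  simp only [pmfMean, Finset.mul_sum, mul_smul_comm]

theorem avg_mul_avg {ι κ A : Type*} [Fintype ι] [Fintype κ] [CommRing A] [Algebra ℝ A]
    (f : ι → A) (g : κ → A) : avg f * avg g = avg fun i => avg fun j => f i * g j := by
  rw [mul_comm, ← avg_mul_left]
  congr 1; funext i
  rw [mul_comm, avg_mul_left]

theorem pmfMean_comm {ι κ W : Type*} [Fintype ι] [Fintype κ] [AddCommGroup W] [Module ℝ W]
    (p : PMF ι) (q : PMF κ) (f : ι → κ → W) :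
    pmfMean p (fun i => pmfMean q (f i)) = pmfMean q fun j => pmfMean p fun i => f i j := by
  simp only [pmfMean, Finset.smul_sum]
  rw [Finset.sum_comm]
  refine Finset.sum_congr rfl fun j _ => Finset.sum_congr rfl fun i _ => ?_
  rw [smul_comm]

theorem card_smul_avg {ι W : Type*} [Fintype ι] [Nonempty ι] [AddCommGroup W] [Module ℝ W]
    (f : ι → W) : (Fintype.card ι : ℝ) • avg f = ∑ i, f i := by
  rw [avg, smul_smul, mul_inv_cancel₀ (by exact_mod_cast Fintype.card_ne_zero), one_smul]

theorem card_F2Vec (t : ℕ) : (Fintype.card (F2Vec t) : ℝ) = 2 ^ t := by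
  rw [Fintype.card_fun, ZMod.card, Fintype.card_fin]
  norm_cast

/-- The substitution that folds the test: `x` is replaced by `x + κ a`, and `c` by `a + c`. -/
theorem avg_avg_sum_mul_shift {G K A : Type*} [Fintype G] [AddCommGroup G] [Fintype K]
    [AddCommGroup K] [CommRing A] [Algebra ℝ A] (κ : K →+ G) (P Q : G → K → A) (z : G) :
    (avg fun x => avg fun c => ∑ a, P x a * Q (x + z - κ c) (a + c)) =
      (Fintype.card K : ℝ) • avg fun x =>
        (avg fun a => P (x - κ a) a) * avg fun c => Q (x + z - κ c) c := by
  have h1 : ∀ x, ((avg fun a => P (x - κ a) a) * avg fun c => Q (x + z - κ c) c) =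
      avg fun a => avg fun c => P (x - κ a) a * Q (x + z - κ (a + c)) (a + c) := by
    intro x
    rw [avg_mul_avg]
    refine congrArg avg (funext fun a => ?_)
    exact (avg_equiv (Equiv.addLeft a) fun c => P (x - κ a) a * Q (x + z - κ c) c).symm
  simp only [h1]
  conv_rhs => rw [avg_comm, card_smul_avg]
  simp only [avg_sum]
  refine Finset.sum_congr rfl fun a _ => ?_
  refine Eq.trans ?_ (avg_equiv (Equiv.subRight (κ a)).symm fun x =>
    avg fun c => P (x - κ a) a * Q (x + z - κ (a + c)) (a + c))
  refine congrArg avg (funext fun x => congrArg avg (funext fun c => ?_))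
  have h2 : x + κ a - κ a = x := add_sub_cancel_right x (κ a)
  have h3 : x + κ a + z - κ (a + c) = x + z - κ c := by rw [map_add]; abel
  show _ = P (x + κ a - κ a) a * Q (x + κ a + z - κ (a + c)) (a + c)
  rw [h2, h3]

/-- `constWord` as a homomorphism. -/
noncomputable def constWordHom (n d t : ℕ) : F2Vec t →+ ShortCode n d t :=
  AddMonoidHom.mk' (constWord n d) constWord_add

/-- A randomly shifted test on unfolded assignments is a test on folded assignments. -/
theorem avg_sum_X_mul_X (v v' : V) (b b' : F2Vec n) (z : ShortCode n d t) :
    (avg fun x : ShortCode n d t => avg fun c : F2Vec t => ∑ a : F2Vec t,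
      X ((v, translateWord b x), a) *
        X ((v', translateWord b' (x + z - constWord n d c)), a + c) :
      MvPolynomial (RedVar V n d t) ℝ) =
    (2 : ℝ) ^ t • avg fun x : ShortCode n d t =>
      fold v (translateWord b x) * fold v' (translateWord b' (x + z)) := by
  rw [← card_F2Vec]
  exact avg_avg_sum_mul_shift (constWordHom n d t)
    (fun x a => (X ((v, translateWord b x), a) : MvPolynomial (RedVar V n d t) ℝ))
    (fun x a => X ((v', translateWord b' x), a)) z

theorem objective_eq_pmfMean {V A : Type} [Fintype V] [Fintype A] [DecidableEq A]
    (W : UniqueGame V A) : W.objective =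
      pmfMean W fun e => ∑ a : A, (X (e.1, a) * X (e.2.1, e.2.2 a) : MvPolynomial (V × A) ℝ) := by
  rw [UniqueGame.objective, pmfMean]
  simp only [MvPolynomial.smul_eq_C_mul]

/-- The objective of the reduced instance is a quadratic form in the folded assignments. -/
theorem objective_shortCodeReduction [Nonempty V] (U : V → PMF (V × F2Vec n)) (ε : ℝ) :
    (shortCodeReduction U d t ε).objective = (2 : ℝ) ^ t • avg fun u : V =>
      avg fun x : ShortCode n d t =>
        nbrMean U u x * pmfMean (shortCodeNoise n d t ε) fun z => nbrMean U u (x + z) := by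
  have h1 : ∀ u (x : ShortCode n d t),
      nbrMean U u x * pmfMean (shortCodeNoise n d t ε) (fun z => nbrMean U u (x + z)) =
      pmfMean (U u) fun e => pmfMean (U u) fun e' => pmfMean (shortCodeNoise n d t ε) fun z =>
        fold e.1 (translateWord e.2 x) * fold e'.1 (translateWord e'.2 (x + z)) := by
    intro u x
    simp only [nbrMean]
    rw [pmfMean_comm, pmfMean_mul_pmfMean]
    simp only [mul_pmfMean]
  have h2 : ∀ u, (avg fun x : ShortCode n d t =>
      nbrMean U u x * pmfMean (shortCodeNoise n d t ε) fun z => nbrMean U u (x + z)) =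
      pmfMean (U u) fun e => pmfMean (U u) fun e' => pmfMean (shortCodeNoise n d t ε) fun z =>
        avg fun x => fold e.1 (translateWord e.2 x) * fold e'.1 (translateWord e'.2 (x + z)) := by
    intro u
    simp only [h1, ← pmfMean_avg_comm]
  rw [objective_eq_pmfMean, shortCodeReduction]
  simp only [pmfMean_bind, pmfMean_map, pmfMean_uniform, Equiv.coe_addRight, h2]
  rw [← avg_smul]
  refine congrArg avg (funext fun u => ?_)
  simp only [← pmfMean_smul]
  simp only [← avg_sum_X_mul_X]
  simp only [pmfMean_avg_comm]

end Folding

/-! ### The mass of folded assignments -/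

section VertexMass

open MvPolynomial

variable {V : Type} [Fintype V] {n d t : ℕ}

/-- The mean square of the (unfolded) assignment at the vertex `v`. -/
noncomputable def vertexMass (n d t : ℕ) (v : V) : MvPolynomial (RedVar V n d t) ℝ :=
  avg fun x : ShortCode n d t => avg fun a : F2Vec t => X ((v, x), a) * X ((v, x), a)

/-- The mean of `vertexMass` over the neighbours of `u`. -/
noncomputable def nbrMass (d t : ℕ) (U : V → PMF (V × F2Vec n)) (u : V) :
    MvPolynomial (RedVar V n d t) ℝ :=
  pmfMean (U u) fun e => vertexMass n d t e.1

theorem jensen_avg_mem_sqCone {σ : Type} {ι : Type*} [Fintype ι] [Nonempty ι]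
    {a : ι → MvPolynomial σ ℝ} (ha : ∀ i, a i ∈ polyDeg σ 1) :
    (avg fun i => a i * a i) - avg a * avg a ∈ sqCone σ := by
  have h := jensen_mem_sqCone (PMF.uniformOfFintype ι) ha
  rwa [pmfMean_uniform, pmfMean_uniform] at h

theorem mem_sqCone_trans {σ : Type} {p q r : MvPolynomial σ ℝ} (h1 : q - p ∈ sqCone σ)
    (h2 : r - q ∈ sqCone σ) : r - p ∈ sqCone σ := by
  have := add_mem h2 h1
  rwa [sub_add_sub_cancel] at this

theorem vertexMass_mem (v : V) : vertexMass n d t v ∈ sqCone (RedVar V n d t) :=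
  avg_mem_sqCone fun _ => avg_mem_sqCone fun _ => mul_self_mem_sqCone (X_mem_polyDeg _)

theorem nbrMass_mem (U : V → PMF (V × F2Vec n)) (u : V) :
    nbrMass d t U u ∈ sqCone (RedVar V n d t) :=
  pmfMean_mem_sqCone _ fun _ => vertexMass_mem _

theorem avg_fold_mul_self_le (v : V) :
    vertexMass n d t v - avg (fun x : ShortCode n d t => fold v x * fold v x) ∈
      sqCone (RedVar V n d t) := by
  have h1 : vertexMass n d t v = avg fun x : ShortCode n d t => avg fun a : F2Vec t =>
      (X ((v, x - constWord n d a), a) * X ((v, x - constWord n d a), a) :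
        MvPolynomial (RedVar V n d t) ℝ) := by
    rw [vertexMass, avg_comm]
    conv_rhs => rw [avg_comm]
    refine congrArg avg (funext fun a => ?_)
    exact (avg_equiv (Equiv.subRight (constWord n d a)) fun x =>
      (X ((v, x), a) * X ((v, x), a) : MvPolynomial (RedVar V n d t) ℝ)).symm
  rw [h1, ← avg_sub]
  exact avg_mem_sqCone fun x => jensen_avg_mem_sqCone fun a => X_mem_polyDeg _

theorem avg_nbrMean_mul_self_le (U : V → PMF (V × F2Vec n)) (u : V) :
    nbrMass d t U u - avg (fun x : ShortCode n d t => nbrMean U u x * nbrMean U u x) ∈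
      sqCone (RedVar V n d t) := by
  have h1 : (nbrMass d t U u - pmfMean (U u) fun e => avg fun x : ShortCode n d t =>
      fold e.1 (translateWord e.2 x) * fold e.1 (translateWord e.2 x)) ∈
      sqCone (RedVar V n d t) := by
    rw [nbrMass, sub_eq_add_neg, ← neg_one_smul ℝ, ← pmfMean_smul, ← pmfMean_add]
    refine pmfMean_mem_sqCone _ fun e => ?_
    rw [neg_one_smul, ← sub_eq_add_neg]
    have h := avg_fold_mul_self_le (n := n) (d := d) (t := t) e.1
    rwa [← avg_equiv (translateEquiv n d t e.2)] at h
  refine mem_sqCone_trans ?_ h1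
  rw [pmfMean_avg_comm, ← avg_sub]
  exact avg_mem_sqCone fun x => jensen_mem_sqCone (U u) fun e => fold_mem _ _

variable {E : MvPolynomial (RedVar V n d t) ℝ →ₗ[ℝ] ℝ}

theorem avg_mul_right {ι A : Type*} [Fintype ι] [CommRing A] [Algebra ℝ A] (f : ι → A) (a : A) :
    avg f * a = avg fun i => f i * a := by
  rw [mul_comm, ← avg_mul_left]
  simp only [mul_comm]

/-- Under a pseudo-assignment the vertex mass acts as the constant `1 / k`, also inside products. The
polynomial itself, and not only its pseudo-expectation, is needed to bound fourth moments. -/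
theorem IsPseudoAssignment.vertexMass_mul (h : IsPseudoAssignment E) (v : V)
    {q : MvPolynomial (RedVar V n d t) ℝ} (hq : q ∈ polyDeg (RedVar V n d t) 4) :
    E (vertexMass n d t v * q) = (2 ^ t)⁻¹ * E q := by
  simp only [vertexMass, avg_mul_right, map_avg, h.X_mul_X_mul _ hq]
  have h1 : ∀ x : ShortCode n d t, avg (fun a : F2Vec t => E (X ((v, x), a) * q)) =
      (2 ^ t)⁻¹ * E q := by
    intro x
    rw [avg, h.sum_X_mul _ hq, card_F2Vec, smul_eq_mul]
  simp only [h1, avg_const]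

/-- The mean mass of the neighbours acts as the constant `1 / k`. -/
theorem IsPseudoAssignment.nbrMass_mul (h : IsPseudoAssignment E)
    (U : V → PMF (V × F2Vec n)) (u : V)
    {q : MvPolynomial (RedVar V n d t) ℝ} (hq : q ∈ polyDeg (RedVar V n d t) 4) :
    E (nbrMass d t U u * q) = (2 ^ t)⁻¹ * E q := by
  rw [mul_comm, nbrMass, mul_pmfMean, map_pmfMean]
  simp only [mul_comm q, h.vertexMass_mul _ hq, pmfMean_const]

/-- Folded assignments have mean `1 / k`. -/
theorem IsPseudoAssignment.avg_fold (h : IsPseudoAssignment E) (v : V) (b : F2Vec n) :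
    avg (fun x : ShortCode n d t => E (fold v (translateWord b x))) = (2 ^ t)⁻¹ := by
  refine (avg_equiv (translateEquiv n d t b) fun x => E (fold v x)).trans ?_
  simp only [fold, map_avg]
  rw [avg_comm]
  have h1 : ∀ a : F2Vec t,
      (avg fun x : ShortCode n d t => E (X ((v, x - constWord n d a), a))) =
      avg fun x : ShortCode n d t => E (X ((v, x), a)) := fun a =>
    avg_equiv (Equiv.subRight (constWord n d a)) fun x => E (X ((v, x), a))
  simp only [h1]
  rw [avg_comm]
  have h2 : ∀ x : ShortCode n d t, avg (fun a : F2Vec t => E (X ((v, x), a))) = (2 ^ t)⁻¹ := by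
    intro x
    have h3 := h.sum_X_mul (v, x) (one_mem_polyDeg 4)
    simp only [mul_one, h.isPseudoExpectation.normalization] at h3
    rw [avg, h3, card_F2Vec, smul_eq_mul, mul_one]
  simp only [h2, avg_const]

theorem IsPseudoAssignment.avg_nbrMean (h : IsPseudoAssignment E) (U : V → PMF (V × F2Vec n))
    (u : V) : avg (fun x : ShortCode n d t => E (nbrMean U u x)) = (2 ^ t)⁻¹ := by
  simp only [nbrMean, map_pmfMean, ← pmfMean_avg_comm]
  simp only [h.avg_fold, pmfMean_const]

/-- A mean of folded assignments correlates with a function of small fourth moment only slightly, since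
it is a mean of boolean variables. -/
theorem IsPseudoAssignment.avg_nbrMean_mul_le (h : IsPseudoAssignment E)
    (U : V → PMF (V × F2Vec n)) (u : V)
    {p : ShortCode n d t → MvPolynomial (RedVar V n d t) ℝ}
    (hp : ∀ x, p x ∈ polyDeg (RedVar V n d t) 1) {θ : ℝ} (hθ : 0 < θ) :
    E (avg fun x => nbrMean U u x * p x) ≤
      3 * θ / 4 * (2 ^ t)⁻¹ + E (avg fun x => p x ^ 2 * p x ^ 2) / (4 * θ ^ 3) := by
  have h1 : ∀ x, E (nbrMean U u x * p x) ≤ (3 * θ / 4) • E (nbrMean U u x) +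
      (4 * θ ^ 3)⁻¹ • E (p x ^ 2 * p x ^ 2) := by
    intro x
    have e1 : E (nbrMean U u x * p x) = pmfMean (U u) fun e => avg fun a : F2Vec t =>
        E (X ((e.1, translateWord e.2 x - constWord n d a), a) * p x) := by
      rw [mul_comm, nbrMean, mul_pmfMean, map_pmfMean]
      simp only [fold, mul_comm (p x), avg_mul_right, map_avg]
    have e2 : E (nbrMean U u x) = pmfMean (U u) fun e => avg fun a : F2Vec t =>
        E (X ((e.1, translateWord e.2 x - constWord n d a), a)) := by
      rw [nbrMean, map_pmfMean]
      simp only [fold, map_avg]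
    have e3 : (3 * θ / 4) • E (nbrMean U u x) + (4 * θ ^ 3)⁻¹ • E (p x ^ 2 * p x ^ 2) =
        pmfMean (U u) fun e => avg fun a : F2Vec t =>
        ((3 * θ / 4) • E (X ((e.1, translateWord e.2 x - constWord n d a), a)) +
          (4 * θ ^ 3)⁻¹ • E (p x ^ 2 * p x ^ 2)) := by
      simp only [avg_add, avg_smul, avg_const, pmfMean_add, pmfMean_smul, pmfMean_const, e2]
    rw [e1, e3]
    refine pmfMean_mono _ fun e => avg_mono fun a => ?_
    rw [smul_eq_mul, smul_eq_mul, ← div_eq_inv_mul]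
    exact h.X_mul_le _ (hp x) hθ
  rw [map_avg]
  refine (avg_mono h1).trans (le_of_eq ?_)
  rw [avg_add, avg_smul, avg_smul, h.avg_nbrMean, ← map_avg, smul_eq_mul, smul_eq_mul,
    ← div_eq_inv_mul]

end VertexMass

/-! ### Low and high characters -/

section Spectrum

open MvPolynomial

variable {n d t : ℕ}

/-- A bound for the multipliers of the noise on characters whose word has distance more than `l`
from the dual of the code. -/
noncomputable def decay (d l : ℕ) (ε : ℝ) : ℝ :=
  Real.exp (-(2 ^ d * Real.log (1 / (1 - ε)) *
    ((1 / 2) ^ 17 * min (((l + 1 : ℕ) : ℝ) * (1 / 2) ^ d) 1)))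

theorem decay_nonneg (d l : ℕ) (ε : ℝ) : 0 ≤ decay d l ε := (Real.exp_pos _).le

theorem decay_le_one (d l : ℕ) {ε : ℝ} (h0 : 0 < ε) (h1 : ε < 1) : decay d l ε ≤ 1 := by
  have := le_log_one_div_one_sub h1
  rw [decay, Real.exp_le_one_iff, neg_nonpos]
  have : 0 ≤ Real.log (1 / (1 - ε)) := by linarith
  positivity

theorem exp_rej_le_one {α : F2Vec n → F2Vec t} {ε : ℝ} (h0 : 0 < ε) (h1 : ε < 1) :
    Real.exp (-(2 ^ d * Real.log (1 / (1 - ε)) * rej d α)) ≤ 1 := by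
  have := le_log_one_div_one_sub h1
  rw [Real.exp_le_one_iff, neg_nonpos]
  have h2 : 0 ≤ Real.log (1 / (1 - ε)) := by linarith
  have := rej_nonneg d α
  positivity

theorem exp_rej_le_decay {α : F2Vec n → F2Vec t} {l : ℕ} {ε : ℝ} (h0 : 0 < ε) (h1 : ε < 1)
    (h : (1 / 2 : ℝ) ^ 17 * min (((l + 1 : ℕ) : ℝ) * (1 / 2) ^ d) 1 ≤ rej d α) :
    Real.exp (-(2 ^ d * Real.log (1 / (1 - ε)) * rej d α)) ≤ decay d l ε := by
  have := le_log_one_div_one_sub h1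
  have h2 : 0 ≤ Real.log (1 / (1 - ε)) := by linarith
  rw [decay, Real.exp_le_exp, neg_le_neg_iff]
  gcongr

/-- The Fourier coefficients of `f` at the characters of weight at most `l`. -/
noncomputable def lowCoeff {W : Type*} [AddCommGroup W] [Module ℝ W] (l : ℕ)
    (f : ShortCode n d t → W) (α : F2Vec n → F2Vec t) : W :=
  if wt α ≤ l then fhat f (pairHom d α) else 0

/-- The projection of `f` to the characters of weight at most `l`. -/
noncomputable def lowPart {W : Type*} [AddCommGroup W] [Module ℝ W] (l : ℕ)
    (f : ShortCode n d t → W) (x : ShortCode n d t) : W :=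
  ∑ α, sgn (pairHom d α x) • lowCoeff l f α

variable {σ : Type} {E : MvPolynomial σ ℝ →ₗ[ℝ] ℝ} {f : ShortCode n d t → MvPolynomial σ ℝ}

theorem fhat_mem {G : Type*} [AddCommGroup G] [Fintype G] {f : G → MvPolynomial σ ℝ} {j : ℕ}
    (hf : ∀ x, f x ∈ polyDeg σ j) (φ : G →+ ZMod 2) : fhat f φ ∈ polyDeg σ j :=
  avg_mem _ fun x => Submodule.smul_mem _ _ (hf x)

theorem lowCoeff_mem (hf : ∀ x, f x ∈ polyDeg σ 1) (l : ℕ) (α : F2Vec n → F2Vec t) :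
    lowCoeff l f α ∈ polyDeg σ 1 := by
  rw [lowCoeff]
  split_ifs
  · exact fhat_mem hf _
  · exact zero_mem _

theorem lowPart_mem (hf : ∀ x, f x ∈ polyDeg σ 1) (l : ℕ) (x : ShortCode n d t) :
    lowPart l f x ∈ polyDeg σ 1 :=
  Submodule.sum_mem _ fun α _ => Submodule.smul_mem _ _ (lowCoeff_mem hf l α)

/-- The projection to the low characters is orthogonal. -/
theorem sum_lowCoeff_mul_self (l : ℕ) :
    ∑ α, lowCoeff l f α * lowCoeff l f α = avg fun x => f x * lowPart l f x := by
  simp only [lowPart, Finset.mul_sum, avg_sum]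
  refine Finset.sum_congr rfl fun α _ => ?_
  have h1 : lowCoeff l f α * lowCoeff l f α = lowCoeff l f α * fhat f (pairHom d α) := by
    rw [lowCoeff]; split_ifs <;> simp
  rw [h1, fhat, ← avg_mul_left]
  refine congrArg avg (funext fun x => ?_)
  rw [mul_smul_comm, mul_smul_comm, mul_comm]

/-- The squares of the low coefficients, as a sum over characters. -/
theorem sum_low_characters {W : Type*} [AddCommMonoid W] {l : ℕ} (hl : 2 * l < 2 ^ (d + 1))
    (g : (ShortCode n d t →+ ZMod 2) → W) [DecidablePred fun φ : ShortCode n d t →+ ZMod 2 =>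
      ∃ α, wt α ≤ l ∧ φ = pairHom d α] :
    ∑ α : F2Vec n → F2Vec t, (if wt α ≤ l then g (pairHom d α) else 0) =
      ∑ φ : ShortCode n d t →+ ZMod 2, if ∃ α, wt α ≤ l ∧ φ = pairHom d α then g φ else 0 := by
  rw [← Finset.sum_filter, ← Finset.sum_filter]
  refine Finset.sum_bij (fun α _ => pairHom d α) ?_ ?_ ?_ fun _ _ => rfl
  · intro α hα
    exact Finset.mem_filter.2 ⟨Finset.mem_univ _, α, (Finset.mem_filter.1 hα).2, rfl⟩
  · intro α hα β hβ h
    exact pairHom_injOn (Finset.mem_filter.1 hα).2 (Finset.mem_filter.1 hβ).2 hl h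
  · intro φ hφ
    obtain ⟨α, hα, rfl⟩ := (Finset.mem_filter.1 hφ).2
    exact ⟨α, Finset.mem_filter.2 ⟨Finset.mem_univ _, hα⟩, rfl⟩

/-- Bessel's inequality for the low characters. -/
theorem sum_lowCoeff_le (hf : ∀ x, f x ∈ polyDeg σ 1) {l : ℕ} (hl : 2 * l < 2 ^ (d + 1)) :
    avg (fun x => f x * f x) - ∑ α, lowCoeff l f α * lowCoeff l f α ∈ sqCone σ := by
  classical
  have h1 : ∑ α, lowCoeff l f α * lowCoeff l f α = ∑ α : F2Vec n → F2Vec t,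
      if wt α ≤ l then fhat f (pairHom d α) * fhat f (pairHom d α) else 0 := by
    refine Finset.sum_congr rfl fun α _ => ?_
    rw [lowCoeff]; split_ifs <;> simp
  rw [h1, sum_low_characters hl fun φ => fhat f φ * fhat f φ, parseval, ← Finset.sum_sub_distrib]
  refine sum_mem fun φ _ => ?_
  split_ifs
  · rw [sub_self]; exact zero_mem _
  · rw [sub_zero]; exact mul_self_mem_sqCone (fhat_mem hf φ)

/-- The quadratic form of the noise splits into a small multiple of the norm and the
contribution of the low characters. -/
theorem avg_mul_noise_le (hf : ∀ x, f x ∈ polyDeg σ 1) (hd : d ≤ n) {l : ℕ}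
    (hl : 2 * l < 2 ^ (d + 1)) {ε : ℝ} (h0 : 0 < ε) (h1 : ε < 1) :
    decay d l ε • avg (fun x => f x * f x) +
        (1 - decay d l ε) • (avg fun x => f x * lowPart l f x) -
      (avg fun x => f x * pmfMean (shortCodeNoise n d t ε) fun z => f (x + z)) ∈ sqCone σ := by
  classical
  have e1 : ∑ α, lowCoeff l f α * lowCoeff l f α = ∑ α : F2Vec n → F2Vec t,
      if wt α ≤ l then fhat f (pairHom d α) * fhat f (pairHom d α) else 0 := by
    refine Finset.sum_congr rfl fun α _ => ?_
    rw [lowCoeff]; split_ifs <;> simp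
  rw [← sum_lowCoeff_mul_self, e1, sum_low_characters hl fun φ => fhat f φ * fhat f φ, parseval,
    parseval, Finset.smul_sum, Finset.smul_sum, ← Finset.sum_add_distrib, ← Finset.sum_sub_distrib]
  refine sum_mem fun φ _ => ?_
  rw [fhat_pmfMean, mul_smul_comm]
  have hcone := mul_self_mem_sqCone (fhat_mem hf φ)
  split_ifs with hφ
  · obtain ⟨α, -, rfl⟩ := hφ
    rw [pmfMean_shortCodeNoise h0 h1, ← add_smul, ← sub_smul]
    refine smul_mem_sqCone ?_ hcone
    have := exp_rej_le_one (d := d) (α := α) h0 h1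
    linarith
  · obtain ⟨α, rfl, hα⟩ := (pairHom_dichotomy hd l φ).resolve_left hφ
    rw [pmfMean_shortCodeNoise h0 h1, smul_zero, add_zero, ← sub_smul]
    refine smul_mem_sqCone ?_ hcone
    have := exp_rej_le_decay h0 h1 hα
    linarith

/-- On the words of weight at most `l` the weights `b ^ wt α` cost a factor of at most `b ^ l`. -/
theorem wtNorm_lowCoeff_le (hf : ∀ x, f x ∈ polyDeg σ 1) {l : ℕ} (hl : 2 * l < 2 ^ (d + 1))
    {b : ℝ} (hb : 1 ≤ b) :
    b ^ l • avg (fun x => f x * f x) - wtNorm b (lowCoeff l f) ∈ sqCone σ := by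
  have h1 : b ^ l • ∑ α, lowCoeff l f α * lowCoeff l f α - wtNorm b (lowCoeff l f) ∈ sqCone σ := by
    rw [wtNorm, Finset.smul_sum, ← Finset.sum_sub_distrib]
    refine sum_mem fun α _ => ?_
    rw [← sub_smul]
    by_cases hα : wt α ≤ l
    · exact smul_mem_sqCone (sub_nonneg.2 (pow_le_pow_right₀ hb hα))
        (mul_self_mem_sqCone (lowCoeff_mem hf l α))
    · rw [lowCoeff, if_neg hα, mul_zero, smul_zero]
      exact zero_mem _
  refine mem_sqCone_trans h1 ?_
  rw [← smul_sub]
  exact smul_mem_sqCone (by positivity) (sum_lowCoeff_le hf hl)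

/-- The fourth moments of low parts can be computed on the full product space. -/
theorem lowPart_quartic (l : ℕ) (hl : 4 * l < 2 ^ (d + 1)) (f g : ShortCode n d t → MvPolynomial σ ℝ) :
    E (avg fun x => lowPart l f x ^ 2 * lowPart l g x ^ 2) =
      quarticMean E (lowCoeff l f) (lowCoeff l g) := by
  refine avg_pairHom_quartic hl ?_ ?_ <;>
  · intro α hα
    rw [lowCoeff, if_neg (not_le.2 hα)]

end Spectrum

section ValueBound

open MvPolynomial

variable {V : Type} [Fintype V] {n d t : ℕ} {E : MvPolynomial (RedVar V n d t) ℝ →ₗ[ℝ] ℝ}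

/-- The contribution of a vertex `u` to the value is small unless the mean of the folded
assignments of its neighbours has influential positions. -/
theorem IsPseudoAssignment.nbrMean_noise_le (h : IsPseudoAssignment E)
    (U : V → PMF (V × F2Vec n)) (u : V) (hd : d ≤ n) {l : ℕ} (hl : 4 * l < 2 ^ (d + 1)) {ε : ℝ}
    (h0 : 0 < ε) (h1 : ε < 1) {θ : ℝ} (hθ : 0 < θ) :
    2 ^ t * E (avg fun x : ShortCode n d t =>
        nbrMean U u x * pmfMean (shortCodeNoise n d t ε) fun z => nbrMean U u (x + z)) ≤
      decay d l ε + (1 - decay d l ε) * (3 * θ / 4 + 2 ^ t / (4 * θ ^ 3) *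
        (16 ^ l / 4 ^ t + ∑ j, E (wtInf (4 * 2 ^ t) j (lowCoeff l (nbrMean (d := d) (t := t) U u)) *
          wtInf (4 * 2 ^ t) j (lowCoeff l (nbrMean U u))))) := by
  set f : ShortCode n d t → MvPolynomial (RedVar V n d t) ℝ := nbrMean U u with hfdef
  have hE := h.isPseudoExpectation
  have hf : ∀ x, f x ∈ polyDeg (RedVar V n d t) 1 := nbrMean_mem U u
  have hl2 : 2 * l < 2 ^ (d + 1) := by omega
  have ht : (0 : ℝ) < 2 ^ t := by positivity
  have hmass := avg_nbrMean_mul_self_le (d := d) (t := t) U u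
  have hQ : E (nbrMass d t U u) = (2 ^ t)⁻¹ := by
    have := h.nbrMass_mul (d := d) (t := t) U u (one_mem_polyDeg 4)
    rwa [mul_one, hE.normalization, mul_one] at this
  have hnorm : E (avg fun x => f x * f x) ≤ (2 ^ t)⁻¹ := by
    have := hE.nonneg hmass
    rw [map_sub, hQ] at this
    linarith
  -- the low characters
  have hlow := h.avg_nbrMean_mul_le (d := d) (t := t) U u (lowPart_mem hf l) hθ
  rw [lowPart_quartic l hl] at hlow
  have hhyp := quarticMean_le hE (lowCoeff_mem hf l) (lowCoeff_mem hf l)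
  have hwt : E (wtNorm 4 (lowCoeff l f) * wtNorm 4 (lowCoeff l f)) ≤ 16 ^ l * (4 ^ t)⁻¹ := by
    have e1 : (4 : ℝ) ^ l • nbrMass d t U u - wtNorm 4 (lowCoeff l f) ∈
        sqCone (RedVar V n d t) := by
      refine mem_sqCone_trans (wtNorm_lowCoeff_le hf hl2 (by norm_num)) ?_
      rw [← smul_sub]
      exact smul_mem_sqCone (by positivity) hmass
    refine (hE.mul_le_mul e1 e1 (smul_mem_sqCone (by positivity) (nbrMass_mem U u))
      (wtNorm_mem (by norm_num) (lowCoeff_mem hf l))).trans (le_of_eq ?_)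
    rw [smul_mul_smul_comm, map_smul, h.nbrMass_mul U u
      (polyDeg_mono (by norm_num) (sqCone_le_polyDeg (nbrMass_mem U u))), hQ, smul_eq_mul,
      ← mul_pow, ← mul_inv, ← mul_pow]
    norm_num
  have hsplit := hE.nonneg (avg_mul_noise_le hf hd hl2 h0 h1)
  rw [map_sub, map_add, map_smul, map_smul, smul_eq_mul, smul_eq_mul] at hsplit
  set I := ∑ j, E (wtInf (4 * 2 ^ t) j (lowCoeff l f) * wtInf (4 * 2 ^ t) j (lowCoeff l f))
  have hlam0 := decay_nonneg d l ε
  have hlam1 := decay_le_one d l h0 h1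
  set lam := decay d l ε
  have hlow' : E (avg fun x => f x * lowPart l f x) ≤
      3 * θ / 4 * (2 ^ t)⁻¹ + (16 ^ l / 4 ^ t + I) / (4 * θ ^ 3) := by
    refine hlow.trans ?_
    rw [div_eq_mul_inv ((16 : ℝ) ^ l)]
    gcongr
    linarith
  calc 2 ^ t * E (avg fun x => f x * pmfMean (shortCodeNoise n d t ε) fun z => f (x + z))
      ≤ 2 ^ t * (lam * E (avg fun x => f x * f x) +
          (1 - lam) * E (avg fun x => f x * lowPart l f x)) := by
        refine mul_le_mul_of_nonneg_left ?_ ht.le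
        linarith
    _ ≤ 2 ^ t * (lam * (2 ^ t)⁻¹ + (1 - lam) * (3 * θ / 4 * (2 ^ t)⁻¹ +
          (16 ^ l / 4 ^ t + I) / (4 * θ ^ 3))) := by
        have : 0 ≤ 1 - lam := by linarith
        gcongr
    _ = _ := by field_simp

end ValueBound

/-! ### Square functions of noisy forms -/

section SquareFunction

open MvPolynomial

variable {n d t : ℕ}

theorem fhat_sum_sgn_smul {G W : Type*} [AddCommGroup G] [Fintype G] [Module (ZMod 2) G]
    [AddCommGroup W] [Module ℝ W] (c : (G →+ ZMod 2) → W) (ψ : G →+ ZMod 2) :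
    fhat (fun x => ∑ φ : G →+ ZMod 2, sgn (φ x) • c φ) ψ = c ψ := by
  classical
  simp only [fhat, Finset.smul_sum, avg_sum]
  have h1 : ∀ φ : G →+ ZMod 2, avg (fun x => sgn (ψ x) • sgn (φ x) • c φ) =
      if φ = ψ then c φ else 0 := by
    intro φ
    have h2 := avg_sgn (ψ + φ)
    rw [avg, smul_eq_mul] at h2
    have h3 : ∀ x, sgn (ψ x) • sgn (φ x) • c φ = sgn ((ψ + φ) x) • c φ := fun x => by
      rw [smul_smul, ← sgn_add, AddMonoidHom.add_apply]
    have h4 : ψ + φ = 0 ↔ φ = ψ := by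
      constructor
      · intro h0
        refine AddMonoidHom.ext fun x => ?_
        have h5 := DFunLike.congr_fun h0 x
        rw [AddMonoidHom.add_apply, AddMonoidHom.zero_apply] at h5
        exact (sub_eq_zero.1 ((sub_eq_add_of_module_two _ _).trans h5)).symm
      · rintro rfl
        exact AddMonoidHom.ext fun x => zmod_two_add_self _
    simp only [h3]
    rw [avg, ← Finset.sum_smul, smul_smul, h2]
    simp only [h4]
    split_ifs <;> simp
  simp only [h1, Finset.sum_ite_eq', Finset.mem_univ, if_true]

theorem fhat_lowPart {W : Type*} [AddCommGroup W] [Module ℝ W] {l : ℕ}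
    (hl : 2 * l < 2 ^ (d + 1)) (f : ShortCode n d t → W) (φ : ShortCode n d t →+ ZMod 2)
    [Decidable (∃ α, wt α ≤ l ∧ φ = pairHom d α)] :
    fhat (lowPart l f) φ = if ∃ α, wt α ≤ l ∧ φ = pairHom d α then fhat f φ else 0 := by
  classical
  have h1 : lowPart l f = fun x => ∑ φ : ShortCode n d t →+ ZMod 2,
      sgn (φ x) • if ∃ α, wt α ≤ l ∧ φ = pairHom d α then fhat f φ else 0 := by
    funext x
    have h2 := sum_low_characters (t := t) (n := n) hl fun φ => sgn (φ x) • fhat f φ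
    simp only [smul_ite, smul_zero]
    rw [← h2, lowPart]
    refine Finset.sum_congr rfl fun α _ => ?_
    rw [lowCoeff]
    split_ifs <;> simp
  rw [h1, fhat_sum_sgn_smul]
  congr

/-- The noise of the base code, on words over a one-dimensional alphabet. -/
noncomputable def rmNoiseOne (n d : ℕ) (η : ℝ) : PMF (ShortCode n d 1) :=
  (rmNoise n d η).map fun q _ => q

theorem pmfMean_rmNoiseOne {η : ℝ} (h0 : 0 < η) (h1 : η < 1) (α : F2Vec n → F2Vec 1) :
    pmfMean (rmNoiseOne n d η) (fun x => sgn (pairHom d α x)) =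
      Real.exp (-(2 ^ d * Real.log (1 / (1 - η)) * rej d α)) := by
  rw [rmNoiseOne, pmfMean_map, pmfMean_rmNoise h0 h1]

variable {σ : Type} {E : MvPolynomial σ ℝ →ₗ[ℝ] ℝ}

theorem avg_pmfMean_mul_self_le {G : Type*} [AddCommGroup G] [Fintype G]
    (μ : PMF G) {f : G → MvPolynomial σ ℝ} (hf : ∀ x, f x ∈ polyDeg σ 1) :
    avg (fun x => f x * f x) - (avg fun x => (pmfMean μ fun z => f (x + z)) *
      pmfMean μ fun z => f (x + z)) ∈ sqCone σ := by
  have h1 : avg (fun x => f x * f x) = avg fun x => pmfMean μ fun z => f (x + z) * f (x + z) := by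
    rw [← pmfMean_avg_comm]
    have h2 : ∀ z, (avg fun x => f (x + z) * f (x + z)) = avg fun x => f x * f x := fun z =>
      avg_equiv (Equiv.addRight z) fun x => f x * f x
    simp only [h2, pmfMean_const]
  rw [h1, ← avg_sub]
  exact avg_mem_sqCone fun x => jensen_mem_sqCone μ fun z => hf _

/-- Noise contracts the high part of a function. -/
theorem avg_highPart_mul_self_le {f : ShortCode n d 1 → MvPolynomial σ ℝ}
    (hf : ∀ x, f x ∈ polyDeg σ 1) (hd : d ≤ n) {l : ℕ} (hl : 2 * l < 2 ^ (d + 1)) {η : ℝ}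
    (h0 : 0 < η) (h1 : η < 1) {g : ShortCode n d 1 → MvPolynomial σ ℝ}
    (hg : g = fun x => pmfMean (rmNoiseOne n d η) fun z => f (x + z)) :
    decay d l η ^ 2 • avg (fun x => f x * f x) -
      (avg fun x => (g x - lowPart l g x) * (g x - lowPart l g x)) ∈ sqCone σ := by
  classical
  rw [parseval, parseval, Finset.smul_sum, ← Finset.sum_sub_distrib]
  refine sum_mem fun φ _ => ?_
  have e1 : fhat (fun x => g x - lowPart l g x) φ = fhat g φ - fhat (lowPart l g) φ := by
    simp only [fhat, smul_sub, avg_sub]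
  have hcone := mul_self_mem_sqCone (fhat_mem hf φ)
  rw [e1, fhat_lowPart hl]
  split_ifs with hφ
  · rw [sub_self, mul_zero, sub_zero]
    exact smul_mem_sqCone (by positivity) hcone
  · obtain ⟨α, rfl, hα⟩ := (pairHom_dichotomy hd l φ).resolve_left hφ
    rw [sub_zero, hg, fhat_pmfMean, pmfMean_rmNoiseOne h0 h1, smul_mul_smul_comm, ← sub_smul]
    refine smul_mem_sqCone ?_ hcone
    have h2 := exp_rej_le_decay h0 h1 hα
    have h3 := Real.exp_pos (-(2 ^ d * Real.log (1 / (1 - η)) * rej d α))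
    nlinarith

/-- A weighted square function of noisy linear forms on the base code is small in mean square,
if it is bounded in the sense of `hτ`: the high parts of the forms are contracted by the noise
and the low parts are hypercontractive. -/
theorem avg_squareFunction_sq_le (hE : IsPseudoExpectation 8 E) {B : Type*} [Fintype B]
    {κ : B → ℝ} (hκ : ∀ b, 0 ≤ κ b) {f g : B → ShortCode n d 1 → MvPolynomial σ ℝ}
    (hf : ∀ b x, f b x ∈ polyDeg σ 1) (hd : d ≤ n) {l : ℕ} (hl : 4 * l < 2 ^ (d + 1)) {η : ℝ}
    (h0 : 0 < η) (h1 : η < 1)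
    (hg : ∀ b, g b = fun x => pmfMean (rmNoiseOne n d η) fun z => f b (x + z))
    {τ : ℝ} (hτ0 : 0 ≤ τ)
    (hτ : ∀ x, ∀ q ∈ sqCone σ, E ((∑ b, κ b • (g b x * g b x)) * q) ≤ τ * E q)
    {a : MvPolynomial σ ℝ} (ha : a = ∑ b, κ b • avg fun x => f b x * f b x) :
    (avg fun x => E ((∑ b, κ b • (g b x * g b x)) * ∑ b, κ b • (g b x * g b x))) ≤
      4 * (64 ^ l * E (a * a)) + 4 * (τ * (decay d l η ^ 2 * E a)) := by
  have hgm : ∀ b x, g b x ∈ polyDeg σ 1 := fun b x => by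
    rw [hg]; exact pmfMean_mem _ _ fun z => hf b _
  set L : B → ShortCode n d 1 → MvPolynomial σ ℝ := fun b => lowPart l (g b) with hL
  have hLm : ∀ b x, L b x ∈ polyDeg σ 1 := fun b => lowPart_mem (hgm b) l
  have hHm : ∀ b x, g b x - L b x ∈ polyDeg σ 1 := fun b x =>
    Submodule.sub_mem _ (hgm b x) (hLm b x)
  set Z : ShortCode n d 1 → MvPolynomial σ ℝ := fun x => ∑ b, κ b • (g b x * g b x) with hZ
  set P : ShortCode n d 1 → MvPolynomial σ ℝ := fun x => ∑ b, κ b • (L b x * L b x) with hP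
  set H : ShortCode n d 1 → MvPolynomial σ ℝ :=
    fun x => ∑ b, κ b • ((g b x - L b x) * (g b x - L b x)) with hH
  have hcone : ∀ {F : B → ShortCode n d 1 → MvPolynomial σ ℝ} (_ : ∀ b x, F b x ∈ polyDeg σ 1) x,
      ∑ b, κ b • (F b x * F b x) ∈ sqCone σ := fun hF x =>
    sum_mem fun b _ => smul_mem_sqCone (hκ b) (mul_self_mem_sqCone (hF b x))
  have hZm : ∀ x, Z x ∈ sqCone σ := hcone hgm
  have hPm : ∀ x, P x ∈ sqCone σ := hcone hLm
  have hHm' : ∀ x, H x ∈ sqCone σ := hcone hHm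
  -- `Z ≤ 2 P + 2 H`, hence `Z² ≤ 4 P² + 4 Z H`
  have hpt : ∀ x, E (Z x * Z x) ≤ (4 : ℝ) • E (P x * P x) + (4 * τ) • E (H x) := by
    intro x
    have e1 : (2 : ℝ) • P x + (2 : ℝ) • H x - Z x ∈ sqCone σ := by
      have : (2 : ℝ) • P x + (2 : ℝ) • H x - Z x =
          ∑ b, κ b • ((g b x - (2 : ℝ) • L b x) * (g b x - (2 : ℝ) • L b x)) := by
        simp only [hP, hH, hZ, Finset.smul_sum]
        rw [← Finset.sum_add_distrib, ← Finset.sum_sub_distrib]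
        refine Finset.sum_congr rfl fun b _ => ?_
        simp only [two_smul, ← smul_sub, ← smul_add]
        congr 1
        ring
      rw [this]
      exact sum_mem fun b _ => smul_mem_sqCone (hκ b) (mul_self_mem_sqCone
        (Submodule.sub_mem _ (hgm b x) (Submodule.smul_mem _ _ (hLm b x))))
    have e2 := hE.mul_nonneg (hZm x) e1
    rw [mul_sub, mul_add, mul_smul_comm, mul_smul_comm, map_sub, map_add, map_smul, map_smul,
      smul_eq_mul, smul_eq_mul] at e2
    have d2 : Z x - (2 : ℝ) • P x ∈ polyDeg σ 4 := polyDeg_mono (by norm_num)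
      (Submodule.sub_mem _ (sqCone_le_polyDeg (hZm x))
        (Submodule.smul_mem _ _ (sqCone_le_polyDeg (hPm x))))
    have e3 := hE.mul_self_nonneg d2
    have e4 : (Z x - (2 : ℝ) • P x) * (Z x - (2 : ℝ) • P x) =
        Z x * Z x - (4 : ℝ) • (Z x * P x) + (4 : ℝ) • (P x * P x) := by
      simp only [Algebra.smul_def, map_ofNat]
      ring
    rw [e4, map_add, map_sub, map_smul, map_smul, smul_eq_mul, smul_eq_mul] at e3
    have e5 := hτ x (H x) (hHm' x)
    rw [smul_eq_mul, smul_eq_mul]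
    linarith
  refine (avg_mono hpt).trans ?_
  rw [avg_add, avg_smul, avg_smul, smul_eq_mul, smul_eq_mul, mul_assoc]
  refine add_le_add (mul_le_mul_of_nonneg_left ?_ (by norm_num))
    (mul_le_mul_of_nonneg_left (mul_le_mul_of_nonneg_left ?_ hτ0) (by norm_num))
  · -- the low part
    have e1 : ∀ b, ((8 : ℝ) ^ l • avg fun x => f b x * f b x) - wtNorm 8 (lowCoeff l (g b)) ∈
        sqCone σ := by
      intro b
      have hj := avg_pmfMean_mul_self_le (rmNoiseOne n d η) (hf b)
      refine mem_sqCone_trans (wtNorm_lowCoeff_le (hgm b) (by omega) (by norm_num)) ?_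
      rw [← smul_sub, hg b]
      exact smul_mem_sqCone (by positivity) hj
    have e2 : ∀ b b', E (avg fun x => L b x ^ 2 * L b' x ^ 2) ≤
        64 ^ l * E ((avg fun x => f b x * f b x) * avg fun x => f b' x * f b' x) := by
      intro b b'
      rw [hL, lowPart_quartic l hl]
      have e3 := quarticMean_le_crude hE (lowCoeff_mem (hgm b) l) (lowCoeff_mem (hgm b') l)
      rw [show (4 * 2 ^ 1 : ℝ) = 8 by norm_num] at e3
      refine (e3.trans (hE.mul_le_mul (e1 b) (e1 b') (smul_mem_sqCone (by positivity)
        (avg_mem_sqCone fun x => mul_self_mem_sqCone (hf b x)))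
        (wtNorm_mem (by norm_num) (lowCoeff_mem (hgm b') l)))).trans (le_of_eq ?_)
      rw [smul_mul_smul_comm, map_smul, smul_eq_mul, ← mul_pow]
      norm_num
    have e4 : (avg fun x => E (P x * P x)) =
        ∑ b, ∑ b', κ b * κ b' * E (avg fun x => L b x ^ 2 * L b' x ^ 2) := by
      have e5 : ∀ x, E (P x * P x) = ∑ b, ∑ b', (κ b * κ b') • E (L b x ^ 2 * L b' x ^ 2) := by
        intro x
        simp only [hP, Finset.sum_mul_sum, map_sum, smul_mul_smul_comm, map_smul, sq]
      simp only [e5, avg_sum, avg_smul]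
      simp only [map_avg, smul_eq_mul]
    have e6 : E (a * a) = ∑ b, ∑ b', κ b * κ b' *
        E ((avg fun x => f b x * f b x) * avg fun x => f b' x * f b' x) := by
      simp only [ha, Finset.sum_mul_sum, map_sum, smul_mul_smul_comm, map_smul, smul_eq_mul]
    rw [e4, e6, Finset.mul_sum]
    refine Finset.sum_le_sum fun b _ => ?_
    rw [Finset.mul_sum]
    refine Finset.sum_le_sum fun b' _ => ?_
    rw [mul_left_comm]
    exact mul_le_mul_of_nonneg_left (e2 b b') (mul_nonneg (hκ b) (hκ b'))
  · -- the high part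
    have e1 : decay d l η ^ 2 • a - avg H ∈ sqCone σ := by
      have : avg H = ∑ b, κ b • avg fun x => (g b x - L b x) * (g b x - L b x) := by
        simp only [hH, avg_sum, avg_smul]
      rw [this, ha, Finset.smul_sum, ← Finset.sum_sub_distrib]
      refine sum_mem fun b _ => ?_
      rw [smul_comm, ← smul_sub]
      exact smul_mem_sqCone (hκ b) (avg_highPart_mul_self_le (hf b) hd (by omega) h0 h1 (hg b))
    have e2 := hE.nonneg e1
    rw [map_sub, map_smul, smul_eq_mul, map_avg] at e2
    linarith

end SquareFunction

/-! ### Influences in the basic instance -/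

section Shift

variable {n d t : ℕ}

/-- The word `α` moved by the translation `i ↦ i + b`. -/
def shiftWord (b : F2Vec n) (α : F2Vec n → F2Vec t) : F2Vec n → F2Vec t := fun i => α (i + b)

theorem shiftWord_shiftWord (b b' : F2Vec n) (α : F2Vec n → F2Vec t) :
    shiftWord b (shiftWord b' α) = shiftWord (b + b') α := by
  funext i
  show α (i + b + b') = α (i + (b + b'))
  rw [add_assoc]

/-- `shiftWord` as a permutation. -/
def shiftEquiv (t : ℕ) (b : F2Vec n) : (F2Vec n → F2Vec t) ≃ (F2Vec n → F2Vec t) where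
  toFun := shiftWord b
  invFun := shiftWord b
  left_inv α := by
    rw [shiftWord_shiftWord, add_self_of_module_two]
    funext i
    show α (i + 0) = α i
    rw [add_zero]
  right_inv α := by
    rw [shiftWord_shiftWord, add_self_of_module_two]
    funext i
    show α (i + 0) = α i
    rw [add_zero]

theorem wt_shiftWord (b : F2Vec n) (α : F2Vec n → F2Vec t) : wt (shiftWord b α) = wt α :=
  wt_comp_equiv (Equiv.addRight b) α

theorem pairHom_shiftWord (b : F2Vec n) (α : F2Vec n → F2Vec t) (x : ShortCode n d t) :
    pairHom d (shiftWord b α) (translateWord b x) = pairHom d α x := by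
  show ∑ i, ∑ j, α (i + b) j * (x j).1 (i + b) = ∑ i, ∑ j, α i j * (x j).1 i
  exact Equiv.sum_comp (Equiv.addRight b) fun i => ∑ j, α i j * (x j).1 i

theorem fhat_translateWord {W : Type*} [AddCommGroup W] [Module ℝ W] (b : F2Vec n)
    (f : ShortCode n d t → W) (α : F2Vec n → F2Vec t) :
    fhat (fun x => f (translateWord b x)) (pairHom d α) = fhat f (pairHom d (shiftWord b α)) := by
  refine Eq.trans ?_ (avg_equiv (translateEquiv n d t b) fun x =>
    sgn (pairHom d (shiftWord b α) x) • f x)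
  refine congrArg avg (funext fun x => ?_)
  show _ = sgn (pairHom d (shiftWord b α) (translateWord b x)) • f (translateWord b x)
  rw [pairHom_shiftWord]

end Shift

section BaseGame

open MvPolynomial

variable {n d : ℕ}

theorem linPart_add (g q : RM n d) : linPart (g + q) = linPart g + linPart q := by
  funext i
  show (g.1 _ + q.1 _) - (g.1 0 + q.1 0) = (g.1 _ - g.1 0) + (q.1 _ - q.1 0)
  ring

theorem linPart_of_forall {q : RM n d} {r : F2Vec n} (h : ∀ x, q.1 x = r ⬝ᵥ x) :
    linPart q = r := by
  funext i
  show q.1 _ - q.1 0 = r i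
  rw [h, h, dotProduct_single, dotProduct_zero, mul_one, sub_zero]

/-- The linear form `x ↦ ⟨r, x⟩` as a codeword. -/
noncomputable def linWord (hd : 1 ≤ d) (r : F2Vec n) : RM n d :=
  ⟨fun x => r ⬝ᵥ x, mem_RM (∑ j, MvPolynomial.C (r j) * MvPolynomial.X j) (by
    refine (MvPolynomial.totalDegree_finsetSum_le fun j _ => ?_).trans hd
    refine (MvPolynomial.totalDegree_mul _ _).trans ?_
    simp) fun x => by simp [dotProduct]⟩

theorem bijective_class_linPart (hd : 1 ≤ d) : Function.Bijective fun g : RM n d =>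
    (((linForms n d).mkQ g, linPart g) : BaseVertex n d × F2Vec n) := by
  constructor
  · intro g g' h
    obtain ⟨h1, h2⟩ := Prod.mk.inj h
    obtain ⟨r, hr⟩ := (Submodule.Quotient.eq (linForms n d)).1 h1
    have h3 : linPart (g - g') = r := linPart_of_forall hr
    have h4 : linPart (g - g') + linPart g' = linPart g := by rw [← linPart_add, sub_add_cancel]
    have h2' : linPart g = linPart g' := h2
    rw [h3, h2', add_eq_right] at h4
    refine sub_eq_zero.1 (Subtype.ext (funext fun x => ?_))
    rw [hr, h4, zero_dotProduct]
    rfl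
  · rintro ⟨u, j⟩
    obtain ⟨g, rfl⟩ := (linForms n d).mkQ_surjective u
    refine ⟨g + linWord hd (j - linPart g), Prod.ext ?_ ?_⟩
    · show (linForms n d).mkQ (g + linWord hd (j - linPart g)) = (linForms n d).mkQ g
      rw [map_add, add_eq_left]
      exact (Submodule.Quotient.mk_eq_zero _).2 ⟨_, fun x => rfl⟩
    · show linPart (g + linWord hd (j - linPart g)) = j
      rw [linPart_add, linPart_of_forall (q := linWord hd (j - linPart g)) fun x => rfl,
        add_sub_cancel]

/-- A codeword is a pair of its class modulo linear forms and its label. -/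
noncomputable def codewordEquiv (hd : 1 ≤ d) : RM n d ≃ BaseVertex n d × F2Vec n :=
  Equiv.ofBijective _ (bijective_class_linPart hd)

/-- A uniformly random class with a uniformly random label is a uniformly random codeword. -/
theorem avg_class_linPart {W : Type*} [AddCommGroup W] [Module ℝ W] (hd : 1 ≤ d)
    (F : BaseVertex n d → F2Vec n → W) :
    (avg fun u => avg fun j => F u j) =
      avg fun g : RM n d => F ((linForms n d).mkQ g) (linPart g) := by
  rw [← avg_prod fun p : BaseVertex n d × F2Vec n => F p.1 p.2, ← avg_equiv (codewordEquiv hd)]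
  rfl

variable {d' t : ℕ}

/-- The Fourier coefficient of the folded assignment at the class of `g`, at the word `β` in the
frame given by the label of `g`. -/
noncomputable def frameCoeff (d' : ℕ) (β : F2Vec n → F2Vec t) (g : RM n d) :
    MvPolynomial (RedVar (BaseVertex n d) n d' t) ℝ :=
  fhat (fold ((linForms n d).mkQ g)) (pairHom d' (shiftWord (linPart g) β))

/-- In the frames given by labels, the constraints of the basic instance act on Fourier
coefficients as the noise of the code. -/
theorem fhat_nbrMean (η : ℝ) (g : RM n d) (β : F2Vec n → F2Vec t) :
    fhat (nbrMean (baseGame n d η) ((linForms n d).mkQ g))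
        (pairHom d' (shiftWord (linPart g) β)) =
      pmfMean (rmNoise n d η) fun q => frameCoeff d' β (g + q) := by
  have h1 : (nbrMean (baseGame n d η) ((linForms n d).mkQ g) : ShortCode n d' t → _) =
      fun x => pmfMean (rmNoise n d η) fun q =>
        fold ((linForms n d).mkQ (g + q)) (translateWord (linPart q) x) := by
    funext x
    rw [nbrMean, baseGame, pmfMean_map]
    simp only [map_add]
  rw [h1]
  have h2 : ∀ φ : ShortCode n d' t →+ ZMod 2, fhat (fun x => pmfMean (rmNoise n d η) fun q =>
      fold ((linForms n d).mkQ (g + q)) (translateWord (linPart q) x)) φ =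
      pmfMean (rmNoise n d η) fun q => fhat (fun x =>
        fold ((linForms n d).mkQ (g + q)) (translateWord (linPart q) x)) φ := by
    intro φ
    simp only [fhat, ← pmfMean_smul]
    rw [← pmfMean_avg_comm]
  rw [h2]
  refine congrArg (pmfMean _) (funext fun q => ?_)
  rw [fhat_translateWord (linPart q) (fold ((linForms n d).mkQ (g + q))), shiftWord_shiftWord,
    frameCoeff, linPart_add, add_comm (linPart q)]

/-- The weights of the influence of the position `0` on the words of weight at most `l`. -/
noncomputable def infWeight (M : ℝ) (l : ℕ) (β : F2Vec n → F2Vec t) : ℝ :=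
  if β 0 ≠ 0 ∧ wt β ≤ l then M ^ wt β else 0

theorem infWeight_nonneg {M : ℝ} (hM : 0 ≤ M) (l : ℕ) (β : F2Vec n → F2Vec t) :
    0 ≤ infWeight M l β := by
  rw [infWeight]; split_ifs <;> positivity

theorem infWeight_le {M : ℝ} (hM : 1 ≤ M) (l : ℕ) (β : F2Vec n → F2Vec t) :
    infWeight M l β ≤ M ^ l * if β 0 ≠ 0 ∧ wt β ≤ l then 1 else 0 := by
  rw [infWeight]
  split_ifs with h
  · rw [mul_one]; exact pow_le_pow_right₀ hM h.2
  · rw [mul_zero]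

/-- The influence of the label of `g` at the class of `g` is a square function on the code: in the frame
of the label, the position is `0` for every codeword. -/
theorem wtInf_lowCoeff_nbrMean (M : ℝ) (l : ℕ) (η : ℝ) (g : RM n d) :
    wtInf M (linPart g) (lowCoeff l (nbrMean (d := d') (t := t) (baseGame n d η)
      ((linForms n d).mkQ g))) =
      ∑ β : F2Vec n → F2Vec t, infWeight M l β •
        ((pmfMean (rmNoise n d η) fun q => frameCoeff d' β (g + q)) *
          pmfMean (rmNoise n d η) fun q => frameCoeff d' β (g + q)) := by
  rw [wtInf, ← (shiftEquiv t (linPart g)).sum_comp]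
  refine Finset.sum_congr rfl fun β _ => ?_
  show (if shiftWord (linPart g) β (linPart g) = 0 then (0 : ℝ) else
    M ^ wt (shiftWord (linPart g) β)) • (lowCoeff l _ (shiftWord (linPart g) β) *
      lowCoeff l _ (shiftWord (linPart g) β)) = _
  have h1 : shiftWord (linPart g) β (linPart g) = β 0 := by
    show β (linPart g + linPart g) = β 0
    rw [add_self_of_module_two]
  rw [h1, wt_shiftWord, lowCoeff, wt_shiftWord, infWeight, fhat_nbrMean]
  by_cases h2 : β 0 = 0
  · simp [h2]
  · by_cases h3 : wt β ≤ l <;> simp [h2, h3]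

end BaseGame

section BaseGame

open MvPolynomial

variable {n d d' t : ℕ}

theorem avg_indicator (l : ℕ) (α : F2Vec n → F2Vec t) :
    avg (fun r => if α r ≠ 0 ∧ wt α ≤ l then (1 : ℝ) else 0) =
      if wt α ≤ l then (wt α : ℝ) / 2 ^ n else 0 := by
  split_ifs with h
  · simp only [h, and_true]
    rw [avg, card_F2Vec, smul_eq_mul, wt, Finset.sum_boole, ← div_eq_inv_mul]
  · simp only [h, and_false, if_false]
    exact avg_const 0

/-- The average over the positions of the low-degree influences, as each word of weight at most `l` is
counted with probability at most `l / 2 ^ n`. -/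
theorem smul_avg_fold_sub_mem (l : ℕ) (hl : 2 * l < 2 ^ (d' + 1)) (u : BaseVertex n d) :
    ((l : ℝ) / 2 ^ n) • (avg fun x : ShortCode n d' t => fold u x * fold u x) -
      (avg fun r => ∑ α : F2Vec n → F2Vec t, (if α r ≠ 0 ∧ wt α ≤ l then (1 : ℝ) else 0) •
        (fhat (fold u) (pairHom d' α) * fhat (fold u) (pairHom d' α))) ∈
      sqCone (RedVar (BaseVertex n d) n d' t) := by
  have hf : ∀ x : ShortCode n d' t, fold u x ∈ polyDeg (RedVar (BaseVertex n d) n d' t) 1 :=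
    fold_mem u
  have e1 : (avg fun r => ∑ α : F2Vec n → F2Vec t, (if α r ≠ 0 ∧ wt α ≤ l then (1 : ℝ) else 0) •
        (fhat (fold u) (pairHom d' α) * fhat (fold u) (pairHom d' α))) =
      ∑ α : F2Vec n → F2Vec t, (if wt α ≤ l then (wt α : ℝ) / 2 ^ n else 0) •
        (fhat (fold u) (pairHom d' α) * fhat (fold u) (pairHom d' α)) := by
    rw [avg_sum]
    refine Finset.sum_congr rfl fun α _ => ?_
    rw [← avg_indicator, avg, ← Finset.sum_smul, smul_smul]
    rfl
  have e2 := sum_lowCoeff_le hf hl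
  have e3 : ((l : ℝ) / 2 ^ n) • ∑ α, lowCoeff l (fold u) α * lowCoeff l (fold u) α -
      ∑ α : F2Vec n → F2Vec t, (if wt α ≤ l then (wt α : ℝ) / 2 ^ n else 0) •
        (fhat (fold u) (pairHom d' α) * fhat (fold u) (pairHom d' α)) ∈
      sqCone (RedVar (BaseVertex n d) n d' t) := by
    rw [Finset.smul_sum, ← Finset.sum_sub_distrib]
    refine sum_mem fun α _ => ?_
    rw [lowCoeff]
    split_ifs with h
    · rw [← sub_smul]
      refine smul_mem_sqCone ?_ (mul_self_mem_sqCone (fhat_mem hf _))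
      rw [← sub_div]
      have : (wt α : ℝ) ≤ l := by exact_mod_cast h
      exact div_nonneg (by linarith) (by positivity)
    · rw [zero_smul, mul_zero, smul_zero, sub_zero]
      exact zero_mem _
  rw [e1]
  refine mem_sqCone_trans e3 ?_
  rw [← smul_sub]
  exact smul_mem_sqCone (by positivity) e2

/-- A random label is an influential position with probability at most `l / 2 ^ n`. -/
theorem sum_infWeight_frameCoeff_le (hd : 1 ≤ d) {l : ℕ} (hl : 2 * l < 2 ^ (d' + 1)) {M : ℝ}
    (hM : 1 ≤ M) :
    (M ^ l * (l / 2 ^ n)) • (avg fun u : BaseVertex n d => vertexMass n d' t u) -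
      ∑ β : F2Vec n → F2Vec t, infWeight M l β •
        (avg fun g : RM n d => frameCoeff d' β g * frameCoeff d' β g) ∈
      sqCone (RedVar (BaseVertex n d) n d' t) := by
  have hfm : ∀ (β : F2Vec n → F2Vec t) (g : RM n d), frameCoeff d' β g ∈
      polyDeg (RedVar (BaseVertex n d) n d' t) 1 := fun β g => fhat_mem (fold_mem _) _
  have e1 : M ^ l • ∑ β : F2Vec n → F2Vec t, (if β 0 ≠ 0 ∧ wt β ≤ l then (1 : ℝ) else 0) •
        (avg fun g : RM n d => frameCoeff d' β g * frameCoeff d' β g) -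
      ∑ β : F2Vec n → F2Vec t, infWeight M l β •
        (avg fun g : RM n d => frameCoeff d' β g * frameCoeff d' β g) ∈
      sqCone (RedVar (BaseVertex n d) n d' t) := by
    rw [Finset.smul_sum, ← Finset.sum_sub_distrib]
    refine sum_mem fun β _ => ?_
    rw [smul_smul, ← sub_smul]
    exact smul_mem_sqCone (sub_nonneg.2 (infWeight_le hM l β))
      (avg_mem_sqCone fun g => mul_self_mem_sqCone (hfm β g))
  have e2 : ∑ β : F2Vec n → F2Vec t, (if β 0 ≠ 0 ∧ wt β ≤ l then (1 : ℝ) else 0) •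
        (avg fun g : RM n d => frameCoeff d' β g * frameCoeff d' β g) =
      avg fun u : BaseVertex n d => avg fun r => ∑ α : F2Vec n → F2Vec t,
        (if α r ≠ 0 ∧ wt α ≤ l then (1 : ℝ) else 0) •
        (fhat (fold u) (pairHom d' α) * fhat (fold u) (pairHom d' α)) := by
    rw [avg_class_linPart hd]
    simp only [← avg_smul, ← avg_sum]
    refine congrArg avg (funext fun g => ?_)
    conv_rhs => rw [← (shiftEquiv t (linPart g)).sum_comp]
    refine Finset.sum_congr rfl fun β _ => ?_
    show _ = (if shiftWord (linPart g) β (linPart g) ≠ 0 ∧ wt (shiftWord (linPart g) β) ≤ l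
      then (1 : ℝ) else 0) • (frameCoeff d' β g * frameCoeff d' β g)
    have h1 : shiftWord (linPart g) β (linPart g) = β 0 := by
      show β (linPart g + linPart g) = β 0
      rw [add_self_of_module_two]
    rw [h1, wt_shiftWord]
  rw [e2] at e1
  refine mem_sqCone_trans e1 ?_
  rw [mul_smul, ← smul_sub, ← avg_smul, ← avg_sub]
  refine smul_mem_sqCone (by positivity) (avg_mem_sqCone fun u => ?_)
  refine mem_sqCone_trans (smul_avg_fold_sub_mem l hl u) ?_
  rw [← smul_sub]
  exact smul_mem_sqCone (by positivity) (avg_fold_mul_self_le u)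

theorem wtInf_le_wtNorm {σ ι : Type} [Fintype ι] [DecidableEq ι] {b : ℝ} (hb : 0 ≤ b) (j : ι)
    {c : (ι → F2Vec t) → MvPolynomial σ ℝ} (hc : ∀ α, c α ∈ polyDeg σ 1) :
    wtNorm b c - wtInf b j c ∈ sqCone σ := by
  rw [wtNorm, wtInf, ← Finset.sum_sub_distrib]
  refine sum_mem fun α _ => ?_
  rw [← sub_smul]
  refine smul_mem_sqCone ?_ (mul_self_mem_sqCone (hc α))
  split_ifs
  · rw [sub_zero]; positivity
  · rw [sub_self]

/-- Inequalities up to `sqCone` can be squared. -/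
theorem IsPseudoExpectation.mul_self_le_of_smul {σ : Type} {E : MvPolynomial σ ℝ →ₗ[ℝ] ℝ}
    (hE : IsPseudoExpectation 8 E) {w : ℝ} (hw : 0 ≤ w) {a p : MvPolynomial σ ℝ}
    (hp : p ∈ sqCone σ) (ha : a ∈ sqCone σ) (h : w • p - a ∈ sqCone σ) :
    E (a * a) ≤ w ^ 2 * E (p * p) := by
  have e1 := hE.mul_le_mul h h (smul_mem_sqCone hw hp) ha
  rwa [smul_mul_smul_comm, map_smul, smul_eq_mul, ← sq w] at e1

variable {E : MvPolynomial (RedVar (BaseVertex n d) n d' t) ℝ →ₗ[ℝ] ℝ}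

/-- The influences in the basic instance are small on average, since its label-extended graph is
the noise graph of the code. -/
theorem IsPseudoAssignment.avg_influences_le (h : IsPseudoAssignment E) (hd1 : 1 ≤ d) (hdn : d ≤ n)
    {l l' : ℕ} (hl : 4 * l < 2 ^ (d' + 1)) (hl' : 4 * l' < 2 ^ (d + 1)) {η : ℝ} (h0 : 0 < η)
    (h1 : η < 1) {M : ℝ} (hM : 1 ≤ M) :
    (avg fun u : BaseVertex n d => ∑ j,
      E (wtInf M j (lowCoeff l (nbrMean (d := d') (t := t) (baseGame n d η) u)) *
        wtInf M j (lowCoeff l (nbrMean (baseGame n d η) u)))) ≤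
      4 * (M ^ l) ^ 2 * l ^ 2 * (64 ^ l' / 2 ^ n + decay d l' η ^ 2) := by
  have hE := h.isPseudoExpectation
  have hk : (1 : ℝ) ≤ 2 ^ t := one_le_pow₀ (by norm_num)
  have hk1 : ((2 : ℝ) ^ t)⁻¹ ≤ 1 := inv_le_one_of_one_le₀ hk
  have hR : (0 : ℝ) < 2 ^ n := by positivity
  set f : (F2Vec n → F2Vec t) → ShortCode n d 1 →
    MvPolynomial (RedVar (BaseVertex n d) n d' t) ℝ := fun β x => frameCoeff d' β (x 0) with hf
  set g : (F2Vec n → F2Vec t) → ShortCode n d 1 →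
    MvPolynomial (RedVar (BaseVertex n d) n d' t) ℝ :=
    fun β x => pmfMean (rmNoise n d η) fun q => frameCoeff d' β (x 0 + q) with hg
  have hfm : ∀ β x, f β x ∈ polyDeg (RedVar (BaseVertex n d) n d' t) 1 :=
    fun β x => fhat_mem (fold_mem _) _
  have hgf : ∀ β, g β = fun x => pmfMean (rmNoiseOne n d η) fun z => f β (x + z) := by
    intro β
    funext x
    rw [rmNoiseOne, pmfMean_map]
    rfl
  have hnm : ∀ u (x : ShortCode n d' t), nbrMean (baseGame n d η) u x ∈
      polyDeg (RedVar (BaseVertex n d) n d' t) 1 := nbrMean_mem _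
  have hM0 : 0 ≤ M := by linarith
  -- the influences as a square function of the code
  have hZ : ∀ x : ShortCode n d 1, wtInf M (linPart (x 0)) (lowCoeff l
      (nbrMean (d := d') (t := t) (baseGame n d η) ((linForms n d).mkQ (x 0)))) =
      ∑ β, infWeight M l β • (g β x * g β x) := fun x => wtInf_lowCoeff_nbrMean M l η (x 0)
  have hsum : (avg fun u : BaseVertex n d => ∑ j,
      E (wtInf M j (lowCoeff l (nbrMean (d := d') (t := t) (baseGame n d η) u)) *
        wtInf M j (lowCoeff l (nbrMean (baseGame n d η) u)))) =
      2 ^ n * avg fun x => E ((∑ β, infWeight M l β • (g β x * g β x)) *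
        ∑ β, infWeight M l β • (g β x * g β x)) := by
    have hcard : ∀ F : F2Vec n → ℝ, ∑ j, F j = (2 : ℝ) ^ n • avg F := fun F => by
      rw [← card_smul_avg, card_F2Vec]
    simp only [hcard]
    rw [avg_smul, smul_eq_mul, avg_class_linPart hd1,
      ← avg_equiv (Equiv.funUnique (Fin 1) (RM n d))]
    refine congrArg (fun y : ℝ => 2 ^ n * y) (congrArg avg (funext fun x => ?_))
    rw [← hZ x]
    rfl
  -- every influence is bounded by the total weight, which acts as the constant `τ`
  set τ : ℝ := M ^ l * (2 ^ t)⁻¹ with hτdef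
  have hτ : ∀ x, ∀ q ∈ sqCone (RedVar (BaseVertex n d) n d' t),
      E ((∑ β, infWeight M l β • (g β x * g β x)) * q) ≤ τ * E q := by
    intro x q hq
    have e1 : M ^ l • nbrMass d' t (baseGame n d η) ((linForms n d).mkQ (x 0)) -
        ∑ β, infWeight M l β • (g β x * g β x) ∈ sqCone (RedVar (BaseVertex n d) n d' t) := by
      rw [← hZ]
      refine mem_sqCone_trans (wtInf_le_wtNorm hM0 _ (lowCoeff_mem (hnm _) l)) ?_
      refine mem_sqCone_trans (wtNorm_lowCoeff_le (hnm _) (by omega) hM) ?_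
      rw [← smul_sub]
      exact smul_mem_sqCone (by positivity) (avg_nbrMean_mul_self_le _ _)
    have e2 := hE.mul_nonneg e1 hq
    rw [sub_mul, smul_mul_assoc, map_sub, map_smul, smul_eq_mul,
      h.nbrMass_mul _ _ (polyDeg_mono (by norm_num) (sqCone_le_polyDeg hq))] at e2
    rw [hτdef]
    linarith
  have hκ : ∀ β : F2Vec n → F2Vec t, 0 ≤ infWeight M l β := infWeight_nonneg hM0 l
  have key := avg_squareFunction_sq_le hE hκ hfm hdn hl' h0 h1 hgf (by positivity) hτ rfl
  -- the total weight
  have hA := sum_infWeight_frameCoeff_le (d' := d') (t := t) (n := n) hd1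
    (by omega : 2 * l < 2 ^ (d' + 1)) hM
  have hfx : ∀ β, (avg fun x => f β x * f β x) =
      avg fun g : RM n d => frameCoeff d' β g * frameCoeff d' β g := fun β =>
    avg_equiv (Equiv.funUnique (Fin 1) (RM n d)) fun g => frameCoeff d' β g * frameCoeff d' β g
  simp only [← hfx] at hA
  set a := ∑ β, infWeight M l β • avg fun x => f β x * f β x with ha
  have ham : a ∈ sqCone (RedVar (BaseVertex n d) n d' t) := sum_mem fun β _ =>
    smul_mem_sqCone (hκ β) (avg_mem_sqCone fun x => mul_self_mem_sqCone (hfm β x))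
  set Y : MvPolynomial (RedVar (BaseVertex n d) n d' t) ℝ :=
    avg fun u : BaseVertex n d => vertexMass n d' t u with hY
  have hYm : Y ∈ sqCone (RedVar (BaseVertex n d) n d' t) := avg_mem_sqCone vertexMass_mem
  have hYq : ∀ q ∈ polyDeg (RedVar (BaseVertex n d) n d' t) 4, E (Y * q) = (2 ^ t)⁻¹ * E q := by
    intro q hq
    rw [hY, avg_mul_right, map_avg]
    simp only [h.vertexMass_mul _ hq, avg_const]
  have hEY : E Y = (2 ^ t)⁻¹ := by
    have := hYq 1 (one_mem_polyDeg 4)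
    rwa [mul_one, hE.normalization, mul_one] at this
  set w : ℝ := M ^ l * (l / 2 ^ n) with hw
  have hw0 : 0 ≤ w := by positivity
  have hEa : E a ≤ w * (2 ^ t)⁻¹ := by
    have := hE.nonneg hA
    rw [map_sub, map_smul, hEY, smul_eq_mul] at this
    linarith
  have hEaa : E (a * a) ≤ w ^ 2 := by
    refine (hE.mul_self_le_of_smul hw0 hYm ham hA).trans
      (mul_le_of_le_one_right (sq_nonneg w) ?_)
    rw [hYq Y (polyDeg_mono (by norm_num) (sqCone_le_polyDeg hYm)), hEY]
    exact mul_le_one₀ hk1 (by positivity) hk1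
  have hEa1 : τ * (decay d l' η ^ 2 * E a) ≤ M ^ l * (decay d l' η ^ 2 * w) := by
    have e1 : E a ≤ w := hEa.trans (mul_le_of_le_one_right hw0 hk1)
    have e2 : τ ≤ M ^ l := mul_le_of_le_one_right (by positivity) hk1
    have e3 : 0 ≤ E a := hE.nonneg ham
    gcongr
  rw [hsum]
  have hll : (l : ℝ) ≤ l ^ 2 := by
    rcases Nat.eq_zero_or_pos l with hl0 | hl0
    · simp [hl0]
    · have : (1 : ℝ) ≤ l := by exact_mod_cast hl0
      nlinarith
  calc _ ≤ 2 ^ n * (4 * (64 ^ l' * w ^ 2) + 4 * (M ^ l * (decay d l' η ^ 2 * w))) := by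
        refine mul_le_mul_of_nonneg_left (key.trans ?_) hR.le
        gcongr
    _ = 4 * (M ^ l) ^ 2 * (l ^ 2 * (64 ^ l' / 2 ^ n) + l * decay d l' η ^ 2) := by
        rw [hw]
        field_simp
    _ ≤ 4 * (M ^ l) ^ 2 * (l ^ 2 * (64 ^ l' / 2 ^ n) + l ^ 2 * decay d l' η ^ 2) := by
        gcongr
    _ = _ := by ring

end BaseGame

/-! ### The choice of parameters -/

section Parameters

/-- Once `l` and `2 ^ d` are of order at least `y`, the high characters are contracted by
`exp (-Ω (ε y))`. -/
theorem decay_le_exp {d l : ℕ} {ε y : ℝ} (h0 : 0 < ε) (h1 : ε < 1) (hy : 0 ≤ y)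
    (hl : y ≤ (l + 1 : ℕ)) (hd : y ≤ 2 ^ d) :
    decay d l ε ≤ Real.exp (-(ε * ((1 / 2) ^ 17 * y))) := by
  have h2 := le_log_one_div_one_sub h1
  have h4 : 0 ≤ Real.log (1 / (1 - ε)) := h0.le.trans h2
  rw [decay, Real.exp_le_exp, neg_le_neg_iff]
  have h3 : y ≤ 2 ^ d * min (((l + 1 : ℕ) : ℝ) * (1 / 2) ^ d) 1 := by
    rw [mul_min_of_nonneg _ _ (by positivity), mul_one]
    refine le_min ?_ hd
    rwa [mul_left_comm, ← mul_pow, show (2 : ℝ) * (1 / 2) = 1 by norm_num, one_pow, mul_one]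
  calc ε * ((1 / 2) ^ 17 * y)
      ≤ Real.log (1 / (1 - ε)) *
        ((1 / 2) ^ 17 * (2 ^ d * min (((l + 1 : ℕ) : ℝ) * (1 / 2) ^ d) 1)) := by gcongr
    _ = _ := by ring

/-- The main term: either the noise removes little and the low characters do not matter, or their
contribution is negligible. -/
theorem decay_add_le {t : ℕ} {s lam θ : ℝ} (hs0 : 0 ≤ s) (hs : s ≤ t / 2 ^ 17)
    (hlam1 : lam ≤ 1) (hlam : lam ≤ Real.exp (-s)) (hθ0 : 0 ≤ θ)
    (hθ : θ ≤ 2 ^ (-(t / 8 : ℝ))) : lam + (1 - lam) * θ ≤ Real.exp (-(s / 32)) := by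
  have hθ' : (2 : ℝ) ^ (-(t / 8 : ℝ)) = Real.exp (-(t / 8 * Real.log 2)) := by
    rw [Real.rpow_def_of_pos (by norm_num)]; congr 1; ring
  have hlog := Real.log_two_gt_d9
  have hlog' := Real.log_two_lt_d9
  rw [hθ'] at hθ
  -- for small `s` it suffices that `θ` is bounded away from `1`, for large `s` that `θ ≤ exp (-s)`
  rcases le_or_gt s 1 with h1 | h1
  · rcases Nat.eq_zero_or_pos t with ht | ht
    · have hs' : s = 0 := by
        rw [ht] at hs; norm_num at hs; linarith
      have : θ ≤ 1 := by
        refine hθ.trans ?_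
        rw [ht]; simp
      rw [hs']
      simp only [zero_div, neg_zero, Real.exp_zero]
      nlinarith
    · have ht1 : (1 : ℝ) ≤ t := by exact_mod_cast ht
      have e1 : θ ≤ 15 / 16 := by
        refine hθ.trans ?_
        have e2 : Real.exp (-(t / 8 * Real.log 2)) ≤ Real.exp (-(1 / 12)) := by
          rw [Real.exp_le_exp]; nlinarith
        have e3 := Real.add_one_le_exp (1 / 12 : ℝ)
        rw [Real.exp_neg (1 / 12)] at e2
        have e4 : (Real.exp (1 / 12))⁻¹ ≤ (1 / 12 + 1 : ℝ)⁻¹ := by gcongr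
        exact e2.trans (e4.trans (by norm_num))
      have e2 : Real.exp (-s) ≤ 1 - s / 2 := by
        have e3 := Real.add_one_le_exp s
        rw [Real.exp_neg]
        have e4 : (Real.exp s)⁻¹ ≤ (s + 1)⁻¹ := by gcongr
        refine e4.trans ?_
        rw [inv_le_iff_one_le_mul₀ (by linarith)]
        nlinarith
      have e3 := Real.add_one_le_exp (-(s / 32))
      nlinarith
  · have e1 : θ ≤ Real.exp (-s) := by
      refine hθ.trans ?_
      rw [Real.exp_le_exp]
      have : s ≤ t / 16 := hs.trans (by gcongr; norm_num)
      nlinarith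
    have e2 : 2 * Real.exp (-s) ≤ Real.exp (-(s / 32)) := by
      have e3 : (2 : ℝ) * Real.exp (-s) = Real.exp (Real.log 2 + -s) := by
        rw [Real.exp_add, Real.exp_log (by norm_num)]
      rw [e3, Real.exp_le_exp]
      linarith
    have e4 : lam + (1 - lam) * θ ≤ 2 * Real.exp (-s) := by
      have e5 : Real.exp (-s) ≤ 1 := Real.exp_le_one_iff.2 (by linarith)
      nlinarith [mul_nonneg (sub_nonneg.2 hlam1) (sub_nonneg.2 e1),
        mul_nonneg (sub_nonneg.2 hlam) (sub_nonneg.2 e5)]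
    linarith

/-- The factors that depend only on the alphabet size of the reduced instance. -/
theorem influence_factor_le {t l : ℕ} (hl : 12 * l ≤ t) {θ : ℝ} (hθ0 : 0 < θ)
    (hθ : (θ ^ 3)⁻¹ ≤ 2 ^ t) :
    2 ^ t / (4 * θ ^ 3) * (4 * ((4 * 2 ^ t) ^ l) ^ 2 * l ^ 2) ≤
      if t = 0 then (0 : ℝ) else 2 ^ (t ^ 2) / 2 := by
  rcases Nat.eq_zero_or_pos l with h | h
  · rw [h]
    split_ifs <;> norm_num
    positivity
  · rw [if_neg (by omega)]
    have e1 : (l : ℝ) ≤ 2 ^ l := by exact_mod_cast (Nat.lt_two_pow_self).le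
    have e2 : 2 * t + (6 + 2 * t) * l + 1 ≤ t ^ 2 := by
      have ht : 12 ≤ t := by omega
      nlinarith
    calc 2 ^ t / (4 * θ ^ 3) * (4 * ((4 * 2 ^ t) ^ l) ^ 2 * l ^ 2)
        = 2 ^ t * (θ ^ 3)⁻¹ * ((4 * 2 ^ t) ^ l) ^ 2 * (l : ℝ) ^ 2 := by field_simp
      _ ≤ 2 ^ t * 2 ^ t * ((4 * 2 ^ t) ^ l) ^ 2 * (2 ^ l) ^ 2 := by gcongr
      _ = 2 ^ (2 * t + (6 + 2 * t) * l) := by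
          rw [show (4 : ℝ) * 2 ^ t = 2 ^ (2 + t) by rw [pow_add]; norm_num]
          simp only [← pow_mul, ← pow_add]
          congr 1
          ring
      _ ≤ 2 ^ (t ^ 2) / 2 := by
          rw [le_div_iff₀ (by norm_num), ← pow_succ]
          exact pow_le_pow_right₀ (by norm_num) e2

variable {n t d₁ d₂ : ℕ}
  {E : MvPolynomial (RedVar (BaseVertex n d₁) n d₂ t) ℝ →ₗ[ℝ] ℝ}

/-- The value in terms of the free parameters: `l` and `l'` separate the low from the high characters
of the short code and of the base code, and `θ` is the scale in `IsPseudoAssignment.X_mul_le`. -/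
theorem IsPseudoAssignment.objective_le (h : IsPseudoAssignment E) (hd1 : 1 ≤ d₁) (hdn : d₁ ≤ n)
    (hd2 : d₂ ≤ n) {l l' : ℕ} (hl : 4 * l < 2 ^ (d₂ + 1)) (hl' : 4 * l' < 2 ^ (d₁ + 1)) {ε η : ℝ}
    (h0 : 0 < ε) (h1 : ε < 1) (h0' : 0 < η) (h1' : η < 1) {θ : ℝ} (hθ : 0 < θ) :
    E (shortCodeGame n t d₁ d₂ ε η).objective ≤
      decay d₂ l ε + (1 - decay d₂ l ε) * (3 * θ / 4 + 2 ^ t / (4 * θ ^ 3) *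
        (16 ^ l / 4 ^ t + 4 * ((4 * 2 ^ t) ^ l) ^ 2 * l ^ 2 *
          (64 ^ l' / 2 ^ n + decay d₁ l' η ^ 2))) := by
  have hk : (1 : ℝ) ≤ 4 * 2 ^ t := by
    have : (1 : ℝ) ≤ 2 ^ t := one_le_pow₀ (by norm_num)
    linarith
  have hinf := h.avg_influences_le (d' := d₂) (t := t) hd1 hdn hl hl' h0' h1' hk
  have hlam := decay_le_one d₂ l h0 h1
  have hpt := fun u => h.nbrMean_noise_le (d := d₂) (t := t) (baseGame n d₁ η) u hd2 hl h0 h1 hθ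
  rw [shortCodeGame, objective_shortCodeReduction, map_smul, smul_eq_mul, map_avg]
  have h2 : ∀ F : BaseVertex n d₁ → ℝ, 2 ^ t * avg F = avg fun u => 2 ^ t * F u := fun F =>
    (avg_smul _ F).symm
  rw [h2]
  refine (avg_mono hpt).trans ?_
  have h3 : ∀ (r s : ℝ) (F : BaseVertex n d₁ → ℝ), (avg fun u => r + s * F u) = r + s * avg F := by
    intro r s F
    rw [avg_add, avg_const]
    exact congrArg (r + ·) (avg_smul s F)
  rw [h3, h3, avg_add, avg_const]
  have h4 : 0 ≤ 1 - decay d₂ l ε := by linarith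
  gcongr

end Parameters

section Parameters

variable {n t d₁ d₂ : ℕ}
  {E : MvPolynomial (RedVar (BaseVertex n d₁) n d₂ t) ℝ →ₗ[ℝ] ℝ}

theorem two_pow_eq_exp (m : ℕ) : (2 : ℝ) ^ m = Real.exp (m * Real.log 2) := by
  rw [Real.exp_nat_mul, Real.exp_log (by norm_num)]

/-- The hypothesis `h` bounds `m` in terms of the dual distance `2 ^ (d + 1)`, so that `⌊c m⌋` is an
admissible weight for the low characters. -/
theorem floor_bounds {c a : ℝ} (hc : 0 < c) (hc12 : c ≤ 1 / 12) (hca : c ≤ a / 4) {m d : ℕ}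
    (h : a * m ≤ 2 ^ d) : 12 * ⌊c * m⌋₊ ≤ m ∧ 4 * ⌊c * m⌋₊ < 2 ^ (d + 1) ∧ c * m ≤ 2 ^ d ∧
      c * m ≤ ((⌊c * m⌋₊ + 1 : ℕ) : ℝ) := by
  have hm : (0 : ℝ) ≤ m := Nat.cast_nonneg m
  have hcm : 0 ≤ c * m := by positivity
  have h1 := Nat.floor_le hcm
  have h2 : c * m ≤ a / 4 * m := by gcongr
  have h3 : c * m ≤ 1 / 12 * m := by gcongr
  have h4 : (0 : ℝ) < 2 ^ d := by positivity
  refine ⟨?_, ?_, by linarith, ?_⟩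
  · have : (12 : ℝ) * (⌊c * m⌋₊ : ℕ) ≤ m := by linarith
    exact_mod_cast this
  · have : (4 : ℝ) * (⌊c * m⌋₊ : ℕ) < 2 ^ (d + 1) := by rw [pow_succ]; linarith
    exact_mod_cast this
  · push_cast
    exact (Nat.lt_floor_add_one _).le

/-- The bound with `l` and `l'` proportional to the logarithms of the alphabet sizes and with
`θ ^ 4 = 16 ^ l / 2 ^ t`, which balances the two contributions of the low characters. -/
theorem value_bound_le_exp {n t l l' : ℕ} (hl : 12 * l ≤ t) (hl' : 12 * l' ≤ n)
    {lam lam' y y' θ : ℝ} (hlam1 : lam ≤ 1) (hlam0' : 0 ≤ lam')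
    (hlam1' : lam' ≤ 1) (hy : 0 ≤ y) (hyt : y ≤ t / 2 ^ 17) (hyn : y' ≤ n / 2 ^ 17)
    (hlam0 : 0 ≤ lam) (hlam : lam ≤ Real.exp (-y)) (hlam' : lam' ≤ Real.exp (-y'))
    (hθ : θ = Real.exp ((l - t / 4) * Real.log 2)) :
    lam + (1 - lam) * (3 * θ / 4 + 2 ^ t / (4 * θ ^ 3) *
        (16 ^ l / 4 ^ t + 4 * ((4 * 2 ^ t) ^ l) ^ 2 * l ^ 2 * (64 ^ l' / 2 ^ n + lam' ^ 2))) ≤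
      Real.exp (-(y / 32)) + (if t = 0 then 0 else 2 ^ (t ^ 2)) * Real.exp (-y') := by
  have hlog := Real.log_two_gt_d9
  have ht0 : (0 : ℝ) ≤ t := Nat.cast_nonneg t
  have hn0 : (0 : ℝ) ≤ n := Nat.cast_nonneg n
  have hlR : (12 : ℝ) * l ≤ t := by exact_mod_cast hl
  have hlR' : (12 : ℝ) * l' ≤ n := by exact_mod_cast hl'
  have hθ0 : 0 < θ := by rw [hθ]; exact Real.exp_pos _
  have hθ4 : 16 ^ l = θ ^ 4 * 2 ^ t := by
    rw [show (16 : ℝ) = 2 ^ 4 by norm_num, ← pow_mul, two_pow_eq_exp, two_pow_eq_exp, hθ,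
      ← Real.exp_nat_mul, ← Real.exp_add]
    congr 1
    push_cast
    ring
  have hθ3 : (θ ^ 3)⁻¹ ≤ 2 ^ t := by
    rw [two_pow_eq_exp, hθ, ← Real.exp_nat_mul, ← Real.exp_neg, Real.exp_le_exp]
    push_cast
    nlinarith [(Nat.cast_nonneg l : (0 : ℝ) ≤ l)]
  have hθ8 : θ ≤ 2 ^ (-(t / 8 : ℝ)) := by
    rw [Real.rpow_def_of_pos (by norm_num), hθ, Real.exp_le_exp, mul_comm]
    refine mul_le_mul_of_nonneg_left ?_ (by linarith)
    linarith
  have hmain := decay_add_le hy hyt hlam1 hlam hθ0.le hθ8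
  have hfac := influence_factor_le hl hθ0 hθ3
  have hD : 64 ^ l' / 2 ^ n + lam' ^ 2 ≤ 2 * Real.exp (-y') := by
    have e1 : (64 : ℝ) ^ l' / 2 ^ n ≤ Real.exp (-y') := by
      rw [show (64 : ℝ) = 2 ^ 6 by norm_num, ← pow_mul, two_pow_eq_exp, two_pow_eq_exp,
        ← Real.exp_sub, Real.exp_le_exp]
      push_cast
      nlinarith
    have e3 : lam' ^ 2 ≤ lam' := by nlinarith
    linarith
  have hsplit : ∀ F D : ℝ, 3 * θ / 4 + 2 ^ t / (4 * θ ^ 3) * (16 ^ l / 4 ^ t + F * D) =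
      θ + 2 ^ t / (4 * θ ^ 3) * F * D := by
    intro F D
    have e1 : (2 : ℝ) ^ t / (4 * θ ^ 3) * (16 ^ l / 4 ^ t) = θ / 4 := by
      rw [hθ4, show (4 : ℝ) ^ t = 2 ^ t * 2 ^ t by rw [← mul_pow]; norm_num]
      field_simp
    rw [mul_add, e1]
    ring
  rw [hsplit]
  have hD0 : 0 ≤ 64 ^ l' / 2 ^ n + lam' ^ 2 := by positivity
  have he0 : 0 ≤ 2 ^ t / (4 * θ ^ 3) * (4 * ((4 * 2 ^ t) ^ l) ^ 2 * (l : ℝ) ^ 2) := by positivity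
  generalize 64 ^ l' / 2 ^ n + lam' ^ 2 = D at hD hD0 ⊢
  generalize 2 ^ t / (4 * θ ^ 3) * (4 * ((4 * 2 ^ t) ^ l) ^ 2 * (l : ℝ) ^ 2) = e at hfac he0 ⊢
  have herr : e * D ≤ (if t = 0 then 0 else 2 ^ (t ^ 2)) * Real.exp (-y') := by
    have e1 : e * D ≤ (if t = 0 then (0 : ℝ) else 2 ^ (t ^ 2) / 2) * (2 * Real.exp (-y')) :=
      mul_le_mul hfac hD hD0 (he0.trans hfac)
    refine e1.trans (le_of_eq ?_)
    split_ifs <;> ring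
  have he1 : 0 ≤ e * D := mul_nonneg he0 hD0
  nlinarith

/-- The value with `l = ⌊c t⌋`, `l' = ⌊c n⌋` and `θ ^ 4 = 16 ^ l / 2 ^ t`. -/
theorem IsPseudoAssignment.objective_le_exp (h : IsPseudoAssignment E) {a c : ℝ} (hc : 0 < c)
    (hc12 : c ≤ 1 / 12) (hca : c ≤ a / 4) (hd1 : 1 ≤ d₁) (hdn : d₁ ≤ n) (hd2 : d₂ ≤ n)
    (hn : a * n ≤ 2 ^ d₁) (ht : a * t ≤ 2 ^ d₂) {ε η : ℝ}
    (h0 : 0 < ε) (h1 : ε < 1) (h0' : 0 < η) (h1' : η < 1) :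
    E (shortCodeGame n t d₁ d₂ ε η).objective ≤
      Real.exp (-(ε * ((1 / 2) ^ 17 * (c * t)) / 32)) +
        (if t = 0 then 0 else 2 ^ (t ^ 2)) * Real.exp (-(η * ((1 / 2) ^ 17 * (c * n)))) := by
  obtain ⟨hl12, hl4, hle, hlf⟩ := floor_bounds hc hc12 hca ht
  obtain ⟨hl12', hl4', hle', hlf'⟩ := floor_bounds hc hc12 hca hn
  have hct : 0 ≤ c * t := by positivity
  have hcn : 0 ≤ c * n := by positivity
  have hs : ∀ {e : ℝ} (m : ℕ), 0 < e → e < 1 → e * ((1 / 2) ^ 17 * (c * m)) ≤ m / 2 ^ 17 := by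
    intro e m he0 he1
    have e1 : e * ((1 / 2) ^ 17 * (c * m)) ≤ 1 * ((1 / 2) ^ 17 * (1 * m)) := by
      gcongr
      linarith
    refine e1.trans (le_of_eq ?_)
    ring
  exact (h.objective_le hd1 hdn hd2 hl4 hl4' h0 h1 h0' h1' (Real.exp_pos _)).trans
    (value_bound_le_exp hl12 hl12' (decay_le_one _ _ h0 h1) (decay_nonneg _ _ _)
      (decay_le_one _ _ h0' h1') (by positivity) (hs t h0 h1) (hs n h0' h1') (decay_nonneg _ _ _)
      (decay_le_exp h0 h1 hct hlf hle) (decay_le_exp h0' h1' hcn hlf' hle') rfl)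

/-- The bound in terms of the alphabet sizes; the error term is absent for the trivial alphabet. -/
theorem sosValue_shortCodeGame_le {a c : ℝ} (hc : 0 < c)
    (hc12 : c ≤ 1 / 12) (hca : c ≤ a / 4) (hd1 : 1 ≤ d₁) (hdn : d₁ ≤ n) (hd2 : d₂ ≤ n)
    (hn : a * n ≤ 2 ^ d₁) (ht : a * t ≤ 2 ^ d₂) {ε η : ℝ}
    (h0 : 0 < ε) (h1 : ε < 1) (h0' : 0 < η) (h1' : η < 1) :
    (shortCodeGame n t d₁ d₂ ε η).sosValue 8 ≤
      ((Real.exp (-(ε * ((1 / 2) ^ 17 * (c * t)) / 32)) +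
        (if t = 0 then 0 else 2 ^ (t ^ 2)) * Real.exp (-(η * ((1 / 2) ^ 17 * (c * n)))) : ℝ) :
        EReal) := by
  refine sSup_le ?_
  rintro v ⟨E, hE, hC, rfl⟩
  rw [EReal.coe_le_coe_iff]
  exact IsPseudoAssignment.objective_le_exp ⟨hE, hC⟩ hc hc12 hca hd1 hdn hd2 hn ht h0 h1 h0' h1'

end Parameters

theorem mainTheorem7 (a : ℝ) (ha : 0 < a) :
    ∃ (c C : ℝ) (K : ℝ → ℝ), 0 < c ∧ 0 < C ∧
      ∀ (n t d₁ d₂ : ℕ) (ε η k R : ℝ),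
        k = 2 ^ t → R = 2 ^ n →
        1 ≤ d₁ → d₁ ≤ n → d₂ ≤ n →
        a * Real.logb 2 R ≤ 2 ^ d₁ → a * Real.logb 2 k ≤ 2 ^ d₂ →
        0 < ε → ε < 1 → 0 < η → η < 1 →
          (shortCodeGame n t d₁ d₂ ε η).sosValue 8 ≤
            ((1 / k ^ (c * ε) + k ^ (C * Real.log k) * R ^ (-(c * η)) : ℝ) : EReal) ∧
          ∀ ν : ℝ, 0 < ν → K ν * (Real.log k) ^ 2 / η ≤ Real.log R →
            (shortCodeGame n t d₁ d₂ ε η).sosValue 8 ≤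
              (((1 + ν) * (1 / k ^ (c * ε)) : ℝ) : EReal) := by
  have hc' : 0 < min (1 / 12) (a / 4) := by positivity
  set c' := min (1 / 12) (a / 4)
  set c : ℝ := (1 / 2) ^ 22 * c' with hc
  have hc0 : 0 < c := by positivity
  have hlog := Real.log_two_gt_d9
  have hlog' := Real.log_two_lt_d9
  -- `K ν` makes `c * η * log R` at least the sum of `2 * L ^ 2`, `c * ε * L` and `|log ν|`, where
  -- `L = log k ≥ log 2`; for the trivial alphabet `k = 1` there is no error term
  refine ⟨c, 2, fun ν => (2 + c / Real.log 2 + |Real.log ν| / Real.log 2 ^ 2) / c, hc0, two_pos, ?_⟩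
  rintro n t d₁ d₂ ε η k R rfl rfl hd1 hdn hd2 hR hk h0 h1 h0' h1'
  have hlogb : ∀ m : ℕ, Real.logb 2 ((2 : ℝ) ^ m) = m := fun m => by
    rw [Real.logb_pow, Real.logb_self_eq_one (by norm_num), mul_one]
  rw [hlogb] at hR hk
  have hval := sosValue_shortCodeGame_le hc' (min_le_left _ _) (min_le_right _ _) hd1 hdn hd2
    hR hk h0 h1 h0' h1'
  have hlogk : Real.log ((2 : ℝ) ^ t) = t * Real.log 2 := Real.log_pow _ _
  have hlogR : Real.log ((2 : ℝ) ^ n) = n * Real.log 2 := Real.log_pow _ _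
  have ht0 : (0 : ℝ) ≤ t := Nat.cast_nonneg t
  have hn0 : (0 : ℝ) ≤ n := Nat.cast_nonneg n
  have hmain : 1 / ((2 : ℝ) ^ t) ^ (c * ε) = Real.exp (-(t * Real.log 2 * (c * ε))) := by
    rw [Real.rpow_def_of_pos (by positivity), hlogk, one_div, Real.exp_neg]
  have hkC : ((2 : ℝ) ^ t) ^ (2 * (t * Real.log 2)) =
      Real.exp (t * Real.log 2 * (2 * (t * Real.log 2))) := by
    rw [Real.rpow_def_of_pos (by positivity), hlogk]
  have hRc : ((2 : ℝ) ^ n) ^ (-(c * η)) = Real.exp (n * Real.log 2 * (-(c * η))) := by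
    rw [Real.rpow_def_of_pos (by positivity), hlogR]
  have e1 : Real.exp (-(ε * ((1 / 2) ^ 17 * (c' * t)) / 32)) ≤
      Real.exp (-(t * Real.log 2 * (c * ε))) := by
    rw [Real.exp_le_exp, neg_le_neg_iff]
    calc t * Real.log 2 * (c * ε) ≤ t * 1 * (c * ε) := by gcongr; linarith
      _ = _ := by rw [hc]; ring
  have e2 : Real.exp (-(η * ((1 / 2) ^ 17 * (c' * n)))) ≤
      Real.exp (n * Real.log 2 * (-(c * η))) := by
    rw [Real.exp_le_exp, mul_neg, neg_le_neg_iff]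
    calc n * Real.log 2 * (c * η) ≤ n * 1 * (c * η) := by gcongr; linarith
      _ = η * ((1 / 2) ^ 22 * (c' * n)) := by rw [hc]; ring
      _ ≤ η * ((1 / 2) ^ 17 * (c' * n)) := by gcongr ?_ * (?_ * _); norm_num
  have e3 : (2 : ℝ) ^ (t ^ 2) ≤ Real.exp (t * Real.log 2 * (2 * (t * Real.log 2))) := by
    rw [two_pow_eq_exp, Real.exp_le_exp]
    push_cast
    nlinarith [sq_nonneg (t : ℝ), mul_nonneg (sq_nonneg (t : ℝ)) (by linarith : 0 ≤ Real.log 2)]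
  rw [hmain, hlogk, hkC, hRc, hlogR]
  refine ⟨hval.trans ?_, fun ν hν hK => hval.trans ?_⟩
  · rw [EReal.coe_le_coe_iff]
    refine add_le_add e1 ?_
    split_ifs
    · rw [zero_mul]; positivity
    · gcongr
  · rw [EReal.coe_le_coe_iff, add_mul, one_mul]
    refine add_le_add e1 ?_
    split_ifs with ht
    · rw [zero_mul]; positivity
    · have ht1 : (1 : ℝ) ≤ t := by exact_mod_cast Nat.one_le_iff_ne_zero.2 ht
      set L : ℝ := t * Real.log 2 with hL
      have hL2 : Real.log 2 ≤ L := by nlinarith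
      have hK' : (2 + c / Real.log 2 + |Real.log ν| / Real.log 2 ^ 2) * L ^ 2 ≤
          c * η * (n * Real.log 2) := by
        rw [div_le_iff₀ h0', div_mul_eq_mul_div, div_le_iff₀ hc0] at hK
        linarith
      have f1 : c * ε * L ≤ c / Real.log 2 * L ^ 2 := by
        rw [div_mul_eq_mul_div, le_div_iff₀ (by linarith)]
        have g1 : L * Real.log 2 ≤ L ^ 2 := by nlinarith
        have g2 : c * ε * (L * Real.log 2) ≤ c * 1 * (L ^ 2) := by gcongr
        linarith
      have f2 : |Real.log ν| ≤ |Real.log ν| / Real.log 2 ^ 2 * L ^ 2 := by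
        rw [div_mul_eq_mul_div, le_div_iff₀ (by positivity)]
        gcongr
      have f3 := neg_abs_le (Real.log ν)
      calc (2 : ℝ) ^ (t ^ 2) * Real.exp (-(η * ((1 / 2) ^ 17 * (c' * n))))
          ≤ Real.exp (L * (2 * L)) * Real.exp (n * Real.log 2 * (-(c * η))) := by gcongr
        _ ≤ Real.exp (Real.log ν) * Real.exp (-(L * (c * ε))) := by
            rw [← Real.exp_add, ← Real.exp_add, Real.exp_le_exp]
            linarith
        _ = ν * Real.exp (-(L * (c * ε))) := by rw [Real.exp_log hν]
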